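/- **Setting.** Let $E$ be a measurable space, $m\neq 0$ a finite measure on $E$, $V:E\to\mathbb R$ measurable, $\beta_0\le\beta_*$ reals and $\alpha\in(0,1)$. For $\beta\in[\beta_0,\beta_*]$ let $\eta_{(\beta)}(dx)\propto e^{-\beta V(x)}m(dx)$ be the tempered probability measure. For $n\ge1$ let $\xi_n:E\to\mathbb R^d$ be measurable with range in a convex set $\mathrm{Dom}(\xi_n)\subset\mathbb R^d$, and let $M_{n,\xi,\beta}$ be Markov kernels on $E$, jointly measurable in the parameters and the state, with $\eta_{(\beta)}M_{n,\xi,\beta}=\eta_{(\beta)}$ for all $\xi\in\mathrm{Dom}(\xi_n)$, $\beta\in[\beta_0,\beta_*]$. For $\theta=(\beta_1,\beta_2,\xi)$ put $G_\theta=e^{-(\beta_2-\beta_1)V}$ and $Q_{n,\theta}\phi=G_\theta\cdot M_{n,\xi,\beta_2}\phi$. Let $\mathrm{ESS}(\eta,\omega)=\eta(\omega)^2/\eta(\omega^2)$. *Limiting quantities.* $\beta_0$ is given, $\eta_n=\eta_{(\beta_n)}$ and, with $\inf\varnothing=\beta_*$, $$\beta_{n+1}=\inf\{\beta_n<\beta\le\beta_*:\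 \mathrm{ESS}(\eta_n,e^{-(\beta-\beta_n)V})=\alpha\}.$$ Let $\gamma_n(\phi)=m(e^{-\beta_nV}\phi)/m(e^{-\beta_0V})$ (so $\gamma_0=\eta_0$), $\theta_n=(\beta_n,\beta_{n+1},\eta_n(\xi_{n+1}))$, $G_n=G_{\theta_n}$, $\Delta_n=\beta_{n+1}-\beta_n$, $Q_n=Q_{n,\theta_{n-1}}$. *Algorithm.* For each $N$, the particles $x_0^1,\dots,x_0^N$ are i.i.d. from $\eta_0$. Let $\eta_n^N=\frac1N\sum_i\delta_{x_n^i}$, $\beta_0^N=\beta_0$, $\beta^N_{n+1}=\inf\{\beta_n^N<\beta\le\beta_*:\mathrm{ESS}(\eta_n^N,e^{-(\beta-\beta_n^N)V})=\alpha\}$ and $\theta_n^N=(\beta_n^N,\beta_{n+1}^N,\eta_n^N(\xi_{n+1}))$. Given the history up to time $n$, the particles $x_{n+1}^1,\dots,x_{n+1}^N$ are i.i.d. from $\phi\mapsto\eta_n^N(Q_{n+1,\theta_n^N}\phi)/\eta_n^N(G_{\theta_n^N})$. Put $\gamma_n^N(\phi)=\{\prod_{p<n}\eta_p^N(G_{\theta_p^N})\}\,\eta_n^N(\phi)$.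 *Assumptions.* Let $D_n=\{(\beta_1,\beta_2,\xi):\beta_0\le\beta_1\le\beta_2\le\beta_*,\ \xi\in\mathrm{Dom}(\xi_n)\}$. (A3) $V$ and the $\xi_n$ are bounded; for every $n\ge1$ and every bounded measurable $\phi:E\to\mathbb R$, the functions $(x,\theta)\mapsto G_\theta(x)$ and $(x,\theta)\mapsto Q_{n,\theta}\phi(x)$ are bounded on $E\times D_n$ and continuous at $\theta=\theta_{n-1}$ (within $D_n$) uniformly in $x\in E$. (A4) For every $n\ge1$ and bounded measurable $\phi$, the derivative $\partial_\theta Q_{n,\theta}\phi(x)$ exists (within $D_n$), is bounded on $E\times D_n$ and is continuous at $\theta=\theta_{n-1}$ uniformly in $x\in E$. *Covariances.* For $\phi=(\phi^1,\dots,\phi^r)$ let $\widetilde\Sigma_\eta(\phi)$ be the covariance matrix of $(0,\phi)^\top$ under $\eta$ and $$\mathrm{Ext}_n(\phi)=\big(G_n-\eta_n(G_n),\ G_n^2-\eta_n(G_n^2),\ \phi\big)^\top .$$ For $n\ge1$ let $\mathcal A_n=\mathcal A_n(\phi)$ be the following $(r+1)\times(r+3)$ matrix. If $\beta_n<\beta_*$,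 put $\rho_n=\partial_\Delta\,\mathrm{ESS}(\eta_{n-1},e^{-\Delta V})|_{\Delta=\Delta_{n-1}}$ and $$[\mathcal A_n]_{1,1}=1,\quad [\mathcal A_n]_{1,2}=\frac{-2}{\gamma_{n-1}(1)}\,\frac{\eta_{n-1}(G_{n-1})}{\eta_{n-1}(G_{n-1}^2)}\,\rho_n^{-1},\quad [\mathcal A_n]_{1,3}=\frac{1}{\gamma_{n-1}(1)}\,\frac{\eta_{n-1}(G_{n-1})^2}{\eta_{n-1}(G_{n-1}^2)^2}\,\rho_n^{-1},\quad [\mathcal A_n]_{1,4:r+3}=0,$$ $$[\mathcal A_n]_{2:r+1,1}=\gamma_{n-1}(1)\,\eta_{n-1}\big[(\partial_{\beta_{n-1}}+\partial_{\beta_n})Q_n\phi\big],\qquad [\mathcal A_n]_{2:r+1,j}=\gamma_{n-1}(1)\,\eta_{n-1}[\partial_{\beta_n}Q_n\phi]\,[\mathcal A_n]_{1,j}\ (j=2,3),\qquad [\mathcal A_n]_{2:r+1,4:r+3}=I_r .$$ Here $\partial_{\beta_{n-1}},\partial_{\beta_n}$ are the derivatives in the first and second components of $\theta$ at $\theta_{n-1}$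 (one-sided at an end point of the domain). If $\beta_n=\beta_*$, then the first row of $\mathcal A_n$ is $0$, $[\mathcal A_n]_{2:r+1,1}=\gamma_{n-1}(1)\,\eta_{n-1}[\partial_{\beta_{n-1}}Q_n\phi]$, $[\mathcal A_n]_{2:r+1,2}=[\mathcal A_n]_{2:r+1,3}=0$ and $[\mathcal A_n]_{2:r+1,4:r+3}=I_r$. **Theorem (CLT, adaptive tempering).** Assume (A3)–(A4). Let $n\ge0$, and suppose that $\mathrm{ESS}(\eta_k,e^{-(\beta_*-\beta_k)V})\neq\alpha$ for every $0\le k<n$ (the threshold is not attained exactly at $\beta_*$). Let $\phi:E\to\mathbb R^r$ be bounded and measurable. Then, as $N\to\infty$, the vector $\sqrt N\,\big(\beta_n^N-\beta_n,\ [\gamma_n^N-\gamma_n](\phi)\big)^\top$ converges weakly to a centred Gaussian distribution with covariance $\Sigma_n(\phi)$, where $\Sigma_0(\phi)=\gamma_0(1)^2\,\widetilde\Sigma_{\eta_0}(\phi)$ and, for $n\ge1$, $$\Sigma_n(\phi)=\mathcal A_n(\phi)\,\Sigma_{n-1}\big(\mathrm{Ext}_{n-1}(Q_n\phi)\big)\,\mathcal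 A_n(\phi)^\top+\gamma_n(1)^2\,\widetilde\Sigma_{\eta_n}(\phi).$$ -/

import Mathlib

open MeasureTheory ProbabilityTheory Filter Topology
open scoped ENNReal

noncomputable section

/-- The data of the adaptive tempering algorithm on a measurable space `E`, with summary statistics
in `ℝ^d`: a dominating measure `m`, a potential `V`, inverse temperatures `β₀ ≤ βs`, an ESS
threshold `α ∈ (0,1)`, statistics `ξ n : E → ℝ^d` (used for `n ≥ 1`), convex sets `domξ n` containing
their ranges, and Markov kernels `M n` depending (jointly measurably) on a parameter `(ξ, β)`, that
leave the measure `e^{-β V} m` invariant. -/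
structure AdaptiveTempering (E : Type*) [MeasurableSpace E] (d : ℕ) where
  m : Measure E
  V : E → ℝ
  β₀ : ℝ
  βs : ℝ
  α : ℝ
  ξ : ℕ → E → EuclideanSpace ℝ (Fin d)
  domξ : ℕ → Set (EuclideanSpace ℝ (Fin d))
  M : ℕ → Kernel ((EuclideanSpace ℝ (Fin d) × ℝ) × E) E
  finite_m : IsFiniteMeasure m
  m_ne_zero : m ≠ 0
  measurable_V : Measurable V
  β₀_le_βs : β₀ ≤ βs
  α_pos : 0 < α
  α_lt_one : α < 1
  measurable_ξ : ∀ n, Measurable (ξ n)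
  convex_domξ : ∀ n, Convex ℝ (domξ n)
  range_ξ : ∀ n, Set.range (ξ n) ⊆ domξ n
  markov_M : ∀ n, IsMarkovKernel (M n)
  invariant_M : ∀ n, ∀ z ∈ domξ n, ∀ b ∈ Set.Icc β₀ βs,
    ((M n).sectR (z, b)).Invariant (m.withDensity fun x => ENNReal.ofReal (Real.exp (-b * V x)))

namespace AdaptiveTempering

/-- `ESS(η, ω) = η(ω)² / η(ω²)`. -/
def ESS {E : Type*} [MeasurableSpace E] (η : Measure E) (ω : E → ℝ) : ℝ :=
  (∫ x, ω x ∂η) ^ 2 / ∫ x, ω x ^ 2 ∂η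

/-- The covariance matrix `Σ_η(f)` of a vector of functions under `η`. -/
def covMatrix {E : Type*} [MeasurableSpace E] (η : Measure E) {k : ℕ} (f : Fin k → E → ℝ) :
    Matrix (Fin k) (Fin k) ℝ :=
  Matrix.of fun i j => cov[f i, f j; η]

/-- Bounded measurable real functions. -/
def IsTest {E : Type*} [MeasurableSpace E] (φ : E → ℝ) : Prop :=
  Measurable φ ∧ ∃ C : ℝ, ∀ x, |φ x| ≤ C

/-- The empirical measure `N⁻¹ ∑ᵢ δ_{xᵢ}`. -/
def empirical {E : Type*} [MeasurableSpace E] {N : ℕ} (x : Fin N → E) : Measure E :=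
  (N : ℝ≥0∞)⁻¹ • ∑ i, Measure.dirac (x i)

/-- The parameters `θ = (β₁, β₂, ξ)`. -/
abbrev Param (d : ℕ) : Type := ℝ × ℝ × EuclideanSpace ℝ (Fin d)

section

variable {E : Type*} [MeasurableSpace E] {d : ℕ} (S : AdaptiveTempering E d)

/-! ### The perfect algorithm -/

/-- The probability measure `Z(b)⁻¹ e^{-b V} m`. -/
def gibbs (b : ℝ) : Measure E :=
  let μ := S.m.withDensity fun x => ENNReal.ofReal (Real.exp (-b * S.V x))
  (μ Set.univ)⁻¹ • μ

open Classical in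
/-- The next inverse temperature, from a measure `η` and the current inverse temperature `b`:
`inf {b < β ≤ βs : ESS(η, e^{-(β-b)V}) = α}`, with `inf ∅ = βs`. -/
def nextTemp (η : Measure E) (b : ℝ) : ℝ :=
  let T : Set ℝ :=
    {β | b < β ∧ β ≤ S.βs ∧ ESS η (fun x => Real.exp (-(β - b) * S.V x)) = S.α}
  if T.Nonempty then sInf T else S.βs

/-- The limiting inverse temperatures `β_n`. -/
def temp : ℕ → ℝ
  | 0 => S.β₀
  | n + 1 => S.nextTemp (S.gibbs (temp n)) (temp n)

/-- The target distributions `η_n`. -/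
def target (n : ℕ) : Measure E := S.gibbs (S.temp n)

/-- The unnormalised distributions `γ_n(φ)`, i.e. integration against `e^{-β_n V} m`, scaled so that
`γ_0 = η_0`. -/
def unnorm (n : ℕ) (φ : E → ℝ) : ℝ :=
  (∫ x, Real.exp (-S.temp n * S.V x) * φ x ∂S.m) / ∫ x, Real.exp (-S.temp 0 * S.V x) ∂S.m

/-- The potential `G_θ(x) = e^{-(β₂ - β₁) V(x)}` for `θ = (β₁, β₂, ξ)`. -/
def potential (θ : Param d) (x : E) : ℝ := Real.exp (-(θ.2.1 - θ.1) * S.V x)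

/-- The function `Q_{n,θ} φ = G_θ · M_{n,ξ,β₂} φ` for `θ = (β₁, β₂, ξ)`. -/
def Q (n : ℕ) (θ : Param d) (φ : E → ℝ) (x : E) : ℝ :=
  S.potential θ x * ∫ y, φ y ∂S.M n ((θ.2.2, θ.2.1), x)

/-- The limiting parameter `θ_n = (β_n, β_{n+1}, η_n(ξ_{n+1}))`. -/
def param (n : ℕ) : Param d :=
  (S.temp n, S.temp (n + 1), ∫ x, S.ξ (n + 1) x ∂S.target n)

/-- The domain `Dom(β) × Dom(ξ_n)` of the parameters. -/
def domParam (n : ℕ) : Set (Param d) :=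
  {θ | S.β₀ ≤ θ.1 ∧ θ.1 ≤ θ.2.1 ∧ θ.2.1 ≤ S.βs ∧ θ.2.2 ∈ S.domξ n}

/-! ### Assumptions -/

/-- First assumption: boundedness, and continuity at the limiting parameters uniformly on `E`. -/
structure BoundedContinuous : Prop where
  bounded_V : ∃ C : ℝ, ∀ x, |S.V x| ≤ C
  bounded_G : ∀ n, ∃ C : ℝ, ∀ x, ∀ θ ∈ S.domParam (n + 1), |S.potential θ x| ≤ C
  continuous_G : ∀ n, TendstoUniformly (fun θ x => S.potential θ x) (S.potential (S.param n))
    (𝓝[S.domParam (n + 1)] S.param n)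
  bounded_ξ : ∀ n, ∃ C : ℝ, ∀ x, ‖S.ξ n x‖ ≤ C
  bounded_Q : ∀ n φ, IsTest φ →
    ∃ C : ℝ, ∀ x, ∀ θ ∈ S.domParam (n + 1), |S.Q (n + 1) θ φ x| ≤ C
  continuous_Q : ∀ n φ, IsTest φ →
    TendstoUniformly (fun θ x => S.Q (n + 1) θ φ x) (S.Q (n + 1) (S.param n) φ)
      (𝓝[S.domParam (n + 1)] S.param n)

/-- Second assumption: the derivative `D x θ = ∂_θ Q_{n+1,θ} φ (x)` exists on the domain of the
parameters, is bounded, and is continuous at the limiting parameter uniformly on `E`. -/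
def DifferentiableKernels : Prop :=
  ∀ n φ, IsTest φ → ∃ D : E → Param d → (Param d →L[ℝ] ℝ),
    (∀ x, ∀ θ ∈ S.domParam (n + 1), HasFDerivWithinAt (fun θ' => S.Q (n + 1) θ' φ x) (D x θ)
      (S.domParam (n + 1)) θ) ∧
    (∃ C : ℝ, ∀ x, ∀ θ ∈ S.domParam (n + 1), ‖D x θ‖ ≤ C) ∧
    TendstoUniformly (fun θ x => D x θ) (fun x => D x (S.param n))
      (𝓝[S.domParam (n + 1)] S.param n)

/-! ### The asymptotic covariance -/

/-- The limiting potential `G_n = e^{-(β_{n+1} - β_n) V}`. -/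
def G (n : ℕ) : E → ℝ := S.potential (S.param n)

/-- The vector `Q_{n+1} φ` at the limiting parameter. -/
def Qlim (n : ℕ) {r : ℕ} (φ : Fin r → E → ℝ) : Fin r → E → ℝ :=
  fun i => S.Q (n + 1) (S.param n) (φ i)

/-- `Ext_n(φ) = (G_n - η_n(G_n), G_n² - η_n(G_n²), φ)`. -/
def Ext (n : ℕ) {r : ℕ} (φ : Fin r → E → ℝ) : Fin (r + 2) → E → ℝ :=
  Fin.cons (fun x => S.G n x - ∫ y, S.G n y ∂S.target n)
    (Fin.cons (fun x => S.G n x ^ 2 - ∫ y, S.G n y ^ 2 ∂S.target n) φ)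

/-- `η_n[∂_{β_n} Q_{n+1} φ]`, with the first inverse temperature varying in `[β₀, β_{n+1}]`. -/
def dQfst (n : ℕ) (φ : E → ℝ) : ℝ :=
  ∫ x, derivWithin (fun t => S.Q (n + 1) (t, (S.param n).2) φ x)
    (Set.Icc S.β₀ (S.temp (n + 1))) (S.temp n) ∂S.target n

/-- `η_n[∂_{β_{n+1}} Q_{n+1} φ]`, with the second inverse temperature varying in `[β_n, βs]`. -/
def dQsnd (n : ℕ) (φ : E → ℝ) : ℝ :=
  ∫ x, derivWithin (fun t => S.Q (n + 1) (S.temp n, t, (S.param n).2.2) φ x)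
    (Set.Icc (S.temp n) S.βs) (S.temp (n + 1)) ∂S.target n

/-- `∂_Δ [η_n(G_n)² / η_n(G_n²)]`, i.e. the derivative of `Δ ↦ ESS(η_n, e^{-ΔV})` at
`Δ_n = β_{n+1} - β_n`. -/
def dESS (n : ℕ) : ℝ :=
  deriv (fun Δ => ESS (S.target n) fun x => Real.exp (-Δ * S.V x)) (S.temp (n + 1) - S.temp n)

/-- The entry `[𝒜_{n+1}]_{1,2}` when `β_{n+1} < βs`. -/
def A12 (n : ℕ) : ℝ :=
  -2 * (S.unnorm n fun _ => 1)⁻¹ *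
    ((∫ x, S.G n x ∂S.target n) / ∫ x, S.G n x ^ 2 ∂S.target n) * (S.dESS n)⁻¹

/-- The entry `[𝒜_{n+1}]_{1,3}` when `β_{n+1} < βs`. -/
def A13 (n : ℕ) : ℝ :=
  (S.unnorm n fun _ => 1)⁻¹ *
    ((∫ x, S.G n x ∂S.target n) ^ 2 / (∫ x, S.G n x ^ 2 ∂S.target n) ^ 2) * (S.dESS n)⁻¹

open Classical in
/-- The `(r+1) × (r+3)` matrix `𝒜_{n+1}(φ)`. In the second case (`β_{n+1} = βs`, the inverse
temperature no longer fluctuates) the first row is zero and the derivative in `β_{n+1}` is absent. -/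
def A (n : ℕ) {r : ℕ} (φ : Fin r → E → ℝ) : Matrix (Fin (r + 1)) (Fin (r + 2 + 1)) ℝ :=
  let g : ℝ := S.unnorm n fun _ => 1
  if S.temp (n + 1) < S.βs then
    Matrix.of (Fin.cons
      (Fin.cons 1 (Fin.cons (S.A12 n) (Fin.cons (S.A13 n) fun _ => 0)))
      fun i => Fin.cons (g * (S.dQfst n (φ i) + S.dQsnd n (φ i)))
        (Fin.cons (g * S.dQsnd n (φ i) * S.A12 n)
          (Fin.cons (g * S.dQsnd n (φ i) * S.A13 n) fun j => if i = j then 1 else 0)))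
  else
    Matrix.of (Fin.cons (fun _ => 0)
      fun i => Fin.cons (g * S.dQfst n (φ i))
        (Fin.cons 0 (Fin.cons 0 fun j => if i = j then 1 else 0)))

/-- The covariance `Σ_n(φ)`, defined by the recursion
`Σ_n(φ) = 𝒜_n(φ) Σ_{n-1}(Ext_{n-1}(Q_n φ)) 𝒜_n(φ)ᵀ + γ_n(1)² Σ_{η_n}((0, φ))`,
with `Σ_0(φ) = γ_0(1)² Σ_{η_0}((0, φ))`. -/
def asympCov : (n : ℕ) → {r : ℕ} → (Fin r → E → ℝ) → Matrix (Fin (r + 1)) (Fin (r + 1)) ℝ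
  | 0, _, φ =>
    (S.unnorm 0 fun _ => 1) ^ 2 • covMatrix (S.target 0) (Fin.cons (fun _ => 0) φ)
  | n + 1, _, φ =>
    S.A n φ * asympCov n (S.Ext n (S.Qlim n φ)) * (S.A n φ).transpose +
      (S.unnorm (n + 1) fun _ => 1) ^ 2 •
        covMatrix (S.target (n + 1)) (Fin.cons (fun _ => 0) φ)

/-! ### The practical algorithm: quantities attached to a particle path `x n i` -/

/-- The inverse temperatures `β_n^N`. -/
def tempN {N : ℕ} (x : ℕ → Fin N → E) : ℕ → ℝ
  | 0 => S.β₀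
  | n + 1 => S.nextTemp (empirical (x n)) (tempN x n)

/-- The parameter `θ_n^N = (β_n^N, β_{n+1}^N, η_n^N(ξ_{n+1}))`. -/
def paramN {N : ℕ} (x : ℕ → Fin N → E) (n : ℕ) : Param d :=
  (S.tempN x n, S.tempN x (n + 1), ∫ y, S.ξ (n + 1) y ∂empirical (x n))

/-- `γ_n^N(φ) = {∏_{p<n} η_p^N(G_{p,N})} η_n^N(φ)`. -/
def unnormN {N : ℕ} (x : ℕ → Fin N → E) (n : ℕ) (φ : E → ℝ) : ℝ :=
  (∏ p ∈ Finset.range n, ∫ y, S.potential (S.paramN x p) y ∂empirical (x p)) *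
    ∫ y, φ y ∂empirical (x n)

/-- The sampling distribution `μ(G_θ M_{n,θ}) / μ(G_θ)`. -/
def Phi (n : ℕ) (θ : Param d) (μ : Measure E) : Measure E :=
  let w := μ.withDensity fun y => ENNReal.ofReal (S.potential θ y)
  (w Set.univ)⁻¹ • w.bind ((S.M n).sectR (θ.2.2, θ.2.1))

/-- The history of the particle system up to time `n`, as a σ-algebra. -/
abbrev history {Ω : Type*} {N : ℕ} (X : ℕ → Fin N → Ω → E) (n : ℕ) : MeasurableSpace Ω :=
  MeasurableSpace.comap (fun ω (p : Fin (n + 1)) (i : Fin N) => X p i ω) MeasurableSpace.pi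

/-- `X n i`, `i = 1, …, N`, is the particle system of the practical algorithm: the initial particles
are i.i.d. from `η_0`, and given the history up to time `n` the particles at time `n + 1` are i.i.d.
from `Φ_{n+1,N}(η_n^N)`. -/
structure IsParticleSystem {Ω : Type*} [MeasurableSpace Ω] (P : Measure Ω) {N : ℕ}
    (X : ℕ → Fin N → Ω → E) : Prop where
  measurable : ∀ n i, Measurable (X n i)
  initial : P.map (fun ω i => X 0 i ω) = Measure.pi fun _ => S.target 0
  step : ∀ n (B : Fin N → Set E), (∀ i, MeasurableSet (B i)) →
    P[(⋂ i, X (n + 1) i ⁻¹' B i).indicator (fun _ => (1 : ℝ)) | history X n] =ᵐ[P]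
      fun ω => ∏ i, (S.Phi (n + 1) (S.paramN (fun p j => X p j ω) n)
        (empirical fun j => X n j ω)).real (B i)

/-- The rescaled error `√N (β_n^N - β_n, [γ_n^N - γ_n](φ))`. -/
def rescaledError {N : ℕ} (n : ℕ) {r : ℕ} (φ : Fin r → E → ℝ) (x : ℕ → Fin N → E) :
    EuclideanSpace ℝ (Fin (r + 1)) :=
  WithLp.toLp 2 (Fin.cons (√(N : ℝ) * (S.tempN x n - S.temp n))
    fun i => √(N : ℝ) * (S.unnormN x n (φ i) - S.unnorm n (φ i)))

end

end AdaptiveTempering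

end

/-! Everything is reduced to characteristic functions. `HasCLT` at time `n` says that, for every
real `s` and every bounded measurable `ψ`, the expectation of exp(i(s√N(β_n^N - β_n) + √N[γ_n^N -
γ_n](ψ))) tends to exp(-`limitVar n s ψ`/2). It is proved by induction on `n` (`hasCLT_zero`,
`HasCLT.succ`). Quantifying over all pairs `(s, ψ)` makes the induction close: the step at `(s, ψ)`
uses the previous statement at another pair, (`pullCoef`, `pullFun`), which is the action of the
transpose of 𝒜.

In one step, `tempErr_add_unnormErr_succ` splits the error into a part determined by the generations
up to `n` and a weighted sampling error. Given the past, the new particles are i.i.d., so the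
conditional characteristic function of the sampling error is an N-th power. It is compared with a
Gaussian factor by an estimate that is uniform in the law (`exists_norm_charFun_pow_sub_le`), since
that law is random. The limits multiply, so the variances add.

The part determined by the past is linearised (`HasCLT.tendsto_step_sub`). For the inverse
temperature this is an implicit-function argument on the ESS equation (`tendsto_increment_sub`): the
slope is nonzero because the ESS is strictly decreasing unless V is almost surely constant. If
β_{n+1} = βs and the threshold is not attained there, the random temperature equals βs with high
probability and does not fluctuate. For the kernels (`HasCLT.tendsto_unnormN_Q_sub`), the empirical
measure may be replaced by η_n in the increment of Q_θψ: the derivative at θ_n involves only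
finitely many test functions (`tendsto_integral_Q_sub_div`). By invariance, η_n(Q_θψ) then depends
to first order on the two temperatures alone, so the fluctuation of the statistic drops out.

The consistency used along the way comes from the central limit theorem at the same time:
convergence of characteristic functions gives tightness, hence boundedness at scale √N. Convergence
in probability is convergence along the filter `highProb P`, so the ordinary calculus of limits
applies to it. Finally `dotProduct_asympCov_mulVec` identifies `limitVar` with the quadratic form of
the covariance matrix, and Lévy's continuity theorem concludes. -/

noncomputable section

namespace AdaptiveTempering

/-! ### Convergence and boundedness in probability along a sequence of probability spaces -/

section HighProb

variable {Ω : ℕ → Type*} [∀ N, MeasurableSpace (Ω N)] {P : ∀ N, Measure (Ω N)}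

/-- The filter of the events whose probability tends to one along a sequence of probability
spaces. Convergence along it is convergence in probability. -/
def highProb (P : ∀ N, Measure (Ω N)) : Filter (Σ N, Ω N) where
  sets := {A | Tendsto (fun N => P N {ω | (⟨N, ω⟩ : Σ N, Ω N) ∉ A}) atTop (𝓝 0)}
  univ_sets := by simp
  sets_of_superset := by
    intro A B hA hAB
    refine tendsto_of_tendsto_of_tendsto_of_le_of_le tendsto_const_nhds hA
      (fun _ => zero_le) fun N => ?_
    exact measure_mono fun ω hω h => hω (hAB h)
  inter_sets := by
    intro A B hA hB
    have h := Tendsto.add hA hB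
    rw [add_zero] at h
    refine tendsto_of_tendsto_of_tendsto_of_le_of_le tendsto_const_nhds h
      (fun _ => zero_le) fun N => ?_
    refine le_trans (measure_mono fun ω hω => ?_) (measure_union_le _ _)
    by_contra hc
    simp only [Set.mem_union, Set.mem_ofPred_eq, not_or, not_not] at hc
    exact hω hc

lemma eventually_highProb {p : (Σ N, Ω N) → Prop} :
    (∀ᶠ i in highProb P, p i) ↔ Tendsto (fun N => P N {ω | ¬ p ⟨N, ω⟩}) atTop (𝓝 0) := Iff.rfl

lemma tendsto_fst_highProb : Tendsto Sigma.fst (highProb P) atTop := by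
  intro A hA
  rw [mem_map]
  change Tendsto (fun N => P N {ω | (⟨N, ω⟩ : Σ N, Ω N) ∉ Sigma.fst ⁻¹' A}) atTop (𝓝 0)
  refine tendsto_const_nhds.congr' ?_
  filter_upwards [hA] with N hN
  simp [hN]

/-- Boundedness in probability. -/
def BoundedInProb (P : ∀ N, Measure (Ω N)) (Y : (Σ N, Ω N) → ℝ) : Prop :=
  ∀ ε : ℝ≥0∞, 0 < ε → ∃ K : ℝ, ∀ᶠ N in atTop, P N {ω | K < |Y ⟨N, ω⟩|} ≤ ε

lemma BoundedInProb.mono {Y Z : (Σ N, Ω N) → ℝ} (hZ : BoundedInProb P Z)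
    (h : ∀ᶠ i in highProb P, |Y i| ≤ |Z i|) : BoundedInProb P Y := by
  intro ε hε
  obtain ⟨K, hK⟩ := hZ (ε / 2) (ENNReal.half_pos hε.ne')
  refine ⟨K, ?_⟩
  have h' := (eventually_highProb.1 h).eventually_le_const (ENNReal.half_pos hε.ne')
  filter_upwards [hK, h'] with N h1 h2
  rw [← ENNReal.add_halves ε]
  refine le_trans (measure_mono fun ω hω => ?_) ((measure_union_le _ _).trans (add_le_add h1 h2))
  by_cases hc : |Y ⟨N, ω⟩| ≤ |Z ⟨N, ω⟩|
  · exact Or.inl (lt_of_lt_of_le hω hc)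
  · exact Or.inr hc

lemma BoundedInProb.congr {Y Z : (Σ N, Ω N) → ℝ} (hZ : BoundedInProb P Z)
    (h : ∀ᶠ i in highProb P, Y i = Z i) : BoundedInProb P Y :=
  hZ.mono (h.mono fun i hi => by rw [hi])

lemma BoundedInProb.of_forall_le {Y : (Σ N, Ω N) → ℝ} {K : ℝ} (h : ∀ i, |Y i| ≤ K) :
    BoundedInProb P Y := by
  intro ε _
  refine ⟨K, Eventually.of_forall fun N => ?_⟩
  have : {ω | K < |Y ⟨N, ω⟩|} = ∅ := by
    ext ω; simpa using h ⟨N, ω⟩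
  simp [this]

lemma BoundedInProb.of_eventually_le {Y : (Σ N, Ω N) → ℝ} {K : ℝ}
    (h : ∀ᶠ i in highProb P, |Y i| ≤ K) : BoundedInProb P Y :=
  (BoundedInProb.of_forall_le (Y := fun _ => |K|) (K := |K|) fun _ => (abs_abs K).le).mono
    (h.mono fun i hi => by rw [abs_abs]; exact hi.trans (le_abs_self K))

lemma BoundedInProb.of_tendsto {Y : (Σ N, Ω N) → ℝ} {a : ℝ}
    (h : Tendsto Y (highProb P) (𝓝 a)) : BoundedInProb P Y :=
  .of_eventually_le (h.abs.eventually_le_const (lt_add_one |a|))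

lemma BoundedInProb.add {Y Z : (Σ N, Ω N) → ℝ} (hY : BoundedInProb P Y)
    (hZ : BoundedInProb P Z) : BoundedInProb P fun i => Y i + Z i := by
  intro ε hε
  obtain ⟨K, hK⟩ := hY (ε / 2) (ENNReal.half_pos hε.ne')
  obtain ⟨L, hL⟩ := hZ (ε / 2) (ENNReal.half_pos hε.ne')
  refine ⟨K + L, ?_⟩
  filter_upwards [hK, hL] with N h1 h2
  rw [← ENNReal.add_halves ε]
  refine le_trans (measure_mono fun ω hω => ?_) ((measure_union_le _ _).trans (add_le_add h1 h2))
  by_contra hc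
  simp only [Set.mem_union, Set.mem_ofPred_eq, not_or, not_lt] at hc hω
  linarith [abs_add_le (Y ⟨N, ω⟩) (Z ⟨N, ω⟩)]

lemma BoundedInProb.mul {Y Z : (Σ N, Ω N) → ℝ} (hY : BoundedInProb P Y)
    (hZ : BoundedInProb P Z) : BoundedInProb P fun i => Y i * Z i := by
  intro ε hε
  obtain ⟨K, hK⟩ := hY (ε / 2) (ENNReal.half_pos hε.ne')
  obtain ⟨L, hL⟩ := hZ (ε / 2) (ENNReal.half_pos hε.ne')
  refine ⟨|K| * |L|, ?_⟩
  filter_upwards [hK, hL] with N h1 h2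
  rw [← ENNReal.add_halves ε]
  refine le_trans (measure_mono fun ω hω => ?_) ((measure_union_le _ _).trans (add_le_add h1 h2))
  by_contra hc
  simp only [Set.mem_union, Set.mem_ofPred_eq, not_or, not_lt] at hc hω
  rw [abs_mul] at hω
  refine absurd hω (not_lt.2 ?_)
  exact mul_le_mul (hc.1.trans (le_abs_self K)) (hc.2.trans (le_abs_self L)) (abs_nonneg _)
    (abs_nonneg _)

lemma BoundedInProb.const_mul {Y : (Σ N, Ω N) → ℝ} (hY : BoundedInProb P Y) (c : ℝ) :
    BoundedInProb P fun i => c * Y i :=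
  (BoundedInProb.of_tendsto tendsto_const_nhds).mul hY

lemma BoundedInProb.abs {Y : (Σ N, Ω N) → ℝ} (hY : BoundedInProb P Y) :
    BoundedInProb P fun i => |Y i| :=
  hY.mono (Eventually.of_forall fun _ => (abs_abs _).le)

lemma BoundedInProb.sum {ι : Type*} (s : Finset ι) {Y : ι → (Σ N, Ω N) → ℝ}
    (hY : ∀ j ∈ s, BoundedInProb P (Y j)) : BoundedInProb P fun i => ∑ j ∈ s, Y j i := by
  classical
  induction s using Finset.induction_on with
  | empty => exact .of_forall_le (K := 0) fun _ => by simp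
  | insert a s ha ih =>
    simp only [Finset.sum_insert ha]
    exact (hY a (by simp)).add (ih fun j hj => hY j (by simp [hj]))

/-- A sequence bounded in probability times one that tends to zero in probability tends to zero in
probability. -/
lemma BoundedInProb.tendsto_mul {Y Z : (Σ N, Ω N) → ℝ} (hY : BoundedInProb P Y)
    (hZ : Tendsto Z (highProb P) (𝓝 0)) : Tendsto (fun i => Z i * Y i) (highProb P) (𝓝 0) := by
  rw [Metric.tendsto_nhds]
  intro δ hδ
  rw [eventually_highProb]
  refine ENNReal.tendsto_nhds_zero.2 fun ε hε => ?_
  obtain ⟨K, hK⟩ := hY (ε / 2) (ENNReal.half_pos hε.ne')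
  have hK' : 0 < |K| + 1 := by positivity
  have h1 := Metric.tendsto_nhds.1 hZ (δ / (|K| + 1)) (by positivity)
  have h' := (eventually_highProb.1 h1).eventually_le_const (ENNReal.half_pos hε.ne')
  filter_upwards [hK, h'] with N h1 h2
  rw [← ENNReal.add_halves ε]
  refine le_trans (measure_mono fun ω hω => ?_) ((measure_union_le _ _).trans (add_le_add h1 h2))
  by_contra hc
  simp only [Set.mem_union, Set.mem_ofPred_eq, not_or, not_lt, not_le] at hc hω
  refine absurd hω (not_le.2 ?_)
  rw [Real.dist_eq, sub_zero] at hc ⊢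
  rw [abs_mul]
  calc |Z ⟨N, ω⟩| * |Y ⟨N, ω⟩| ≤ |Z ⟨N, ω⟩| * (|K| + 1) := by
        gcongr
        linarith [hc.1, le_abs_self K]
    _ < δ / (|K| + 1) * (|K| + 1) := by
        gcongr
        exact hc.2
    _ = δ := by field_simp

lemma tendsto_sqrt_highProb :
    Tendsto (fun i : Σ N, Ω N => √(i.1 : ℝ)) (highProb P) atTop :=
  (Real.tendsto_sqrt_atTop.comp tendsto_natCast_atTop_atTop).comp tendsto_fst_highProb

/-- This is how consistency is extracted from a central limit theorem. -/
lemma BoundedInProb.tendsto_of_sqrt_mul {Y : (Σ N, Ω N) → ℝ}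
    (hY : BoundedInProb P fun i => √(i.1 : ℝ) * Y i) : Tendsto Y (highProb P) (𝓝 0) := by
  have h := hY.tendsto_mul (tendsto_inv_atTop_zero.comp tendsto_sqrt_highProb)
  refine h.congr' ?_
  filter_upwards [tendsto_sqrt_highProb.eventually_gt_atTop 0] with i hi
  simp only [Function.comp]
  field_simp

/-- Dominated convergence in probability. -/
lemma tendsto_integral_of_tendsto_highProb [∀ N, IsProbabilityMeasure (P N)]
    {g : (Σ N, Ω N) → ℂ} {C : ℝ} (hC : ∀ i, ‖g i‖ ≤ C) (hg : Tendsto g (highProb P) (𝓝 0)) :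
    Tendsto (fun N => ∫ ω, g ⟨N, ω⟩ ∂P N) atTop (𝓝 0) := by
  rw [Metric.tendsto_nhds]
  intro δ hδ
  have h1 := Metric.tendsto_nhds.1 hg (δ / 3) (by positivity)
  rw [eventually_highProb] at h1
  have hC' : 0 < |C| + 1 := by positivity
  -- The threshold is chosen so that the exceptional event, on which only the bound `|C| + 1` is
  -- available, contributes at most δ/3 to the integral; its complement contributes δ/3 as well.
  have h2 := h1.eventually_le_const
    (show (0 : ℝ≥0∞) < ENNReal.ofReal (δ / 3 / (|C| + 1)) by
      rw [ENNReal.ofReal_pos]; positivity)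
  filter_upwards [h2] with N hN
  set A : Set (Ω N) := {ω | ¬ dist (g ⟨N, ω⟩) 0 < δ / 3} with hA
  -- No measurability of `g` is assumed, so the exceptional event is replaced by a measurable hull.
  have hbound : ∀ ω, ‖g ⟨N, ω⟩‖ₑ ≤ ENNReal.ofReal (δ / 3) +
      (toMeasurable (P N) A).indicator (fun _ => ENNReal.ofReal (|C| + 1)) ω := by
    intro ω
    by_cases hω : ω ∈ A
    · rw [Set.indicator_of_mem (subset_toMeasurable _ _ hω), ← ofReal_norm]
      refine le_trans (ENNReal.ofReal_le_ofReal ?_) le_add_self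
      linarith [hC ⟨N, ω⟩, le_abs_self C]
    · refine le_trans ?_ le_self_add
      rw [← ofReal_norm]
      refine ENNReal.ofReal_le_ofReal ?_
      simp only [hA, Set.mem_ofPred_eq, not_not, dist_zero_right] at hω
      exact hω.le
  have h3 : ‖∫ ω, g ⟨N, ω⟩ ∂P N‖ₑ ≤ ENNReal.ofReal (δ / 3 + δ / 3) := by
    calc ‖∫ ω, g ⟨N, ω⟩ ∂P N‖ₑ ≤ ∫⁻ ω, ‖g ⟨N, ω⟩‖ₑ ∂P N := enorm_integral_le_lintegral_enorm _
      _ ≤ ∫⁻ ω, (ENNReal.ofReal (δ / 3) +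
          (toMeasurable (P N) A).indicator (fun _ => ENNReal.ofReal (|C| + 1)) ω) ∂P N :=
        lintegral_mono hbound
      _ = ENNReal.ofReal (δ / 3) + ENNReal.ofReal (|C| + 1) * P N A := by
        rw [lintegral_add_left measurable_const,
          lintegral_indicator (measurableSet_toMeasurable _ _)]
        simp
      _ ≤ ENNReal.ofReal (δ / 3) +
          ENNReal.ofReal (|C| + 1) * ENNReal.ofReal (δ / 3 / (|C| + 1)) := by
        gcongr
      _ = ENNReal.ofReal (δ / 3 + δ / 3) := by
        rw [← ENNReal.ofReal_mul hC'.le, ← ENNReal.ofReal_add (by positivity) (by positivity)]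
        congr 2
        field_simp
  rw [← ofReal_norm, ENNReal.ofReal_le_ofReal_iff (by positivity)] at h3
  rw [dist_zero_right]
  linarith

lemma norm_exp_ofReal_mul_I_sub_le (a b : ℝ) :
    ‖Complex.exp (a * Complex.I) - Complex.exp (b * Complex.I)‖ ≤ |a - b| := by
  have h : Complex.exp (a * Complex.I) - Complex.exp (b * Complex.I) =
      Complex.exp (b * Complex.I) * (Complex.exp (Complex.I * ((a - b : ℝ) : ℂ)) - 1) := by
    rw [mul_sub, ← Complex.exp_add]
    congr 2
    · push_cast; ring
    · ring
  rw [h, norm_mul, Complex.norm_exp_ofReal_mul_I, one_mul]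
  simpa using Real.norm_exp_I_mul_ofReal_sub_one_le (x := a - b)

lemma integrable_exp_ofReal_mul_I {α : Type*} [MeasurableSpace α] {μ : Measure α}
    [IsFiniteMeasure μ] {f : α → ℝ} (hf : Measurable f) :
    Integrable (fun x => Complex.exp (f x * Complex.I)) μ :=
  .of_bound (by fun_prop) 1 (Eventually.of_forall fun x => by simp [Complex.norm_exp_ofReal_mul_I])

/-- Adding an error that tends to zero in probability does not change the limit of the
characteristic functions. -/
lemma tendsto_charFun_of_sub [∀ N, IsProbabilityMeasure (P N)] {Y Z : (Σ N, Ω N) → ℝ}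
    (hY : ∀ N, Measurable fun ω => Y ⟨N, ω⟩) (hZ : ∀ N, Measurable fun ω => Z ⟨N, ω⟩)
    (h : Tendsto (fun i => Y i - Z i) (highProb P) (𝓝 0)) {c : ℂ}
    (hc : Tendsto (fun N => ∫ ω, Complex.exp (Z ⟨N, ω⟩ * Complex.I) ∂P N) atTop (𝓝 c)) :
    Tendsto (fun N => ∫ ω, Complex.exp (Y ⟨N, ω⟩ * Complex.I) ∂P N) atTop (𝓝 c) := by
  have h1 := tendsto_integral_of_tendsto_highProb (P := P) (C := 2)
    (g := fun i => Complex.exp (Y i * Complex.I) - Complex.exp (Z i * Complex.I))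
    (fun i => by
      refine (norm_sub_le _ _).trans ?_
      rw [Complex.norm_exp_ofReal_mul_I, Complex.norm_exp_ofReal_mul_I]
      norm_num)
    (squeeze_zero_norm (fun i => norm_exp_ofReal_mul_I_sub_le _ _) (by simpa using h.abs))
  have h2 := h1.add hc
  rw [zero_add] at h2
  refine h2.congr fun N => ?_
  rw [integral_sub (integrable_exp_ofReal_mul_I (hY N)) (integrable_exp_ofReal_mul_I (hZ N)),
    sub_add_cancel]

/-- Convergence of the characteristic functions implies boundedness in probability. -/
lemma BoundedInProb.of_tendsto_charFun [∀ N, IsProbabilityMeasure (P N)] {Y : (Σ N, Ω N) → ℝ}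
    (hY : ∀ N, Measurable fun ω => Y ⟨N, ω⟩) {f : ℝ → ℂ} (hf : Continuous f)
    (h : ∀ t : ℝ, Tendsto (fun N => ∫ ω, Complex.exp ((t * Y ⟨N, ω⟩ : ℝ) * Complex.I) ∂P N)
      atTop (𝓝 (f t))) : BoundedInProb P Y := by
  have : ∀ N, IsProbabilityMeasure ((P N).map fun ω => Y ⟨N, ω⟩) := fun N =>
    Measure.isProbabilityMeasure_map (hY N).aemeasurable
  -- Continuity of the limit at the origin is all that tightness requires.
  have ht := isTightMeasureSet_of_tendsto_charFun (μ := fun N => (P N).map fun ω => Y ⟨N, ω⟩)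
    (f := f) hf.continuousAt (by
      intro t
      refine (h t).congr fun N => ?_
      rw [charFun_apply_real, integral_map (hY N).aemeasurable (by fun_prop)]
      simp)
  rw [isTightMeasureSet_iff_exists_isCompact_measure_compl_le] at ht
  intro ε hε
  obtain ⟨K, hK, hle⟩ := ht ε hε
  obtain ⟨R, hR⟩ := hK.isBounded.subset_closedBall 0
  refine ⟨R, Eventually.of_forall fun N => ?_⟩
  refine le_trans ?_ (hle _ ⟨N, rfl⟩)
  rw [Measure.map_apply (hY N) hK.isClosed.measurableSet.compl]
  refine measure_mono fun ω hω hc => ?_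
  have := hR hc
  rw [mem_closedBall_zero_iff, Real.norm_eq_abs] at this
  exact absurd hω (not_lt.2 this)

end HighProb

/-! ### Characteristic functions of normalised sums -/

section CharFun

/-- Telescoping, all other factors being in the unit disc. An error of order N^{-3/2} in one factor
thus costs N^{-1/2} in the N-th power. -/
lemma norm_pow_sub_pow_le_mul {a b : ℂ} (ha : ‖a‖ ≤ 1) (hb : ‖b‖ ≤ 1) (n : ℕ) :
    ‖a ^ n - b ^ n‖ ≤ n * ‖a - b‖ := by
  induction n with
  | zero => simp
  | succ n ih =>
    have h : a ^ (n + 1) - b ^ (n + 1) = a ^ n * (a - b) + (a ^ n - b ^ n) * b := by ring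
    rw [h]
    refine (norm_add_le _ _).trans ?_
    rw [norm_mul, norm_mul, norm_pow]
    have h1 : ‖a‖ ^ n ≤ 1 := pow_le_one₀ (norm_nonneg _) ha
    have h2 : ‖a‖ ^ n * ‖a - b‖ ≤ 1 * ‖a - b‖ := by gcongr
    have h3 : ‖a ^ n - b ^ n‖ * ‖b‖ ≤ (n * ‖a - b‖) * 1 := by gcongr
    push_cast
    linarith

variable {E : Type*} [MeasurableSpace E]

lemma integrable_of_bounded {μ : Measure E} [IsFiniteMeasure μ] {f : E → ℝ} (hf : Measurable f)
    {C : ℝ} (hC : ∀ x, |f x| ≤ C) : Integrable f μ :=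
  .of_bound hf.aestronglyMeasurable C (Eventually.of_forall hC)

lemma abs_integral_le_of_bounded {μ : Measure E} [IsProbabilityMeasure μ] {f : E → ℝ}
    {C : ℝ} (hC : ∀ x, |f x| ≤ C) : |∫ x, f x ∂μ| ≤ C := by
  simpa using norm_integral_le_of_norm_le_const (μ := μ) (f := f) (Eventually.of_forall hC)

/-- Centring removes the linear Taylor term, and boundedness of `g` turns the cubic remainder into a
constant independent of the law. -/
lemma norm_integral_exp_sub_le {μ : Measure E} [IsProbabilityMeasure μ] {g : E → ℝ}
    (hg : Measurable g) {c : ℝ} (hc : ∀ x, |g x| ≤ c) (h0 : ∫ x, g x ∂μ = 0) :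
    ‖∫ x, Complex.exp (g x * Complex.I) ∂μ - (1 - ((∫ x, g x ^ 2 ∂μ) / 2 : ℝ))‖ ≤
      c ^ 3 * Real.exp c := by
  have hI := integrable_exp_ofReal_mul_I (μ := μ) hg
  have hg1 : Integrable g μ := integrable_of_bounded hg hc
  have hg2 : Integrable (fun x => g x ^ 2) μ :=
    integrable_of_bounded (hg.pow_const 2) (C := c ^ 2) fun x => by
      rw [abs_pow]; exact pow_le_pow_left₀ (abs_nonneg _) (hc x) 2
  have h1 : ∫ x, (1 + (g x : ℂ) * Complex.I - ((g x ^ 2 / 2 : ℝ) : ℂ)) ∂μ =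
      1 - ((∫ x, g x ^ 2 ∂μ) / 2 : ℝ) := by
    have ha : Integrable (fun x => (g x : ℂ) * Complex.I) μ := hg1.ofReal.mul_const _
    have hb : Integrable (fun x => ((g x ^ 2 / 2 : ℝ) : ℂ)) μ := (hg2.div_const 2).ofReal
    have hab : Integrable (fun x => 1 + (g x : ℂ) * Complex.I) μ := (integrable_const _).add ha
    rw [integral_sub hab hb, integral_add (integrable_const _) ha,
      integral_mul_const, integral_complex_ofReal, integral_complex_ofReal, h0, integral_div]
    simp
  have hb : Integrable (fun x => ((g x ^ 2 / 2 : ℝ) : ℂ)) μ := (hg2.div_const 2).ofReal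
  have ha : Integrable (fun x => (g x : ℂ) * Complex.I) μ := hg1.ofReal.mul_const _
  have hab : Integrable (fun x => 1 + (g x : ℂ) * Complex.I - ((g x ^ 2 / 2 : ℝ) : ℂ)) μ :=
    ((integrable_const _).add ha).sub hb
  rw [← h1, ← integral_sub hI hab]
  have key : ∀ x, ‖Complex.exp (g x * Complex.I) -
      (1 + (g x : ℂ) * Complex.I - ((g x ^ 2 / 2 : ℝ) : ℂ))‖ ≤ c ^ 3 * Real.exp c := by
    intro x
    have h := Complex.norm_exp_sub_sum_le_norm_mul_exp (g x * Complex.I) 3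
    have hs : ∑ m ∈ Finset.range 3, ((g x : ℂ) * Complex.I) ^ m / (m.factorial : ℂ) =
        1 + (g x : ℂ) * Complex.I - ((g x ^ 2 / 2 : ℝ) : ℂ) := by
      simp [Finset.sum_range_succ, mul_pow, Nat.factorial]
      ring
    rw [hs] at h
    refine h.trans ?_
    have hn : ‖(g x : ℂ) * Complex.I‖ = |g x| := by simp
    rw [hn]
    have := hc x
    have : 0 ≤ c := (abs_nonneg _).trans this
    gcongr
  simpa using norm_integral_le_of_norm_le_const (μ := μ) (Eventually.of_forall key)

/-- A quantitative central limit theorem for the characteristic function of a normalised sum of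
bounded i.i.d. variables, uniform in their law. -/
lemma exists_norm_charFun_pow_sub_le (C : ℝ) : ∃ K : ℝ, ∀ (μ : Measure E) [IsProbabilityMeasure μ]
    (f : E → ℝ), Measurable f → (∀ x, |f x| ≤ C) → ∀ N : ℕ, 1 ≤ N →
    ‖Complex.exp ((-√(N : ℝ) * ∫ x, f x ∂μ : ℝ) * Complex.I) *
        (∫ x, Complex.exp ((f x / √(N : ℝ) : ℝ) * Complex.I) ∂μ) ^ N -
      (Real.exp (-(∫ x, f x ^ 2 ∂μ - (∫ x, f x ∂μ) ^ 2) / 2) : ℝ)‖ ≤ K / √(N : ℝ) := by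
  -- The first summand is the cubic remainder for the centred variable, bounded by 2C; the second is
  -- the quadratic remainder of exp(-v/(2N)), where the variance v is at most (2C)².
  refine ⟨(2 * C) ^ 3 * Real.exp (2 * C) + ((2 * C) ^ 2 / 2) ^ 2 * Real.exp ((2 * C) ^ 2 / 2), ?_⟩
  intro μ _ f hf hC N hN
  set m := ∫ x, f x ∂μ with hm
  set s := √(N : ℝ) with hs
  have hN1 : (1 : ℝ) ≤ N := by exact_mod_cast hN
  have hs1 : 1 ≤ s := Real.one_le_sqrt.2 hN1
  have hs0 : 0 < s := by linarith
  have hsq : s * s = N := Real.mul_self_sqrt (by linarith)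
  have hmC : |m| ≤ C := abs_integral_le_of_bounded hC
  have hC0 : 0 ≤ C := (abs_nonneg m).trans hmC
  have hf1 : Integrable f μ := integrable_of_bounded hf hC
  have hf2 : Integrable (fun x => f x ^ 2) μ :=
    integrable_of_bounded (hf.pow_const 2) (C := C ^ 2) fun x => by
      rw [abs_pow]; exact pow_le_pow_left₀ (abs_nonneg _) (hC x) 2
  set v := ∫ x, f x ^ 2 ∂μ - m ^ 2 with hv
  set g : E → ℝ := fun x => (f x - m) / s with hgdef
  have hg : Measurable g := (hf.sub_const m).div_const _
  have hgb : ∀ x, |g x| ≤ 2 * C / s := by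
    intro x
    rw [hgdef, abs_div, abs_of_pos hs0]
    gcongr
    linarith [abs_sub (f x) m, hC x]
  have hg0 : ∫ x, g x ∂μ = 0 := by
    rw [hgdef, integral_div, integral_sub hf1 (integrable_const _)]
    simp [hm]
  have hg2 : ∫ x, g x ^ 2 ∂μ = v / N := by
    have : ∀ x, g x ^ 2 = (f x ^ 2 - 2 * m * f x + m ^ 2) / N := by
      intro x
      rw [hgdef, ← hsq]
      field_simp
      ring
    simp_rw [this]
    have hd : Integrable (fun x => f x ^ 2 - 2 * m * f x) μ := hf2.sub (hf1.const_mul _)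
    rw [integral_div, integral_add hd (integrable_const _),
      integral_sub hf2 (hf1.const_mul _), integral_const_mul]
    simp [hv, ← hm]
    ring
  have hv0 : 0 ≤ v := by
    have h : 0 ≤ v / N := hg2 ▸ integral_nonneg fun x => sq_nonneg _
    rw [le_div_iff₀ (by linarith)] at h
    linarith
  have hvC : v ≤ (2 * C) ^ 2 := by
    have h : ∫ x, f x ^ 2 ∂μ ≤ C ^ 2 := by
      refine (le_abs_self _).trans (abs_integral_le_of_bounded fun x => ?_)
      rw [abs_pow]; exact pow_le_pow_left₀ (abs_nonneg _) (hC x) 2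
    nlinarith [sq_nonneg m]
  set a := ∫ x, Complex.exp (g x * Complex.I) ∂μ with ha
  set b : ℂ := ((Real.exp (-(v / 2 / N)) : ℝ) : ℂ) with hb
  -- The centring phase is distributed over the N factors, so that both quantities to be compared
  -- become N-th powers of numbers in the unit disc.
  have e1 : Complex.exp ((-s * m : ℝ) * Complex.I) *
      (∫ x, Complex.exp ((f x / s : ℝ) * Complex.I) ∂μ) ^ N = a ^ N := by
    have : Complex.exp ((-s * m : ℝ) * Complex.I) =
        Complex.exp ((-(m / s) : ℝ) * Complex.I) ^ N := by
      rw [← Complex.exp_nat_mul]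
      congr 1
      have hr : -s * m = N * -(m / s) := by
        rw [← hsq]; field_simp
      rw [hr]; push_cast; ring
    rw [this, ← mul_pow, ← integral_const_mul, ha]
    congr 2
    ext x
    rw [← Complex.exp_add, hgdef]
    congr 1
    push_cast
    ring
  have e2 : ((Real.exp (-v / 2) : ℝ) : ℂ) = b ^ N := by
    rw [hb, ← Complex.ofReal_pow, ← Real.exp_nat_mul]
    congr 2
    field_simp
  rw [e1, e2]
  have ha1 : ‖a‖ ≤ 1 := by
    have := norm_integral_le_of_norm_le_const (μ := μ)
      (f := fun x => Complex.exp (g x * Complex.I)) (C := 1)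
      (Eventually.of_forall fun x => by rw [Complex.norm_exp_ofReal_mul_I])
    simpa using this
  have hb1 : ‖b‖ ≤ 1 := by
    rw [hb, Complex.norm_real, Real.norm_eq_abs, abs_of_pos (Real.exp_pos _), Real.exp_le_one_iff,
      neg_nonpos]
    positivity
  refine (norm_pow_sub_pow_le_mul ha1 hb1 N).trans ?_
  have h1 : ‖a - (1 - ((v / N) / 2 : ℝ))‖ ≤ (2 * C / s) ^ 3 * Real.exp (2 * C / s) := by
    have := norm_integral_exp_sub_le hg hgb hg0
    rwa [hg2] at this
  have hle : 2 * C / s ≤ 2 * C := div_le_self (by positivity) hs1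
  have h1' : ‖a - (1 - ((v / N) / 2 : ℝ))‖ ≤ (2 * C) ^ 3 * Real.exp (2 * C) / (N * s) := by
    refine h1.trans ?_
    have : (2 * C / s) ^ 3 * Real.exp (2 * C / s) =
        (2 * C) ^ 3 * Real.exp (2 * C / s) / (N * s) := by
      rw [← hsq]; field_simp
    rw [this]
    gcongr
  have h2 : ‖b - (1 - ((v / N) / 2 : ℝ))‖ ≤
      ((2 * C) ^ 2 / 2) ^ 2 * Real.exp ((2 * C) ^ 2 / 2) / (N * s) := by
    have h := Complex.norm_exp_sub_sum_le_norm_mul_exp ((-(v / 2 / N) : ℝ) : ℂ) 2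
    have hsum : ∑ k ∈ Finset.range 2, ((-(v / 2 / N) : ℝ) : ℂ) ^ k / (k.factorial : ℂ) =
        1 - ((v / N) / 2 : ℝ) := by
      simp [Finset.sum_range_succ]
      ring
    rw [hsum, ← Complex.ofReal_exp, Complex.norm_real, norm_neg, Real.norm_eq_abs,
      abs_of_nonneg (by positivity)] at h
    refine h.trans ?_
    have hq : v / 2 / N ≤ (2 * C) ^ 2 / 2 / s / s := by
      rw [div_div _ (s), hsq]
      gcongr
    have hvN : v / 2 / N ≤ (2 * C) ^ 2 / 2 :=
      (div_le_self (by positivity) hN1).trans (by linarith)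
    have hq2 : (v / 2 / N) ^ 2 ≤ ((2 * C) ^ 2 / 2) ^ 2 / (N * s) := by
      calc (v / 2 / N) ^ 2 = (v / 2) ^ 2 / (N * N) := by field_simp
        _ ≤ ((2 * C) ^ 2 / 2) ^ 2 / (N * s) := by
          gcongr
          nlinarith
    calc (v / 2 / N) ^ 2 * Real.exp (v / 2 / N)
        ≤ ((2 * C) ^ 2 / 2) ^ 2 / (N * s) * Real.exp ((2 * C) ^ 2 / 2) := by gcongr
      _ = _ := by ring
  have h3 : ‖a - b‖ ≤ ((2 * C) ^ 3 * Real.exp (2 * C) +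
      ((2 * C) ^ 2 / 2) ^ 2 * Real.exp ((2 * C) ^ 2 / 2)) / (N * s) := by
    rw [add_div]
    rw [norm_sub_rev] at h2
    calc ‖a - b‖ = ‖(a - (1 - ((v / N) / 2 : ℝ))) + ((1 - ((v / N) / 2 : ℝ)) - b)‖ := by
          congr 1; ring
      _ ≤ _ := (norm_add_le _ _).trans (add_le_add h1' h2)
  calc (N : ℝ) * ‖a - b‖ ≤ N * (((2 * C) ^ 3 * Real.exp (2 * C) +
      ((2 * C) ^ 2 / 2) ^ 2 * Real.exp ((2 * C) ^ 2 / 2)) / (N * s)) := by gcongr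
    _ = _ := by field_simp

end CharFun

/-! ### The mean of a random point of a finite-dimensional convex set -/

section ConvexMean

/-- If C has interior points, Hahn–Banach separates 0 from the interior, and the inequality passes
to the closure, which contains C. Otherwise C spans a proper affine subspace, and a functional that
kills its direction is constant on C. -/
lemma exists_linear_ne_zero_of_zero_notMem {F : Type*} [NormedAddCommGroup F] [NormedSpace ℝ F]
    [FiniteDimensional ℝ F] {C : Set F} (hC : Convex ℝ C) (h0 : (0 : F) ∉ C) (hne : C.Nonempty) :
    ∃ f : F →L[ℝ] ℝ, f ≠ 0 ∧ ((∀ c ∈ C, 0 ≤ f c) ∨ ∃ a, ∀ c ∈ C, f c = a) := by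
  by_cases hi : (interior C).Nonempty
  · obtain ⟨f, hf⟩ := geometric_hahn_banach_point_open hC.interior isOpen_interior
      (fun h => h0 (interior_subset h))
    refine ⟨f, ?_, Or.inl fun c hc => ?_⟩
    · rintro rfl
      obtain ⟨x, hx⟩ := hi
      simpa using hf x hx
    · have hc' : c ∈ closure (interior C) := by
        rw [hC.closure_interior_eq_closure_of_nonempty_interior hi]
        exact subset_closure hc
      have : closure (interior C) ⊆ {x | 0 ≤ f x} :=
        closure_minimal (fun x hx => by simpa using (hf x hx).le)
          (isClosed_le continuous_const f.continuous)
      exact this hc'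
  · obtain ⟨p, hp⟩ := hne
    have hspan : vectorSpan ℝ C ≠ ⊤ := by
      intro h
      apply hi
      rw [hC.interior_nonempty_iff_affineSpan_eq_top,
        AffineSubspace.affineSpan_eq_top_iff_vectorSpan_eq_top_of_nonempty ℝ F F ⟨p, hp⟩]
      exact h
    obtain ⟨f, hf0, hf⟩ := Submodule.exists_le_ker_of_lt_top _ (lt_top_iff_ne_top.2 hspan)
    refine ⟨LinearMap.toContinuousLinearMap f, ?_, Or.inr ⟨f p, fun c hc => ?_⟩⟩
    · intro h
      apply hf0
      ext x
      simpa using congrArg (fun g : F →L[ℝ] ℝ => g x) h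
    · have := hf (vsub_mem_vectorSpan ℝ hc hp)
      rw [LinearMap.mem_ker, vsub_eq_sub, map_sub, sub_eq_zero] at this
      simpa using this

/-- Induction on the dimension. If 0 were outside C, some nonzero functional would be nonnegative or
constant on C while having mean zero along X, hence would vanish on X almost surely. Then X lives in
a proper subspace, where the induction hypothesis puts 0 into C after all. -/
lemma zero_mem_of_integral_eq_zero {α : Type*} [MeasurableSpace α] (μ : Measure α)
    [IsProbabilityMeasure μ] (k : ℕ) : ∀ {F : Type} [NormedAddCommGroup F] [NormedSpace ℝ F]
    [FiniteDimensional ℝ F], Module.finrank ℝ F = k → ∀ {C : Set F}, Convex ℝ C → ∀ {X : α → F},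
    Integrable X μ → (∀ᵐ a ∂μ, X a ∈ C) → ∫ a, X a ∂μ = 0 → (0 : F) ∈ C := by
  induction k using Nat.strong_induction_on with
  | _ k ih =>
  intro F _ _ _ hk C hC X hX hXC hX0
  by_contra h0
  have hne : C.Nonempty := by
    obtain ⟨a, ha⟩ := hXC.exists
    exact ⟨_, ha⟩
  obtain ⟨f, hf0, hf⟩ := exists_linear_ne_zero_of_zero_notMem hC h0 hne
  have hint : ∫ a, f (X a) ∂μ = 0 := by
    rw [f.integral_comp_comm hX, hX0, map_zero]
  have hker : ∀ᵐ a ∂μ, f (X a) = 0 := by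
    rcases hf with hf | ⟨c, hf⟩
    · exact (integral_eq_zero_iff_of_nonneg_ae (hXC.mono fun a ha => hf _ ha)
        (f.integrable_comp hX)).1 hint
    · have h1 : ∫ a, f (X a) ∂μ = c := by
        rw [integral_congr_ae (hXC.mono fun a ha => hf _ ha)]
        simp
      exact hXC.mono fun a ha => by rw [hf _ ha, ← h1, hint]
  obtain ⟨p, hp⟩ := Submodule.exists_isCompl (LinearMap.ker (f : F →ₗ[ℝ] ℝ))
  set W := LinearMap.ker (f : F →ₗ[ℝ] ℝ) with hW
  -- Since X lies in the kernel W only almost surely, a W-valued variable is produced by projection.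
  set π : F →L[ℝ] W := LinearMap.toContinuousLinearMap (W.projectionOnto p hp) with hπ
  have hπX : ∀ᵐ a ∂μ, ((π (X a) : W) : F) = X a := by
    filter_upwards [hker] with a ha
    exact congrArg Subtype.val
      (Submodule.projectionOnto_apply_left hp ⟨X a, by simpa [hW] using ha⟩)
  have hlt : Module.finrank ℝ W < k := by
    rw [← hk]
    refine Submodule.finrank_lt ?_
    intro h
    apply hf0
    ext x
    have : x ∈ W := h ▸ Submodule.mem_top
    simpa [hW] using this
  have := ih _ hlt (F := W) rfl (hC.linear_preimage W.subtype) (π.integrable_comp hX)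
    (by filter_upwards [hπX, hXC] with a h1 h2; simpa [h1] using h2)
    (by rw [π.integral_comp_comm hX, hX0, map_zero])
  exact h0 (by simpa using this)

/-- In finite dimension the mean of a probability measure carried by a convex set belongs to that
set, closed or not. -/
lemma integral_mem_of_convex {α : Type*} [MeasurableSpace α] (μ : Measure α)
    [IsProbabilityMeasure μ] {F : Type} [NormedAddCommGroup F] [NormedSpace ℝ F]
    [FiniteDimensional ℝ F] {C : Set F} (hC : Convex ℝ C) {X : α → F}
    (hX : Integrable X μ) (hXC : ∀ a, X a ∈ C) : ∫ a, X a ∂μ ∈ C := by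
  have h := zero_mem_of_integral_eq_zero μ _ (F := F) rfl
    (hC.translate_preimage_right (∫ a, X a ∂μ)) (X := fun a => X a - ∫ a, X a ∂μ)
    (hX.sub (integrable_const _)) (Eventually.of_forall fun a => by simpa using hXC a)
    (by rw [integral_sub hX (integrable_const _)]; simp)
  simpa using h

end ConvexMean

/-! ### Exponential tilts and the effective sample size -/

section ESS

variable {E : Type*} [MeasurableSpace E]

lemma abs_exp_sub_one_sub_self_le (y : ℝ) : |Real.exp y - 1 - y| ≤ y ^ 2 * Real.exp |y| := by
  have h := Complex.norm_exp_sub_sum_le_norm_mul_exp (y : ℂ) 2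
  have hs : ∑ k ∈ Finset.range 2, (y : ℂ) ^ k / (k.factorial : ℂ) = ((1 + y : ℝ) : ℂ) := by
    simp [Finset.sum_range_succ]
  rw [hs, ← Complex.ofReal_exp, ← Complex.ofReal_sub, Complex.norm_real, Complex.norm_real,
    Real.norm_eq_abs, Real.norm_eq_abs, sq_abs] at h
  rwa [sub_sub]

lemma measurable_exp_mul {V : E → ℝ} (hV : Measurable V) (t : ℝ) :
    Measurable fun x => Real.exp (t * V x) := Real.measurable_exp.comp (hV.const_mul t)

lemma exp_mul_le {α : Type*} {V : α → ℝ} {C : ℝ} (hC : ∀ x, |V x| ≤ C) (t : ℝ) (x : α) :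
    Real.exp (t * V x) ≤ Real.exp (|t| * C) := by
  refine Real.exp_le_exp.2 ((le_abs_self _).trans ?_)
  rw [abs_mul]
  exact mul_le_mul_of_nonneg_left (hC x) (abs_nonneg t)

lemma IsTest.integrable {μ : Measure E} [IsFiniteMeasure μ] {f : E → ℝ} (hf : IsTest f) :
    Integrable f μ := by
  obtain ⟨hm, C, hC⟩ := hf
  exact integrable_of_bounded hm hC

lemma IsTest.mul {f g : E → ℝ} (hf : IsTest f) (hg : IsTest g) : IsTest fun x => f x * g x := by
  obtain ⟨hfm, A, hA⟩ := hf
  obtain ⟨hgm, B, hB⟩ := hg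
  refine ⟨hfm.mul hgm, A * B, fun x => ?_⟩
  rw [abs_mul]
  exact mul_le_mul (hA x) (hB x) (abs_nonneg _) ((abs_nonneg _).trans (hA x))

lemma IsTest.add {f g : E → ℝ} (hf : IsTest f) (hg : IsTest g) : IsTest fun x => f x + g x := by
  obtain ⟨hfm, A, hA⟩ := hf
  obtain ⟨hgm, B, hB⟩ := hg
  exact ⟨hfm.add hgm, A + B, fun x => (abs_add_le _ _).trans (add_le_add (hA x) (hB x))⟩

lemma isTest_const (c : ℝ) : IsTest fun _ : E => c := ⟨measurable_const, |c|, fun _ => le_rfl⟩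

lemma IsTest.const_mul {f : E → ℝ} (hf : IsTest f) (c : ℝ) : IsTest fun x => c * f x :=
  (isTest_const c).mul hf

lemma IsTest.sub {f g : E → ℝ} (hf : IsTest f) (hg : IsTest g) : IsTest fun x => f x - g x := by
  simpa [sub_eq_add_neg] using hf.add (hg.const_mul (-1))

lemma IsTest.pow {f : E → ℝ} (hf : IsTest f) (n : ℕ) : IsTest fun x => f x ^ n := by
  induction n with
  | zero => simpa using isTest_const (E := E) 1
  | succ n ih => simpa [pow_succ] using ih.mul hf

lemma IsTest.sum {ι : Type*} (s : Finset ι) {f : ι → E → ℝ} (hf : ∀ i ∈ s, IsTest (f i)) :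
    IsTest fun x => ∑ i ∈ s, f i x := by
  classical
  induction s using Finset.induction_on with
  | empty => simpa using isTest_const (E := E) 0
  | insert a s ha ih =>
    simp only [Finset.sum_insert ha]
    exact (hf a (by simp)).add (ih fun j hj => hf j (by simp [hj]))

lemma IsTest.exp {V : E → ℝ} (hV : IsTest V) (t : ℝ) : IsTest fun x => Real.exp (t * V x) := by
  obtain ⟨hm, C, hC⟩ := hV
  refine ⟨measurable_exp_mul hm t, Real.exp (|t| * C), fun x => ?_⟩
  rw [abs_of_pos (Real.exp_pos _)]
  exact exp_mul_le hC t x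

/-- First order expansion of an exponential tilt, uniform in the measure. -/
lemma abs_integral_mul_exp_sub_le {f V : E → ℝ} (hf : Measurable f) (hV : Measurable V) {B C : ℝ}
    (hB : ∀ x, |f x| ≤ B) (hC : ∀ x, |V x| ≤ C) (μ : Measure E) [IsFiniteMeasure μ] {h : ℝ}
    (hh : |h| ≤ 1) :
    |∫ x, f x * Real.exp (-h * V x) ∂μ - ∫ x, f x ∂μ + h * ∫ x, V x * f x ∂μ| ≤
      B * (C ^ 2 * Real.exp C) * μ.real Set.univ * h ^ 2 := by
  have hf' : IsTest f := ⟨hf, B, hB⟩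
  have hV' : IsTest V := ⟨hV, C, hC⟩
  have h1 := (hf'.mul (hV'.exp (-h))).integrable (μ := μ)
  have h2 := hf'.integrable (μ := μ)
  have h3 := (hV'.mul hf').integrable (μ := μ)
  have h12 : Integrable (fun x => f x * Real.exp (-h * V x) - f x) μ := h1.sub h2
  rw [← integral_const_mul, ← integral_sub h1 h2, ← integral_add h12 (h3.const_mul h)]
  have key : ∀ x, ‖f x * Real.exp (-h * V x) - f x + h * (V x * f x)‖ ≤
      B * (C ^ 2 * Real.exp C) * h ^ 2 := by
    intro x
    have hC0 : 0 ≤ C := (abs_nonneg _).trans (hC x)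
    have e : f x * Real.exp (-h * V x) - f x + h * (V x * f x) =
        f x * (Real.exp (-h * V x) - 1 - (-h * V x)) := by ring
    rw [e, Real.norm_eq_abs, abs_mul]
    have h4 := abs_exp_sub_one_sub_self_le (-h * V x)
    have h5 : |-h * V x| ≤ C := by
      rw [abs_mul, abs_neg]
      calc |h| * |V x| ≤ 1 * C := mul_le_mul hh (hC x) (abs_nonneg _) zero_le_one
        _ = C := one_mul C
    have h6 : (-h * V x) ^ 2 ≤ h ^ 2 * C ^ 2 := by
      rw [mul_pow, neg_sq]
      have := sq_le_sq' (abs_le.1 (hC x)).1 (abs_le.1 (hC x)).2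
      gcongr
    calc |f x| * |Real.exp (-h * V x) - 1 - (-h * V x)|
        ≤ B * (h ^ 2 * C ^ 2 * Real.exp C) := by
          have hb := hB x
          have : 0 ≤ B := (abs_nonneg _).trans hb
          gcongr
          refine h4.trans ?_
          gcongr
      _ = _ := by ring
  refine (norm_integral_le_of_norm_le_const (Eventually.of_forall key)).trans (le_of_eq ?_)
  ring

lemma hasDerivAt_of_abs_le {F : ℝ → ℝ} {t F' K : ℝ}
    (h : ∀ s, |s - t| ≤ 1 → |F s - F t - (s - t) * F'| ≤ K * (s - t) ^ 2) : HasDerivAt F F' t := by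
  rw [hasDerivAt_iff_isLittleO]
  have h1 : (fun s => F s - F t - (s - t) • F') =O[𝓝 t] fun s => (s - t) ^ 2 := by
    refine Asymptotics.IsBigO.of_bound K ?_
    filter_upwards [Metric.closedBall_mem_nhds t one_pos] with s hs
    rw [Metric.mem_closedBall, Real.dist_eq] at hs
    simpa using h s hs
  refine h1.trans_isLittleO ?_
  have h2 : Tendsto (fun s : ℝ => s - t) (𝓝 t) (𝓝 0) := by
    have : ContinuousAt (fun s : ℝ => s - t) t := by fun_prop
    simpa [ContinuousAt] using this
  simpa [Function.comp_def] using
    (Asymptotics.isLittleO_pow_id (one_lt_two)).comp_tendsto h2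

/-- Tilts compose: going from t to s is a tilt by s - t of the function f e^{-tV}, so the expansion
at 0 gives the derivative at every t. -/
lemma hasDerivAt_integral_mul_exp {f V : E → ℝ} (hf : IsTest f) (hV : IsTest V) (μ : Measure E)
    [IsFiniteMeasure μ] (t : ℝ) :
    HasDerivAt (fun t => ∫ x, f x * Real.exp (-t * V x) ∂μ)
      (-∫ x, V x * (f x * Real.exp (-t * V x)) ∂μ) t := by
  obtain ⟨hg, B, hB⟩ := hf.mul (hV.exp (-t))
  obtain ⟨hVm, C, hC⟩ := hV
  refine hasDerivAt_of_abs_le (K := B * (C ^ 2 * Real.exp C) * μ.real Set.univ) fun s hs => ?_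
  have := abs_integral_mul_exp_sub_le hg hVm hB hC μ hs
  have e : ∀ x, f x * Real.exp (-t * V x) * Real.exp (-(s - t) * V x) =
      f x * Real.exp (-s * V x) := by
    intro x
    rw [mul_assoc, ← Real.exp_add]
    congr 2
    ring
  simp_rw [e] at this
  convert this using 2
  ring

variable {μ : Measure E} [IsProbabilityMeasure μ] {V : E → ℝ}

lemma integral_exp_mul_pos (hV : IsTest V) (t : ℝ) : 0 < ∫ x, Real.exp (t * V x) ∂μ :=
  integral_exp_pos ((hV.exp t).integrable)

lemma integral_exp_sq_pos (hV : IsTest V) (t : ℝ) : 0 < ∫ x, Real.exp (t * V x) ^ 2 ∂μ := by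
  have : ∀ x, Real.exp (t * V x) ^ 2 = Real.exp (2 * t * V x) := by
    intro x; rw [← Real.exp_nat_mul]; congr 1; push_cast; ring
  simp_rw [this]
  exact integral_exp_mul_pos hV _

lemma hasDerivAt_ESS (hV : IsTest V) (t : ℝ) :
    HasDerivAt (fun t => ESS μ fun x => Real.exp (-t * V x))
      (2 * (∫ x, Real.exp (-t * V x) ∂μ) / (∫ x, Real.exp (-t * V x) ^ 2 ∂μ) ^ 2 *
        ((∫ x, Real.exp (-t * V x) ∂μ) * (∫ x, V x * Real.exp (-t * V x) ^ 2 ∂μ) -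
          (∫ x, V x * Real.exp (-t * V x) ∂μ) * ∫ x, Real.exp (-t * V x) ^ 2 ∂μ)) t := by
  have h1 := hasDerivAt_integral_mul_exp (isTest_const 1) hV μ t
  simp only [one_mul] at h1
  -- The square of the weight at t is the weight at 2t.
  have h2 := (hasDerivAt_integral_mul_exp (isTest_const 1) hV μ (2 * t)).comp t
    ((hasDerivAt_id t).const_mul 2)
  have e : ∀ t x, Real.exp (-(2 * t) * V x) = Real.exp (-t * V x) ^ 2 := by
    intro t x; rw [← Real.exp_nat_mul]; congr 1; push_cast; ring
  simp only [one_mul, Function.comp_def, e] at h2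
  have h3 := (h1.pow 2).div h2 (integral_exp_sq_pos hV (-t)).ne'
  refine h3.congr_deriv ?_
  have := (integral_exp_sq_pos (μ := μ) hV (-t)).ne'
  simp only [Pi.pow_apply]
  field_simp
  ring

/-- The tilted covariance of `V` and `e^{-tV}` is the mean of a nonpositive function. -/
lemma integral_tilted_cov (hV : IsTest V) (t : ℝ) :
    ((∫ x, Real.exp (-t * V x) ∂μ) * (∫ x, V x * Real.exp (-t * V x) ^ 2 ∂μ) -
      (∫ x, V x * Real.exp (-t * V x) ∂μ) * ∫ x, Real.exp (-t * V x) ^ 2 ∂μ) =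
    (∫ x, Real.exp (-t * V x) ∂μ) * ∫ x, (V x - (∫ x, V x * Real.exp (-t * V x) ∂μ) /
      ∫ x, Real.exp (-t * V x) ∂μ) * Real.exp (-t * V x) * (Real.exp (-t * V x) -
        Real.exp (-t * ((∫ x, V x * Real.exp (-t * V x) ∂μ) / ∫ x, Real.exp (-t * V x) ∂μ))) ∂μ := by
  have ha := (integral_exp_mul_pos (μ := μ) hV (-t)).ne'
  set a := ∫ x, Real.exp (-t * V x) ∂μ with hadef
  set u := ∫ x, V x * Real.exp (-t * V x) ∂μ with hu
  set c := u / a with hc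
  have hG := hV.exp (-t)
  have e : ∀ x, (V x - c) * Real.exp (-t * V x) * (Real.exp (-t * V x) - Real.exp (-t * c)) =
      V x * Real.exp (-t * V x) ^ 2 - c * Real.exp (-t * V x) ^ 2 -
        Real.exp (-t * c) * (V x * Real.exp (-t * V x) - c * Real.exp (-t * V x)) := by
    intro x; ring
  simp_rw [e]
  have i1 := (hV.mul (hG.pow 2)).integrable (μ := μ)
  have i2 := ((hG.pow 2).const_mul c).integrable (μ := μ)
  have i3 := (hV.mul hG).integrable (μ := μ)
  have i4 := (hG.const_mul c).integrable (μ := μ)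
  have i12 : Integrable (fun x => V x * Real.exp (-t * V x) ^ 2 - c * Real.exp (-t * V x) ^ 2) μ :=
    i1.sub i2
  have i34 : Integrable (fun x => V x * Real.exp (-t * V x) - c * Real.exp (-t * V x)) μ :=
    i3.sub i4
  rw [integral_sub i12 (i34.const_mul _), integral_sub i1 i2, integral_const_mul,
    integral_const_mul, integral_sub i3 i4, integral_const_mul, ← hadef, ← hu]
  -- Here c is the tilted mean of V, so (V - c)e^{-tV} has mean zero and subtracting the constant
  -- e^{-tc} from the last factor changes nothing.
  have hca : c * a = u := div_mul_cancel₀ u ha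
  linear_combination (∫ x, Real.exp (-t * V x) ^ 2 ∂μ - a * Real.exp (-t * c)) * hca

/-- For t ≥ 0 the map v ↦ e^{-tv} is nonincreasing, so the two differences have opposite signs. -/
lemma sub_mul_exp_sub_nonpos {t : ℝ} (ht : 0 ≤ t) (v c : ℝ) :
    (v - c) * Real.exp (-t * v) * (Real.exp (-t * v) - Real.exp (-t * c)) ≤ 0 := by
  rcases le_total v c with h | h
  · have h1 : Real.exp (-t * c) ≤ Real.exp (-t * v) := Real.exp_le_exp.2 (by nlinarith)
    exact mul_nonpos_of_nonpos_of_nonneg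
      (mul_nonpos_of_nonpos_of_nonneg (by linarith) (Real.exp_pos _).le) (by linarith)
  · have h1 : Real.exp (-t * v) ≤ Real.exp (-t * c) := Real.exp_le_exp.2 (by nlinarith)
    exact mul_nonpos_of_nonneg_of_nonpos
      (mul_nonneg (by linarith) (Real.exp_pos _).le) (by linarith)

lemma tilted_cov_nonpos (hV : IsTest V) {t : ℝ} (ht : 0 ≤ t) :
    (∫ x, Real.exp (-t * V x) ∂μ) * (∫ x, V x * Real.exp (-t * V x) ^ 2 ∂μ) -
      (∫ x, V x * Real.exp (-t * V x) ∂μ) * ∫ x, Real.exp (-t * V x) ^ 2 ∂μ ≤ 0 := by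
  rw [integral_tilted_cov hV]
  exact mul_nonpos_of_nonneg_of_nonpos (integral_exp_mul_pos hV _).le
    (integral_nonpos fun x => sub_mul_exp_sub_nonpos ht _ _)

/-- A nonpositive integrand with zero mean vanishes almost everywhere; as t > 0, the vanishing of
either difference forces V to equal its tilted mean. -/
lemma tilted_cov_neg (hV : IsTest V) {t : ℝ} (ht : 0 < t) (hc : ∀ c, ¬ V =ᵐ[μ] fun _ => c) :
    (∫ x, Real.exp (-t * V x) ∂μ) * (∫ x, V x * Real.exp (-t * V x) ^ 2 ∂μ) -
      (∫ x, V x * Real.exp (-t * V x) ∂μ) * ∫ x, Real.exp (-t * V x) ^ 2 ∂μ < 0 := by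
  refine lt_of_le_of_ne (tilted_cov_nonpos hV ht.le) fun h => ?_
  rw [integral_tilted_cov hV, mul_eq_zero, or_iff_right (integral_exp_mul_pos hV _).ne'] at h
  set c := (∫ x, V x * Real.exp (-t * V x) ∂μ) / ∫ x, Real.exp (-t * V x) ∂μ
  have hG := hV.exp (-t)
  have hi := (((hV.sub (isTest_const c)).mul hG).mul
    (hG.sub (isTest_const (Real.exp (-t * c))))).integrable (μ := μ)
  rw [← neg_eq_zero, ← integral_neg, integral_eq_zero_iff_of_nonneg
    (fun x => neg_nonneg.2 (sub_mul_exp_sub_nonpos ht.le _ _)) hi.neg] at h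
  refine hc c (h.mono fun x hx => ?_)
  simp only [Pi.zero_apply, neg_eq_zero, mul_eq_zero, (Real.exp_pos _).ne', or_false, sub_eq_zero,
    Real.exp_eq_exp] at hx
  rcases hx with hx | hx
  · exact hx
  · exact mul_left_cancel₀ (neg_ne_zero.2 ht.ne') hx

lemma continuous_ESS (hV : IsTest V) : Continuous fun t => ESS μ fun x => Real.exp (-t * V x) :=
  continuous_iff_continuousAt.2 fun t => (hasDerivAt_ESS hV t).continuousAt

lemma antitoneOn_ESS (hV : IsTest V) :
    AntitoneOn (fun t => ESS μ fun x => Real.exp (-t * V x)) (Set.Ici 0) := by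
  refine antitoneOn_of_deriv_nonpos (convex_Ici 0) (continuous_ESS hV).continuousOn
    (fun t _ => (hasDerivAt_ESS hV t).differentiableAt.differentiableWithinAt) fun t ht => ?_
  rw [interior_Ici] at ht
  rw [(hasDerivAt_ESS hV t).deriv]
  exact mul_nonpos_of_nonneg_of_nonpos (div_nonneg (mul_nonneg zero_le_two
    (integral_exp_mul_pos hV _).le) (sq_nonneg _)) (tilted_cov_nonpos hV (le_of_lt ht))

lemma ESS_const (c : ℝ) (hV : V =ᵐ[μ] fun _ => c) (t : ℝ) :
    (ESS μ fun x => Real.exp (-t * V x)) = 1 := by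
  have h1 : ∫ x, Real.exp (-t * V x) ∂μ = Real.exp (-t * c) := by
    rw [integral_congr_ae (hV.mono fun x hx => by rw [hx])]; simp
  have h2 : ∫ x, Real.exp (-t * V x) ^ 2 ∂μ = Real.exp (-t * c) ^ 2 := by
    rw [integral_congr_ae (hV.mono fun x hx => by rw [hx])]; simp
  rw [ESS, h1, h2, div_self (pow_ne_zero _ (Real.exp_pos _).ne')]

lemma ESS_zero : (ESS μ fun x => Real.exp (-0 * V x)) = 1 := by
  simp [ESS]

lemma strictAntiOn_ESS (hV : IsTest V) (hc : ∀ c, ¬ V =ᵐ[μ] fun _ => c) :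
    StrictAntiOn (fun t => ESS μ fun x => Real.exp (-t * V x)) (Set.Ici 0) := by
  refine strictAntiOn_of_deriv_neg (convex_Ici 0) (continuous_ESS hV).continuousOn fun t ht => ?_
  rw [interior_Ici] at ht
  rw [(hasDerivAt_ESS hV t).deriv]
  exact mul_neg_of_pos_of_neg (div_pos (mul_pos two_pos
    (integral_exp_mul_pos hV _)) (pow_pos (integral_exp_sq_pos hV _) 2)) (tilted_cov_neg hV ht hc)

end ESS

/-! ### The choice of the next inverse temperature -/

section NextTemp

variable {E : Type*} [MeasurableSpace E] {d : ℕ} (S : AdaptiveTempering E d)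
  {μ : Measure E} [IsProbabilityMeasure μ]

/-- At zero increment the ESS is 1 > α: the intermediate value theorem applies, and the solution
cannot sit at `b` itself. -/
lemma exists_ESS_eq (hV : IsTest S.V) {b c : ℝ} (hbc : b ≤ c)
    (h : (ESS μ fun x => Real.exp (-(c - b) * S.V x)) ≤ S.α) :
    ∃ β, b < β ∧ β ≤ c ∧ (ESS μ fun x => Real.exp (-(β - b) * S.V x)) = S.α := by
  have hcont : ContinuousOn (fun β => ESS μ fun x => Real.exp (-(β - b) * S.V x)) (Set.Icc b c) :=
    ((continuous_ESS (μ := μ) hV).comp (continuous_id.sub continuous_const)).continuousOn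
  have h1 : (ESS μ fun x => Real.exp (-(b - b) * S.V x)) = 1 := by
    rw [sub_self]; exact ESS_zero
  obtain ⟨β, hβ, he⟩ := intermediate_value_Icc' hbc hcont
    (show S.α ∈ Set.Icc _ _ from ⟨h, by simp only [h1]; exact S.α_lt_one.le⟩)
  refine ⟨β, lt_of_le_of_ne hβ.1 ?_, hβ.2, he⟩
  rintro rfl
  simp only [h1] at he
  exact S.α_lt_one.ne he.symm

/-- The ESS is nonincreasing in the increment; above the threshold at `βs`, it is above it at all
earlier points, and the solution set is empty. -/
lemma nextTemp_eq_of_lt (hV : IsTest S.V) {b : ℝ}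
    (h : S.α < ESS μ fun x => Real.exp (-(S.βs - b) * S.V x)) : S.nextTemp μ b = S.βs := by
  rw [nextTemp]
  refine if_neg ?_
  rintro ⟨β, h1, h2, h3⟩
  have h4 := antitoneOn_ESS (μ := μ) hV (show β - b ∈ Set.Ici 0 from sub_nonneg.2 h1.le)
    (show S.βs - b ∈ Set.Ici 0 from sub_nonneg.2 (h1.le.trans h2)) (by linarith)
  simp only at h4
  linarith

lemma nextTemp_mem_of_le (hV : IsTest S.V) {b : ℝ} (hb : b ≤ S.βs)
    (h : (ESS μ fun x => Real.exp (-(S.βs - b) * S.V x)) ≤ S.α) :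
    b < S.nextTemp μ b ∧ S.nextTemp μ b ≤ S.βs ∧
      (ESS μ fun x => Real.exp (-(S.nextTemp μ b - b) * S.V x)) = S.α := by
  have hne := exists_ESS_eq S (μ := μ) hV hb h
  rw [nextTemp]
  set T : Set ℝ :=
    {β | b < β ∧ β ≤ S.βs ∧ ESS μ (fun x => Real.exp (-(β - b) * S.V x)) = S.α} with hT
  have hTne : T.Nonempty := hne
  rw [if_pos hTne]
  -- The strict inequality `b < β` is automatic because the ESS at `b` is 1 ≠ α. Hence the solution
  -- set is closed and its infimum is attained.
  have hTeq : T = Set.Icc b S.βs ∩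
      (fun β => ESS μ fun x => Real.exp (-(β - b) * S.V x)) ⁻¹' {S.α} := by
    ext β
    constructor
    · rintro ⟨h1, h2, h3⟩
      exact ⟨⟨h1.le, h2⟩, h3⟩
    · rintro ⟨⟨h1, h2⟩, h3⟩
      refine ⟨lt_of_le_of_ne h1 ?_, h2, h3⟩
      rintro rfl
      have h4 : (ESS μ fun x => Real.exp (-(b - b) * S.V x)) = S.α := h3
      rw [sub_self, ESS_zero] at h4
      exact S.α_lt_one.ne h4.symm
  have hclosed : IsClosed T := by
    rw [hTeq]
    exact isClosed_Icc.inter (isClosed_singleton.preimage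
      ((continuous_ESS (μ := μ) hV).comp (continuous_id.sub continuous_const)))
  exact hclosed.csInf_mem hTne ⟨b, fun β hβ => hβ.1.le⟩

lemma le_nextTemp (hV : IsTest S.V) {b : ℝ} (hb : b ≤ S.βs) : b ≤ S.nextTemp μ b := by
  rcases lt_or_ge S.α (ESS μ fun x => Real.exp (-(S.βs - b) * S.V x)) with h | h
  · rwa [nextTemp_eq_of_lt S hV h]
  · exact (nextTemp_mem_of_le S hV hb h).1.le

lemma nextTemp_le (hV : IsTest S.V) {b : ℝ} (hb : b ≤ S.βs) : S.nextTemp μ b ≤ S.βs := by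
  rcases lt_or_ge S.α (ESS μ fun x => Real.exp (-(S.βs - b) * S.V x)) with h | h
  · rw [nextTemp_eq_of_lt S hV h]
  · exact (nextTemp_mem_of_le S hV hb h).2.1

lemma ESS_nextTemp_of_lt (hV : IsTest S.V) {b : ℝ} (hb : b ≤ S.βs) (h : S.nextTemp μ b < S.βs) :
    b < S.nextTemp μ b ∧ (ESS μ fun x => Real.exp (-(S.nextTemp μ b - b) * S.V x)) = S.α := by
  rcases lt_or_ge S.α (ESS μ fun x => Real.exp (-(S.βs - b) * S.V x)) with h' | h'
  · exact absurd (nextTemp_eq_of_lt S hV h') h.ne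
  · exact ⟨(nextTemp_mem_of_le S hV hb h').1, (nextTemp_mem_of_le S hV hb h').2.2⟩

/-- Random inverse temperatures are controlled through this equivalence: it yields their
measurability and, by bracketing, their consistency. At `c = βs` it would fail, since the left side
then always holds. -/
lemma nextTemp_le_iff (hV : IsTest S.V) {b c : ℝ} (hbc : b ≤ c) (hc : c < S.βs) :
    S.nextTemp μ b ≤ c ↔ (ESS μ fun x => Real.exp (-(c - b) * S.V x)) ≤ S.α := by
  have hb : b ≤ S.βs := hbc.trans hc.le
  constructor
  · intro h
    have h1 := ESS_nextTemp_of_lt S (μ := μ) hV hb (h.trans_lt hc)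
    rw [← h1.2]
    exact antitoneOn_ESS (μ := μ) hV (show S.nextTemp μ b - b ∈ Set.Ici 0 from
      sub_nonneg.2 h1.1.le) (show c - b ∈ Set.Ici 0 from sub_nonneg.2 hbc) (by linarith)
  · intro h
    obtain ⟨β, h1, h2, h3⟩ := exists_ESS_eq S (μ := μ) hV hbc h
    have hne : {β | b < β ∧ β ≤ S.βs ∧
        ESS μ (fun x => Real.exp (-(β - b) * S.V x)) = S.α}.Nonempty := ⟨β, h1, h2.trans hc.le, h3⟩
    rw [nextTemp]
    rw [if_pos hne]
    have hbdd : BddBelow {β | b < β ∧ β ≤ S.βs ∧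
        ESS μ (fun x => Real.exp (-(β - b) * S.V x)) = S.α} := ⟨b, fun β hβ => hβ.1.le⟩
    exact (csInf_le hbdd ⟨h1, h2.trans hc.le, h3⟩).trans h2

end NextTemp

/-! ### Empirical measures and reweighted measures -/

section Measures

variable {E : Type*} [MeasurableSpace E]

lemma isProbabilityMeasure_empirical {N : ℕ} (hN : N ≠ 0) (x : Fin N → E) :
    IsProbabilityMeasure (empirical x) := by
  refine ⟨?_⟩
  simp only [empirical, Measure.smul_apply, Measure.coe_finsetSum, Finset.sum_apply, measure_univ,
    Finset.sum_const, Finset.card_univ, Fintype.card_fin, smul_eq_mul, nsmul_eq_mul, mul_one]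
  exact ENNReal.inv_mul_cancel (by exact_mod_cast hN) (ENNReal.natCast_ne_top N)

lemma integral_empirical {F : Type*} [NormedAddCommGroup F] [NormedSpace ℝ F] [CompleteSpace F]
    {N : ℕ} (x : Fin N → E) {f : E → F} (hf : StronglyMeasurable f) :
    ∫ y, f y ∂empirical x = (N : ℝ)⁻¹ • ∑ i, f (x i) := by
  rw [empirical, integral_smul_measure, integral_finsetSum_measure fun i _ =>
    integrable_dirac' hf (by simp)]
  simp [integral_dirac' _ _ hf]

lemma integral_withDensity_ofReal {μ : Measure E} {w : E → ℝ} (hw : Measurable w)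
    (h0 : ∀ x, 0 ≤ w x) (f : E → ℝ) :
    ∫ x, f x ∂μ.withDensity (fun x => ENNReal.ofReal (w x)) = ∫ x, w x * f x ∂μ := by
  rw [integral_withDensity_eq_integral_toReal_smul hw.ennreal_ofReal
    (Eventually.of_forall fun x => ENNReal.ofReal_lt_top)]
  simp [ENNReal.toReal_ofReal (h0 _)]

lemma withDensity_ofReal_univ {μ : Measure E} {w : E → ℝ} (h0 : ∀ x, 0 ≤ w x)
    (hi : Integrable w μ) :
    μ.withDensity (fun x => ENNReal.ofReal (w x)) Set.univ = ENNReal.ofReal (∫ x, w x ∂μ) := by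
  rw [withDensity_apply _ .univ, setLIntegral_univ,
    ofReal_integral_eq_lintegral_ofReal hi (Eventually.of_forall h0)]

lemma isProbabilityMeasure_inv_smul {μ : Measure E} {a : ℝ} (ha : 0 < a)
    (h : μ Set.univ = ENNReal.ofReal a) : IsProbabilityMeasure ((μ Set.univ)⁻¹ • μ) := by
  refine ⟨?_⟩
  rw [Measure.smul_apply, smul_eq_mul, h]
  exact ENNReal.inv_mul_cancel (by simpa using ha) ENNReal.ofReal_ne_top

lemma integral_inv_smul {μ ν : Measure E} {a : ℝ} (ha : 0 < a)
    (h : μ Set.univ = ENNReal.ofReal a) (f : E → ℝ) :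
    ∫ x, f x ∂((μ Set.univ)⁻¹ • ν) = (∫ x, f x ∂ν) / a := by
  rw [integral_smul_measure, h, ENNReal.toReal_inv, ENNReal.toReal_ofReal ha.le, smul_eq_mul,
    div_eq_inv_mul]

lemma integral_bind_kernel {μ : Measure E} [IsFiniteMeasure μ] {κ : Kernel E E} [IsMarkovKernel κ]
    {f : E → ℝ} (hf : IsTest f) : ∫ x, f x ∂μ.bind κ = ∫ x, ∫ y, f y ∂κ x ∂μ := by
  have hi : Integrable f (μ.bind κ) := hf.integrable
  rw [Measure.comp_eq_comp_const_apply] at hi ⊢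
  rw [Kernel.integral_comp hi]
  simp

end Measures

/-- A sequence stopped at time `n`. -/
def stopPath {F : Type*} (x : ℕ → F) (n : ℕ) : ℕ → F := fun p => x (min p n)

lemma stopPath_eq {F : Type*} (x : ℕ → F) {n p : ℕ} (hp : p ≤ n) : stopPath x n p = x p := by
  rw [stopPath, min_eq_left hp]

section Basic

variable {E : Type*} [MeasurableSpace E] {d : ℕ} (S : AdaptiveTempering E d)

/-! ### The target distributions -/

/-- The normalising constant `m(e^{-bV})`. -/
def normConst (b : ℝ) : ℝ := ∫ x, Real.exp (-b * S.V x) ∂S.m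

lemma normConst_pos (hV : IsTest S.V) (b : ℝ) : 0 < S.normConst b := by
  have := S.finite_m
  have : NeZero S.m := ⟨S.m_ne_zero⟩
  exact integral_exp_pos (hV.exp (-b)).integrable

lemma withDensity_exp_univ (hV : IsTest S.V) (b : ℝ) :
    (S.m.withDensity fun x => ENNReal.ofReal (Real.exp (-b * S.V x))) Set.univ =
      ENNReal.ofReal (S.normConst b) := by
  have := S.finite_m
  exact withDensity_ofReal_univ (fun x => (Real.exp_pos _).le) (hV.exp (-b)).integrable

lemma isProbabilityMeasure_gibbs (hV : IsTest S.V) (b : ℝ) : IsProbabilityMeasure (S.gibbs b) :=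
  isProbabilityMeasure_inv_smul (S.normConst_pos hV b) (S.withDensity_exp_univ hV b)

lemma integral_gibbs (hV : IsTest S.V) (b : ℝ) (f : E → ℝ) :
    ∫ x, f x ∂S.gibbs b = (∫ x, Real.exp (-b * S.V x) * f x ∂S.m) / S.normConst b := by
  rw [gibbs]
  rw [integral_inv_smul (S.normConst_pos hV b) (S.withDensity_exp_univ hV b),
    integral_withDensity_ofReal (hV.exp (-b)).1 fun x => (Real.exp_pos _).le]

lemma isProbabilityMeasure_target (hV : IsTest S.V) (n : ℕ) : IsProbabilityMeasure (S.target n) :=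
  S.isProbabilityMeasure_gibbs hV _

lemma unnorm_eq (hV : IsTest S.V) (n : ℕ) (f : E → ℝ) :
    S.unnorm n f = S.normConst (S.temp n) / S.normConst S.β₀ * ∫ x, f x ∂S.target n := by
  have := (S.normConst_pos hV (S.temp n)).ne'
  rw [unnorm, target, S.integral_gibbs hV]
  change _ / S.normConst S.β₀ = _
  field_simp

lemma unnorm_one (hV : IsTest S.V) (n : ℕ) :
    S.unnorm n (fun _ => 1) = S.normConst (S.temp n) / S.normConst S.β₀ := by
  have := S.isProbabilityMeasure_target hV n
  rw [S.unnorm_eq hV]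
  simp

lemma unnorm_one_pos (hV : IsTest S.V) (n : ℕ) : 0 < S.unnorm n (fun _ => 1) := by
  rw [S.unnorm_one hV]
  exact div_pos (S.normConst_pos hV _) (S.normConst_pos hV _)

lemma unnorm_eq_mul (hV : IsTest S.V) (n : ℕ) (f : E → ℝ) :
    S.unnorm n f = S.unnorm n (fun _ => 1) * ∫ x, f x ∂S.target n := by
  rw [S.unnorm_one hV, S.unnorm_eq hV]

lemma temp_mem (hV : IsTest S.V) (n : ℕ) : S.β₀ ≤ S.temp n ∧ S.temp n ≤ S.βs := by
  induction n with
  | zero => exact ⟨le_rfl, S.β₀_le_βs⟩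
  | succ n ih =>
    have := S.isProbabilityMeasure_gibbs hV (S.temp n)
    exact ⟨ih.1.trans (le_nextTemp S hV ih.2), nextTemp_le S hV ih.2⟩

lemma temp_le_temp_succ (hV : IsTest S.V) (n : ℕ) : S.temp n ≤ S.temp (n + 1) := by
  have := S.isProbabilityMeasure_gibbs hV (S.temp n)
  exact le_nextTemp S hV (S.temp_mem hV n).2

lemma convex_domParam (n : ℕ) : Convex ℝ (S.domParam n) := by
  rintro θ ⟨h1, h2, h3, h4⟩ θ' ⟨h1', h2', h3', h4'⟩ a b ha hb hab
  refine ⟨?_, ?_, ?_, S.convex_domξ n h4 h4' ha hb hab⟩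
  · change S.β₀ ≤ a * θ.1 + b * θ'.1
    have e : S.β₀ = a * S.β₀ + b * S.β₀ := by rw [← add_mul, hab, one_mul]
    linarith [mul_le_mul_of_nonneg_left h1 ha, mul_le_mul_of_nonneg_left h1' hb]
  · change a * θ.1 + b * θ'.1 ≤ a * θ.2.1 + b * θ'.2.1
    linarith [mul_le_mul_of_nonneg_left h2 ha, mul_le_mul_of_nonneg_left h2' hb]
  · change a * θ.2.1 + b * θ'.2.1 ≤ S.βs
    have e : S.βs = a * S.βs + b * S.βs := by rw [← add_mul, hab, one_mul]
    linarith [mul_le_mul_of_nonneg_left h3 ha, mul_le_mul_of_nonneg_left h3' hb]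

lemma integrable_ξ {μ : Measure E} [IsFiniteMeasure μ] {n : ℕ} {C : ℝ}
    (hC : ∀ x, ‖S.ξ n x‖ ≤ C) : Integrable (S.ξ n) μ :=
  .of_bound (S.measurable_ξ n).aestronglyMeasurable C (Eventually.of_forall hC)

/-- Keeps the limiting and the random parameters inside the domain on which derivatives are assumed
to exist, although that domain need not be closed. -/
lemma integral_ξ_mem {μ : Measure E} [IsProbabilityMeasure μ] {n : ℕ} {C : ℝ}
    (hC : ∀ x, ‖S.ξ n x‖ ≤ C) : ∫ x, S.ξ n x ∂μ ∈ S.domξ n :=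
  integral_mem_of_convex μ (S.convex_domξ n) (S.integrable_ξ hC)
    fun x => S.range_ξ n ⟨x, rfl⟩

lemma param_mem (hV : IsTest S.V) (n : ℕ) {C : ℝ} (hC : ∀ x, ‖S.ξ (n + 1) x‖ ≤ C) :
    S.param n ∈ S.domParam (n + 1) := by
  have := S.isProbabilityMeasure_target hV n
  exact ⟨(S.temp_mem hV n).1, S.temp_le_temp_succ hV n, (S.temp_mem hV (n + 1)).2,
    S.integral_ξ_mem hC⟩

/-! ### The kernels -/

lemma isTest_potential (hV : IsTest S.V) (θ : Param d) : IsTest (S.potential θ) := hV.exp _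

lemma potential_pos (θ : Param d) (x : E) : 0 < S.potential θ x := Real.exp_pos _

lemma integral_potential_pos (hV : IsTest S.V) {μ : Measure E} [IsProbabilityMeasure μ]
    (θ : Param d) : 0 < ∫ x, S.potential θ x ∂μ := integral_exp_mul_pos hV _

lemma measurable_potential_uncurry : Measurable fun p : Param d × E => S.potential p.1 p.2 := by
  have hV := S.measurable_V
  unfold potential
  fun_prop

lemma measurable_Q_uncurry (n : ℕ) {φ : E → ℝ} (hφ : Measurable φ) :
    Measurable fun p : Param d × E => S.Q n p.1 φ p.2 := by
  have h2 : Measurable fun z => ∫ y, φ y ∂S.M n z :=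
    (hφ.stronglyMeasurable.integral_kernel (κ := S.M n)).measurable
  exact S.measurable_potential_uncurry.mul (h2.comp (by fun_prop : Measurable fun p : Param d × E => ((p.1.2.2, p.1.2.1), p.2)))

lemma isTest_Q (hV : IsTest S.V) (n : ℕ) (θ : Param d) {φ : E → ℝ} (hφ : IsTest φ) :
    IsTest (S.Q n θ φ) := by
  have := S.markov_M n
  obtain ⟨hm, C, hC⟩ := hφ
  obtain ⟨hG, B, hB⟩ := S.isTest_potential hV θ
  refine ⟨(S.measurable_Q_uncurry n hm).comp measurable_prodMk_left, B * C, fun x => ?_⟩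
  rw [Q, abs_mul]
  exact mul_le_mul (hB x) (abs_integral_le_of_bounded hC) (abs_nonneg _)
    ((abs_nonneg _).trans (hB x))

lemma Q_one (n : ℕ) (θ : Param d) (x : E) : S.Q n θ (fun _ => 1) x = S.potential θ x := by
  have := S.markov_M n
  simp [Q]

/-! ### The sampling distribution -/

section Phi

variable (hV : IsTest S.V) (n : ℕ) (θ : Param d) (μ : Measure E) [IsProbabilityMeasure μ]

include hV

lemma withDensity_potential_univ :
    (μ.withDensity fun y => ENNReal.ofReal (S.potential θ y)) Set.univ =
      ENNReal.ofReal (∫ x, S.potential θ x ∂μ) :=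
  withDensity_ofReal_univ (fun x => (S.potential_pos θ x).le) (S.isTest_potential hV θ).integrable

lemma isProbabilityMeasure_Phi : IsProbabilityMeasure (S.Phi n θ μ) := by
  have := S.markov_M n
  have h := S.withDensity_potential_univ hV θ μ
  refine ⟨?_⟩
  rw [Phi]
  rw [Measure.smul_apply, smul_eq_mul, Measure.bind_apply .univ (Kernel.aemeasurable _)]
  simp only [measure_univ, lintegral_one]
  rw [h]
  exact ENNReal.inv_mul_cancel (by simpa using S.integral_potential_pos hV θ)
    ENNReal.ofReal_ne_top

lemma integral_Phi {φ : E → ℝ} (hφ : IsTest φ) :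
    ∫ x, φ x ∂S.Phi n θ μ = (∫ x, S.Q n θ φ x ∂μ) / ∫ x, S.potential θ x ∂μ := by
  have := S.markov_M n
  have h := S.withDensity_potential_univ hV θ μ
  have hfin : IsFiniteMeasure (μ.withDensity fun y => ENNReal.ofReal (S.potential θ y)) :=
    ⟨by rw [h]; exact ENNReal.ofReal_lt_top⟩
  rw [Phi]
  rw [integral_inv_smul (S.integral_potential_pos hV θ) h, integral_bind_kernel hφ,
    integral_withDensity_ofReal (S.isTest_potential hV θ).1 fun x => (S.potential_pos θ x).le]
  rfl

end Phi

/-! ### Quantities attached to a particle path -/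

section Path

variable {N : ℕ}

lemma tempN_mem (hV : IsTest S.V) (hN : N ≠ 0) (x : ℕ → Fin N → E) (n : ℕ) :
    S.β₀ ≤ S.tempN x n ∧ S.tempN x n ≤ S.βs := by
  induction n with
  | zero => exact ⟨le_rfl, S.β₀_le_βs⟩
  | succ n ih =>
    have := isProbabilityMeasure_empirical hN (x n)
    exact ⟨ih.1.trans (le_nextTemp S hV ih.2), nextTemp_le S hV ih.2⟩

lemma paramN_mem (hV : IsTest S.V) (hN : N ≠ 0) (x : ℕ → Fin N → E) (n : ℕ) {C : ℝ}
    (hC : ∀ x, ‖S.ξ (n + 1) x‖ ≤ C) : S.paramN x n ∈ S.domParam (n + 1) := by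
  have := isProbabilityMeasure_empirical hN (x n)
  exact ⟨(S.tempN_mem hV hN x n).1, le_nextTemp S hV (S.tempN_mem hV hN x n).2,
    (S.tempN_mem hV hN x (n + 1)).2, S.integral_ξ_mem hC⟩

/-- The inverse temperature of index `n` is fixed before generation `n` is drawn, hence the strict
inequality. The parameter of index `n` contains β_{n+1}^N and therefore uses generation `n` too. -/
lemma tempN_congr {x y : ℕ → Fin N → E} (n : ℕ) (h : ∀ p < n, x p = y p) :
    S.tempN x n = S.tempN y n := by
  induction n with
  | zero => rfl
  | succ n ih =>
    simp only [tempN]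
    rw [ih fun p hp => h p (hp.trans n.lt_succ_self), h n n.lt_succ_self]

lemma paramN_congr {x y : ℕ → Fin N → E} (n : ℕ) (h : ∀ p ≤ n, x p = y p) :
    S.paramN x n = S.paramN y n := by
  rw [paramN, paramN, S.tempN_congr n fun p hp => h p hp.le,
    S.tempN_congr (n + 1) fun p hp => h p (Nat.lt_succ_iff.1 hp), h n le_rfl]

lemma unnormN_congr {x y : ℕ → Fin N → E} (n : ℕ) (h : ∀ p ≤ n, x p = y p) (φ : E → ℝ) :
    S.unnormN x n φ = S.unnormN y n φ := by
  rw [unnormN, unnormN, h n le_rfl]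
  congr 1
  refine Finset.prod_congr rfl fun p hp => ?_
  have hp' := Finset.mem_range.1 hp
  rw [S.paramN_congr p fun q hq => h q (hq.trans hp'.le), h p hp'.le]

lemma unnormN_one (hN : N ≠ 0) (x : ℕ → Fin N → E) (n : ℕ) : S.unnormN x n (fun _ => 1) =
    ∏ p ∈ Finset.range n, ∫ y, S.potential (S.paramN x p) y ∂empirical (x p) := by
  have := isProbabilityMeasure_empirical hN (x n)
  simp [unnormN]

lemma unnormN_eq_mul (hN : N ≠ 0) (x : ℕ → Fin N → E) (n : ℕ) (φ : E → ℝ) : S.unnormN x n φ =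
    S.unnormN x n (fun _ => 1) * ∫ y, φ y ∂empirical (x n) := by
  rw [S.unnormN_one hN, unnormN]

lemma unnormN_succ (x : ℕ → Fin N → E) (n : ℕ) (φ : E → ℝ) : S.unnormN x (n + 1) φ =
    S.unnormN x n (S.potential (S.paramN x n)) * ∫ y, φ y ∂empirical (x (n + 1)) := by
  rw [unnormN, unnormN, Finset.prod_range_succ]

/-! Measurability on the space of paths. -/

lemma measurable_integral_empirical (n : ℕ) {g : (ℕ → Fin N → E) → E → ℝ}
    (hg : Measurable fun p : (ℕ → Fin N → E) × E => g p.1 p.2) :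
    Measurable fun x : ℕ → Fin N → E => ∫ y, g x y ∂empirical (x n) := by
  have e : ∀ x : ℕ → Fin N → E, ∫ y, g x y ∂empirical (x n) = (N : ℝ)⁻¹ * ∑ i, g x (x n i) :=
    fun x => by
      have hx : Measurable (g x) := hg.comp measurable_prodMk_left
      rw [integral_empirical _ hx.stronglyMeasurable, smul_eq_mul]
  simp_rw [e]
  refine (Finset.measurable_fun_sum _ fun i _ => ?_).const_mul _
  exact hg.comp (by fun_prop : Measurable fun x : ℕ → Fin N → E => (x, x n i))

lemma measurable_tempN (hV : IsTest S.V) (n : ℕ) :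
    Measurable fun x : ℕ → Fin N → E => S.tempN x n := by
  rcases eq_or_ne N 0 with rfl | hN
  · exact Subsingleton.measurable
  induction n with
  | zero => exact measurable_const
  | succ n ih =>
    -- The temperature is an infimum over an uncountable set; below `βs` its sublevel sets are
    -- described by the ESS at the single point `c`.
    refine measurable_of_Iic fun c => ?_
    rcases lt_or_ge c S.βs with hc | hc
    · have e : (fun x : ℕ → Fin N → E => S.tempN x (n + 1)) ⁻¹' Set.Iic c =
          {x | S.tempN x n ≤ c} ∩
            {x | ESS (empirical (x n)) (fun y => Real.exp (-(c - S.tempN x n) * S.V y)) ≤ S.α} := by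
        ext x
        have := isProbabilityMeasure_empirical hN (x n)
        have hx := S.tempN_mem hV hN x n
        change S.nextTemp (empirical (x n)) (S.tempN x n) ≤ c ↔ S.tempN x n ≤ c ∧
          ESS (empirical (x n)) (fun y => Real.exp (-(c - S.tempN x n) * S.V y)) ≤ S.α
        by_cases h : S.tempN x n ≤ c
        · rw [nextTemp_le_iff S hV h hc, and_iff_right h]
        · refine iff_of_false (fun h' => h ?_) fun h' => h h'.1
          exact (le_nextTemp S hV hx.2).trans h'
      rw [e]
      have hVm := S.measurable_V
      have hm : Measurable fun p : (ℕ → Fin N → E) × E =>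
          Real.exp (-(c - S.tempN p.1 n) * S.V p.2) := by
        fun_prop
      refine (measurableSet_le ih measurable_const).inter (measurableSet_le ?_ measurable_const)
      exact ((measurable_integral_empirical n hm).pow_const 2).div
        (measurable_integral_empirical n (hm.pow_const 2))
    · have e : (fun x : ℕ → Fin N → E => S.tempN x (n + 1)) ⁻¹' Set.Iic c = Set.univ := by
        ext x
        simpa using (S.tempN_mem hV hN x (n + 1)).2.trans hc
      rw [e]
      exact .univ

lemma measurable_paramN (hV : IsTest S.V) (n : ℕ) :
    Measurable fun x : ℕ → Fin N → E => S.paramN x n := by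
  refine (S.measurable_tempN hV n).prodMk ((S.measurable_tempN hV (n + 1)).prodMk ?_)
  have hξ := S.measurable_ξ (n + 1)
  have e : ∀ x : ℕ → Fin N → E, ∫ y, S.ξ (n + 1) y ∂empirical (x n) =
      (N : ℝ)⁻¹ • ∑ i, S.ξ (n + 1) (x n i) := fun x =>
    integral_empirical _ hξ.stronglyMeasurable
  simp_rw [e]
  fun_prop

lemma measurable_unnormN (hV : IsTest S.V) (n : ℕ) {φ : E → ℝ} (hφ : Measurable φ) :
    Measurable fun x : ℕ → Fin N → E => S.unnormN x n φ := by
  refine Measurable.mul (Finset.measurable_fun_prod _ fun p _ => ?_)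
    (measurable_integral_empirical n (hφ.comp measurable_snd))
  have := S.measurable_paramN hV p (N := N)
  exact measurable_integral_empirical p (g := fun x y => S.potential (S.paramN x p) y)
    (S.measurable_potential_uncurry.comp
      (by fun_prop : Measurable fun q : (ℕ → Fin N → E) × E => (S.paramN q.1 p, q.2)))

lemma measurable_integral_Q (hV : IsTest S.V) (n k : ℕ) {φ : E → ℝ} (hφ : Measurable φ) :
    Measurable fun x : ℕ → Fin N → E => ∫ y, S.Q k (S.paramN x n) φ y ∂empirical (x n) := by
  have := S.measurable_paramN hV n (N := N)
  exact measurable_integral_empirical n (g := fun x y => S.Q k (S.paramN x n) φ y)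
    ((S.measurable_Q_uncurry k hφ).comp
      (by fun_prop : Measurable fun p : (ℕ → Fin N → E) × E => (S.paramN p.1 n, p.2)))

lemma measurable_Phi_path (hV : IsTest S.V) (hN : N ≠ 0) (n k : ℕ) :
    Measurable fun x : ℕ → Fin N → E => S.Phi k (S.paramN x n) (empirical (x n)) := by
  refine Measure.measurable_of_measurable_coe _ fun B hB => ?_
  have hφ : IsTest (B.indicator fun _ => (1 : ℝ)) :=
    ⟨measurable_const.indicator hB, 1, fun x => by
      by_cases h : x ∈ B <;> simp [h]⟩
  -- The mass of `B` is a ratio of two integrals of Q, with the indicator of `B` above and the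
  -- constant 1 below, both measurable in the path.
  have e : ∀ x : ℕ → Fin N → E, S.Phi k (S.paramN x n) (empirical (x n)) B =
      ENNReal.ofReal ((∫ y, S.Q k (S.paramN x n) (B.indicator fun _ => (1 : ℝ)) y
        ∂empirical (x n)) / ∫ y, S.Q k (S.paramN x n) (fun _ => 1) y ∂empirical (x n)) := by
    intro x
    have := isProbabilityMeasure_empirical hN (x n)
    have := S.isProbabilityMeasure_Phi hV k (S.paramN x n) (empirical (x n))
    simp_rw [S.Q_one]
    rw [← S.integral_Phi hV k _ _ hφ, integral_indicator_const _ hB]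
    simp
  simp_rw [e]
  exact ((S.measurable_integral_Q hV n k hφ.1).div
    (S.measurable_integral_Q hV n k measurable_const)).ennreal_ofReal

end Path

end Basic

/-! ### The conditional law of a generation of particles -/

section ConditionalLaw

variable {E : Type*} [MeasurableSpace E] {d : ℕ} (S : AdaptiveTempering E d)

lemma measurable_pi_const {α : Type*} [MeasurableSpace α] {N : ℕ} {ν : α → Measure E}
    (hν : Measurable ν) [∀ a, IsProbabilityMeasure (ν a)] :
    Measurable fun a => Measure.pi fun _ : Fin N => ν a := by
  refine Measurable.measure_of_isPiSystem_of_isProbabilityMeasure generateFrom_pi.symm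
    isPiSystem_pi ?_
  rintro _ ⟨B, hB, rfl⟩
  simp_rw [Measure.pi_pi]
  exact Finset.measurable_fun_prod _ fun i _ => (Measure.measurable_coe (hB i trivial)).comp hν

lemma measurable_stopPath {α : Type*} [MeasurableSpace α] (n : ℕ) :
    Measurable fun x : ℕ → α => stopPath x n :=
  measurable_pi_lambda _ fun p => measurable_pi_apply (min p n)

variable {Ω : Type*} [MeasurableSpace Ω] {P : Measure Ω} {N : ℕ}
  {X : ℕ → Fin N → Ω → E}

lemma history_le (hX : S.IsParticleSystem P X) (n : ℕ) : history X n ≤ ‹MeasurableSpace Ω› :=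
  Measurable.comap_le (measurable_pi_lambda _ fun _ => measurable_pi_lambda _ fun _ =>
    hX.measurable _ _)

lemma measurable_path (hX : S.IsParticleSystem P X) : Measurable fun ω p i => X p i ω :=
  measurable_pi_lambda _ fun _ => measurable_pi_lambda _ fun _ => hX.measurable _ _

/-- Stopping encodes the past as a point of the full path space, where all quantities of the
algorithm are defined; this ties that encoding to the σ-algebra used in `IsParticleSystem`. -/
lemma measurable_stopPath_history {Ω : Type*} {N : ℕ} {X : ℕ → Fin N → Ω → E} (n : ℕ) :
    Measurable[history X n] fun ω => stopPath (fun p i => X p i ω) n := by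
  let := history X n
  have h : Measurable fun ω (p : Fin (n + 1)) (i : Fin N) => X p i ω := comap_measurable _
  refine measurable_pi_lambda _ fun p => measurable_pi_lambda _ fun i => ?_
  exact ((measurable_pi_apply i).comp (measurable_pi_apply
    (⟨min p n, Nat.lt_succ_of_le (min_le_right p n)⟩ : Fin (n + 1)))).comp h

lemma Phi_stopPath (n : ℕ) (x : ℕ → Fin N → E) :
    S.Phi (n + 1) (S.paramN (stopPath x n) n) (empirical (stopPath x n n)) =
      S.Phi (n + 1) (S.paramN x n) (empirical (x n)) := by
  rw [S.paramN_congr n fun p hp => stopPath_eq x hp, stopPath_eq x le_rfl]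

/-- The initial generation. -/
lemma integral_prod_zero (hV : IsTest S.V) (hX : S.IsParticleSystem P X)
    {f : E → ℂ} (hf : Measurable f) :
    ∫ ω, ∏ i, f (X 0 i ω) ∂P = (∫ y, f y ∂S.target 0) ^ N := by
  have := S.isProbabilityMeasure_target hV 0
  have hy : Measurable fun ω i => X 0 i ω := measurable_pi_lambda _ fun _ => hX.measurable _ _
  have hF : Measurable fun y : Fin N → E => ∏ i, f (y i) := by fun_prop
  have h1 := integral_map (μ := P) hy.aemeasurable hF.aestronglyMeasurable
  rw [hX.initial, integral_fintype_prod_eq_prod] at h1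
  rw [← h1]
  simp

variable [IsProbabilityMeasure P]

/-- Given the past, the particles of the next generation are i.i.d. -/
lemma map_stopPath_prod (hV : IsTest S.V) (hN : N ≠ 0) (hX : S.IsParticleSystem P X) (n : ℕ)
    (κ : Kernel (ℕ → Fin N → E) (Fin N → E)) [IsMarkovKernel κ]
    (hκ : ∀ x, κ x = Measure.pi fun _ => S.Phi (n + 1) (S.paramN x n) (empirical (x n))) :
    P.map (fun ω => (stopPath (fun p i => X p i ω) n, fun i => X (n + 1) i ω)) =
      (P.map fun ω => stopPath (fun p i => X p i ω) n) ⊗ₘ κ := by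
  have hprob : ∀ x : ℕ → Fin N → E,
      IsProbabilityMeasure (S.Phi (n + 1) (S.paramN x n) (empirical (x n))) := fun x => by
    have := isProbabilityMeasure_empirical hN (x n)
    exact S.isProbabilityMeasure_Phi hV _ _ _
  have hle := S.history_le hX n
  have hs : Measurable fun ω => stopPath (fun p i => X p i ω) n :=
    (measurable_stopPath n).comp (S.measurable_path hX)
  have hy : Measurable fun ω i => X (n + 1) i ω :=
    measurable_pi_lambda _ fun _ => hX.measurable _ _
  have := Measure.isProbabilityMeasure_map (μ := P) hs.aemeasurable
  have hbox : ∀ (s : Set (ℕ → Fin N → E)), MeasurableSet s → ∀ (B : Fin N → Set E),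
      (∀ i, MeasurableSet (B i)) →
      P.map (fun ω => (stopPath (fun p i => X p i ω) n, fun i => X (n + 1) i ω))
        (s ×ˢ Set.univ.pi B) =
      ((P.map fun ω => stopPath (fun p i => X p i ω) n) ⊗ₘ κ) (s ×ˢ Set.univ.pi B) := by
    intro s hsm B hB
    have hBm : MeasurableSet (Set.univ.pi B) := MeasurableSet.univ_pi hB
    rw [Measure.map_apply (hs.prodMk hy) (hsm.prod hBm), Measure.compProd_apply_prod hsm hBm,
      setLIntegral_map hsm (κ.measurable_coe hBm) hs]
    set A : Set Ω := (fun ω => stopPath (fun p i => X p i ω) n) ⁻¹' s with hA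
    have hAm : MeasurableSet[history X n] A := measurable_stopPath_history n hsm
    set D : Set Ω := ⋂ i, X (n + 1) i ⁻¹' B i with hD
    have hDm : MeasurableSet D := MeasurableSet.iInter fun i => hX.measurable _ _ (hB i)
    have e1 : (fun ω => (stopPath (fun p i => X p i ω) n, fun i => X (n + 1) i ω)) ⁻¹'
        s ×ˢ Set.univ.pi B = A ∩ D := by
      ext ω
      simp [hA, hD]
    have e2 : ∀ ω, κ (stopPath (fun p i => X p i ω) n) (Set.univ.pi B) = ENNReal.ofReal
        (∏ i, (S.Phi (n + 1) (S.paramN (fun p j => X p j ω) n)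
          (empirical fun j => X n j ω)).real (B i)) := by
      intro ω
      have := hprob fun p i => X p i ω
      rw [hκ, S.Phi_stopPath, Measure.pi_pi, ENNReal.ofReal_prod_of_nonneg
        fun i _ => measureReal_nonneg]
      simp
    rw [e1]
    simp_rw [e2]
    -- Integrating the conditional probability of `D` over the past event `A` gives the probability
    -- of `A ∩ D`.
    have h3 := setIntegral_condExp hle (μ := P)
      (f := D.indicator fun _ => (1 : ℝ)) ((integrable_const 1).indicator hDm) hAm
    rw [setIntegral_congr_ae (hle _ hAm) ((hX.step n B hB).mono fun ω hω _ => hω)] at h3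
    rw [setIntegral_indicator hDm, setIntegral_const, smul_eq_mul, mul_one] at h3
    have hint : Integrable (fun ω => ∏ i, (S.Phi (n + 1) (S.paramN (fun p j => X p j ω) n)
          (empirical fun j => X n j ω)).real (B i)) P :=
      integrable_condExp.congr (hX.step n B hB)
    rw [← ofReal_integral_eq_lintegral_ofReal hint.integrableOn
      (Eventually.of_forall fun ω => Finset.prod_nonneg fun i _ => measureReal_nonneg), h3]
    simp
  -- For fixed `s`, both sides are finite measures in `t`, obtained by restriction and projection;
  -- they agree on the π-system of boxes, hence everywhere.
  refine Measure.ext_prod fun {s} {t} hsm ht => ?_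
  have key : ∀ (ρ : Measure ((ℕ → Fin N → E) × (Fin N → E))) (t : Set (Fin N → E)),
      MeasurableSet t → (ρ.restrict (s ×ˢ Set.univ)).map Prod.snd t = ρ (s ×ˢ t) := by
    intro ρ t ht
    rw [Measure.map_apply measurable_snd ht, Measure.restrict_apply (measurable_snd ht)]
    congr 1
    ext z
    simp [and_comm]
  rw [← key _ t ht, ← key _ t ht]
  congr 1
  have := Measure.isProbabilityMeasure_map (μ := P) (hs.prodMk hy).aemeasurable
  refine ext_of_generate_finite _ generateFrom_pi.symm isPiSystem_pi ?_ ?_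
  · rintro _ ⟨B, hB, rfl⟩
    have hBm : ∀ i, MeasurableSet (B i) := fun i => hB i trivial
    rw [key _ _ (MeasurableSet.univ_pi hBm), key _ _ (MeasurableSet.univ_pi hBm)]
    exact hbox s hsm B hBm
  · rw [key _ _ .univ, key _ _ .univ]
    simpa using hbox s hsm (fun _ => Set.univ) fun _ => .univ

/-- Integration of the last generation conditionally on the past. -/
lemma integral_mul_prod (hV : IsTest S.V) (hN : N ≠ 0) (hX : S.IsParticleSystem P X) (n : ℕ)
    {U : (ℕ → Fin N → E) → ℂ} (hU : Measurable U) {C : ℝ} (hUC : ∀ x, ‖U x‖ ≤ C)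
    (hpast : ∀ x, U (stopPath x n) = U x) {f : E → ℂ} (hf : Measurable f) {B : ℝ}
    (hfB : ∀ x, ‖f x‖ ≤ B) :
    ∫ ω, U (fun p i => X p i ω) * ∏ i, f (X (n + 1) i ω) ∂P =
      ∫ ω, U (fun p i => X p i ω) * (∫ y, f y ∂S.Phi (n + 1) (S.paramN (fun p i => X p i ω) n)
        (empirical fun i => X n i ω)) ^ N ∂P := by
  have hprob : ∀ x : ℕ → Fin N → E,
      IsProbabilityMeasure (S.Phi (n + 1) (S.paramN x n) (empirical (x n))) := fun x => by
    have := isProbabilityMeasure_empirical hN (x n)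
    exact S.isProbabilityMeasure_Phi hV _ _ _
  let κ : Kernel (ℕ → Fin N → E) (Fin N → E) :=
    ⟨fun x => Measure.pi fun _ => S.Phi (n + 1) (S.paramN x n) (empirical (x n)),
      measurable_pi_const (S.measurable_Phi_path hV hN n (n + 1))⟩
  have hκ : ∀ x, κ x = Measure.pi fun _ => S.Phi (n + 1) (S.paramN x n) (empirical (x n)) :=
    fun _ => rfl
  have hκm : IsMarkovKernel κ := ⟨fun x => by rw [hκ]; infer_instance⟩
  have hs : Measurable fun ω => stopPath (fun p i => X p i ω) n :=
    (measurable_stopPath n).comp (S.measurable_path hX)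
  have hy : Measurable fun ω i => X (n + 1) i ω :=
    measurable_pi_lambda _ fun _ => hX.measurable _ _
  have := Measure.isProbabilityMeasure_map (μ := P) hs.aemeasurable
  have hF : Measurable fun z : (ℕ → Fin N → E) × (Fin N → E) => U z.1 * ∏ i, f (z.2 i) := by
    fun_prop
  have hFb : ∀ z : (ℕ → Fin N → E) × (Fin N → E), ‖U z.1 * ∏ i, f (z.2 i)‖ ≤ C * B ^ N := by
    intro z
    rw [norm_mul, norm_prod]
    refine mul_le_mul (hUC _) ?_ (by positivity) ((norm_nonneg _).trans (hUC z.1))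
    calc ∏ i, ‖f (z.2 i)‖ ≤ ∏ _i : Fin N, B :=
          Finset.prod_le_prod (fun i _ => norm_nonneg _) fun i _ => hfB _
      _ = B ^ N := by simp
  have h1 := S.map_stopPath_prod hV hN hX n κ hκ
  have h2 := congrArg (fun ρ => ∫ z : (ℕ → Fin N → E) × (Fin N → E), U z.1 * ∏ i, f (z.2 i) ∂ρ) h1
  rw [integral_map (hs.prodMk hy).aemeasurable hF.aestronglyMeasurable,
    Measure.integral_compProd (.of_bound hF.aestronglyMeasurable _ (Eventually.of_forall hFb))] at h2
  have h3 : ∀ x, ∫ y, U x * ∏ i, f (y i) ∂κ x =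
      U x * (∫ y, f y ∂S.Phi (n + 1) (S.paramN x n) (empirical (x n))) ^ N := by
    intro x
    rw [integral_const_mul, hκ, integral_fintype_prod_eq_prod]
    simp
  simp_rw [h3] at h2
  have hm : Measurable fun x : ℕ → Fin N → E =>
      U x * (∫ y, f y ∂S.Phi (n + 1) (S.paramN x n) (empirical (x n))) ^ N := by
    let κ' : Kernel (ℕ → Fin N → E) E := ⟨fun x => S.Phi (n + 1) (S.paramN x n) (empirical (x n)),
      S.measurable_Phi_path hV hN n (n + 1)⟩
    have : Measurable fun x => ∫ y, f y ∂κ' x :=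
      (hf.stronglyMeasurable.integral_kernel (κ := κ')).measurable
    exact hU.mul (this.pow_const N)
  rw [integral_map hs.aemeasurable hm.aestronglyMeasurable] at h2
  simp only [hpast, S.Phi_stopPath] at h2
  exact h2

end ConditionalLaw

/-! ### Expansion of the kernels around the limiting parameter -/

section Expansion

variable {E : Type*} [MeasurableSpace E] {d : ℕ} (S : AdaptiveTempering E d)

lemma BoundedContinuous.isTest_V {S : AdaptiveTempering E d} (h : S.BoundedContinuous) :
    IsTest S.V := ⟨S.measurable_V, h.bounded_V⟩

lemma BoundedContinuous.param_mem {S : AdaptiveTempering E d} (h : S.BoundedContinuous) (n : ℕ) :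
    S.param n ∈ S.domParam (n + 1) := by
  obtain ⟨C, hC⟩ := h.bounded_ξ (n + 1)
  exact S.param_mem h.isTest_V n hC

lemma integral_exp_mul_kernel (hV : IsTest S.V) (n : ℕ) {z : EuclideanSpace ℝ (Fin d)}
    (hz : z ∈ S.domξ n) {b : ℝ} (hb : b ∈ Set.Icc S.β₀ S.βs) {φ : E → ℝ} (hφ : IsTest φ) :
    ∫ x, Real.exp (-b * S.V x) * ∫ y, φ y ∂S.M n ((z, b), x) ∂S.m =
      ∫ x, Real.exp (-b * S.V x) * φ x ∂S.m := by
  have := S.markov_M n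
  have := S.finite_m
  have hm := (hV.exp (-b)).1
  have h := S.invariant_M n z hz b hb
  have hfin : IsFiniteMeasure (S.m.withDensity fun x => ENNReal.ofReal (Real.exp (-b * S.V x))) :=
    ⟨by rw [S.withDensity_exp_univ hV b]; exact ENNReal.ofReal_lt_top⟩
  have h1 := integral_bind_kernel (κ := (S.M n).sectR (z, b))
    (μ := S.m.withDensity fun x => ENNReal.ofReal (Real.exp (-b * S.V x))) hφ
  rw [h, integral_withDensity_ofReal hm fun x => (Real.exp_pos _).le,
    integral_withDensity_ofReal hm fun x => (Real.exp_pos _).le] at h1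
  exact h1.symm

/-- Invariance of the kernels: the `V`-tilted mean of `Q_θ φ` under `η_n` does not depend on the
statistic. -/
lemma integral_exp_mul_Q (hV : IsTest S.V) (n : ℕ) {θ : Param d} (hθ : θ ∈ S.domParam (n + 1))
    {φ : E → ℝ} (hφ : IsTest φ) :
    ∫ x, S.Q (n + 1) θ φ x * Real.exp (-(θ.1 - S.temp n) * S.V x) ∂S.target n =
      (∫ x, Real.exp (-θ.2.1 * S.V x) * φ x ∂S.m) / S.normConst (S.temp n) := by
  obtain ⟨h1, h2, h3, h4⟩ := hθ
  rw [target, S.integral_gibbs hV,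
    ← S.integral_exp_mul_kernel hV (n + 1) h4 ⟨h1.trans h2, h3⟩ hφ]
  congr 2
  ext x
  have e : Real.exp (-θ.2.1 * S.V x) = Real.exp (-S.temp n * S.V x) *
      (Real.exp (-(θ.2.1 - θ.1) * S.V x) * Real.exp (-(θ.1 - S.temp n) * S.V x)) := by
    rw [← Real.exp_add, ← Real.exp_add]
    congr 1
    ring
  rw [e, Q, potential]
  ring

lemma integral_Q_of_fst_eq (hV : IsTest S.V) (n : ℕ) {θ : Param d} (hθ : θ ∈ S.domParam (n + 1))
    (h : θ.1 = S.temp n) {φ : E → ℝ} (hφ : IsTest φ) :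
    ∫ x, S.Q (n + 1) θ φ x ∂S.target n =
      (∫ x, Real.exp (-θ.2.1 * S.V x) * φ x ∂S.m) / S.normConst (S.temp n) := by
  rw [← S.integral_exp_mul_Q hV n hθ hφ, h]
  simp

/-- Reweighting by G_n moves the Gibbs weight from β_n to β_{n+1}, and the kernel leaves the latter
invariant. -/
lemma unnorm_Q (hA : S.BoundedContinuous) (n : ℕ) {φ : E → ℝ} (hφ : IsTest φ) :
    S.unnorm n (S.Q (n + 1) (S.param n) φ) = S.unnorm (n + 1) φ := by
  have h1 := (S.normConst_pos hA.isTest_V (S.temp n)).ne'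
  rw [S.unnorm_eq hA.isTest_V, S.integral_Q_of_fst_eq hA.isTest_V n (hA.param_mem n) rfl hφ]
  rw [unnorm]
  change _ = _ / S.normConst S.β₀
  change _ / S.normConst S.β₀ * ((∫ x, Real.exp (-S.temp (n + 1) * S.V x) * φ x ∂S.m) / _) = _
  field_simp

/-- Expansion of `η_n(Q_θ φ)` in the inverse temperatures. -/
lemma exists_abs_integral_Q_sub_le (hA : S.BoundedContinuous) (n : ℕ) {φ : E → ℝ}
    (hφ : IsTest φ) : ∃ K : ℝ, 0 ≤ K ∧ ∀ θ ∈ S.domParam (n + 1), |θ.1 - S.temp n| ≤ 1 →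
      |θ.2.1 - S.temp (n + 1)| ≤ 1 →
      |∫ x, S.Q (n + 1) θ φ x ∂S.target n - ∫ x, S.Q (n + 1) (S.param n) φ x ∂S.target n -
        (θ.1 - S.temp n) * ∫ x, S.V x * S.Q (n + 1) θ φ x ∂S.target n +
        (θ.2.1 - S.temp (n + 1)) * ((∫ x, S.V x * (Real.exp (-S.temp (n + 1) * S.V x) * φ x) ∂S.m) /
          S.normConst (S.temp n))| ≤
        K * (|θ.1 - S.temp n| ^ 2 + |θ.2.1 - S.temp (n + 1)| ^ 2) := by
  have hV := hA.isTest_V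
  have := S.isProbabilityMeasure_target hV n
  have := S.finite_m
  obtain ⟨B, hB⟩ := hA.bounded_Q n φ hφ
  obtain ⟨hVm, C, hC⟩ := hV
  have hV : IsTest S.V := ⟨hVm, C, hC⟩
  obtain ⟨hf, B', hB'⟩ := (hV.exp (-S.temp (n + 1))).mul hφ
  have hZ := S.normConst_pos hV (S.temp n)
  set K₁ := B * (C ^ 2 * Real.exp C) * (S.target n).real Set.univ
  set K₂ := B' * (C ^ 2 * Real.exp C) * S.m.real Set.univ / S.normConst (S.temp n)
  refine ⟨max |K₁| |K₂|, le_max_of_le_left (abs_nonneg _), fun θ hθ h1 h2 => ?_⟩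
  -- Tilting by the error of the first temperature makes the mean of `Q_θ φ` explicit in the second
  -- one, by invariance; no derivative of the kernel is needed. The coefficient keeps Q at `θ`; its
  -- limit is taken later, by `tendsto_integral_mul_Q`.
  have e1 := abs_integral_mul_exp_sub_le (S.isTest_Q hV (n + 1) θ hφ).1 hVm (fun x => hB x θ hθ) hC
    (S.target n) h1
  have e2 := abs_integral_mul_exp_sub_le hf hVm hB' hC S.m h2
  have e3 : ∀ x, Real.exp (-S.temp (n + 1) * S.V x) * φ x *
      Real.exp (-(θ.2.1 - S.temp (n + 1)) * S.V x) = Real.exp (-θ.2.1 * S.V x) * φ x := by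
    intro x
    have : Real.exp (-θ.2.1 * S.V x) = Real.exp (-S.temp (n + 1) * S.V x) *
        Real.exp (-(θ.2.1 - S.temp (n + 1)) * S.V x) := by
      rw [← Real.exp_add]; congr 1; ring
    rw [this]; ring
  simp_rw [e3] at e2
  rw [S.integral_exp_mul_Q hV n hθ hφ] at e1
  rw [S.integral_Q_of_fst_eq hV n (hA.param_mem n) rfl hφ]
  change |_ - (∫ x, Real.exp (-S.temp (n + 1) * S.V x) * φ x ∂S.m) / _ - _ + _| ≤ _
  have e4 : |((∫ x, Real.exp (-θ.2.1 * S.V x) * φ x ∂S.m) -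
      (∫ x, Real.exp (-S.temp (n + 1) * S.V x) * φ x ∂S.m) + (θ.2.1 - S.temp (n + 1)) *
      ∫ x, S.V x * (Real.exp (-S.temp (n + 1) * S.V x) * φ x) ∂S.m) / S.normConst (S.temp n)| ≤
      K₂ * (θ.2.1 - S.temp (n + 1)) ^ 2 := by
    rw [abs_div, abs_of_pos hZ, div_le_iff₀ hZ]
    refine e2.trans (le_of_eq ?_)
    simp only [K₂]
    field_simp
  rw [sq_abs, sq_abs, mul_add]
  have f1 : K₁ * (θ.1 - S.temp n) ^ 2 ≤ max |K₁| |K₂| * (θ.1 - S.temp n) ^ 2 := by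
    gcongr; exact (le_abs_self _).trans (le_max_left _ _)
  have f2 : K₂ * (θ.2.1 - S.temp (n + 1)) ^ 2 ≤
      max |K₁| |K₂| * (θ.2.1 - S.temp (n + 1)) ^ 2 := by
    gcongr; exact (le_abs_self _).trans (le_max_right _ _)
  rw [add_div, sub_div, mul_div_assoc] at e4
  have g1 := abs_le.1 (e1.trans f1)
  have g2 := abs_le.1 (e4.trans f2)
  rw [abs_le]
  constructor <;> linarith [g1.1, g1.2, g2.1, g2.2]

/-- Uniform differentiability of the kernels at the limiting parameter. -/
lemma exists_abs_Q_sub_sub_le (hA : S.BoundedContinuous) (n : ℕ) {φ : E → ℝ}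
    {D : E → Param d → (Param d →L[ℝ] ℝ)}
    (hD : ∀ x, ∀ θ ∈ S.domParam (n + 1), HasFDerivWithinAt (fun θ' => S.Q (n + 1) θ' φ x) (D x θ)
      (S.domParam (n + 1)) θ)
    (hDc : TendstoUniformly (fun θ x => D x θ) (fun x => D x (S.param n))
      (𝓝[S.domParam (n + 1)] S.param n)) {ε : ℝ} (hε : 0 < ε) :
    ∀ᶠ θ in 𝓝[S.domParam (n + 1)] S.param n, ∀ x,
      |S.Q (n + 1) θ φ x - S.Q (n + 1) (S.param n) φ x - D x (S.param n) (θ - S.param n)| ≤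
        ε * ‖θ - S.param n‖ := by
  have h1 := Metric.tendstoUniformly_iff.1 hDc ε hε
  obtain ⟨δ, hδ, hball⟩ := Metric.mem_nhdsWithin_iff.1 h1
  have hmem : Metric.ball (S.param n) δ ∩ S.domParam (n + 1) ∈
      𝓝[S.domParam (n + 1)] S.param n :=
    Filter.inter_mem (mem_nhdsWithin_of_mem_nhds (Metric.ball_mem_nhds _ hδ)) self_mem_nhdsWithin
  filter_upwards [hmem] with θ hθ x
  have hconv : Convex ℝ (Metric.ball (S.param n) δ ∩ S.domParam (n + 1)) :=
    (convex_ball _ _).inter (S.convex_domParam (n + 1))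
  have := hconv.norm_image_sub_le_of_norm_hasFDerivWithin_le'
    (f := fun θ' => S.Q (n + 1) θ' φ x) (f' := D x) (φ := D x (S.param n)) (C := ε)
    (fun θ' hθ' => (hD x θ' hθ'.2).mono Set.inter_subset_right)
    (fun θ' hθ' => by
      have := (hball hθ') x
      rw [dist_eq_norm, norm_sub_rev] at this
      exact this.le)
    ⟨Metric.mem_ball_self hδ, hA.param_mem n⟩ hθ
  exact this

/-- The derivative of the kernels in a direction of the span of the domain is measurable. -/
lemma isTest_deriv (hA : S.BoundedContinuous) (n : ℕ) {φ : E → ℝ} (hφ : IsTest φ)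
    {D : E → Param d → (Param d →L[ℝ] ℝ)}
    (hD : ∀ x, ∀ θ ∈ S.domParam (n + 1), HasFDerivWithinAt (fun θ' => S.Q (n + 1) θ' φ x) (D x θ)
      (S.domParam (n + 1)) θ) {C : ℝ} (hC : ∀ x, ∀ θ ∈ S.domParam (n + 1), ‖D x θ‖ ≤ C)
    {v : Param d}
    (hv : v ∈ Submodule.span ℝ ((fun θ => θ - S.param n) '' S.domParam (n + 1))) :
    IsTest fun x => D x (S.param n) v := by
  have hmem := hA.param_mem n
  refine ⟨?_, C * ‖v‖, fun x => ?_⟩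
  · induction hv using Submodule.span_induction with
    | zero => simp only [map_zero]; exact measurable_const
    | add u w _ _ hu hw => simp only [map_add]; exact hu.add hw
    | smul a u _ hu => simp only [map_smul, smul_eq_mul]; exact hu.const_mul a
    -- The segment from the limiting parameter to `θ` stays in the convex domain, so the derivative
    -- is a limit of difference quotients along it. The domain may be degenerate, and directions
    -- outside the span are not controlled.
    | mem w hw =>
      obtain ⟨θ, hθ, rfl⟩ := hw
      let t : ℕ → ℝ := fun k => 1 / ((k : ℝ) + 1)
      have ht0 : ∀ k, 0 < t k := fun k => by positivity
      have ht1 : ∀ k, t k ≤ 1 := fun k => by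
        rw [div_le_one (by positivity)]; linarith [Nat.cast_nonneg (α := ℝ) k]
      have htl : Tendsto t atTop (𝓝 0) := tendsto_one_div_add_atTop_nhds_zero_nat
      have hin : ∀ k, S.param n + t k • (θ - S.param n) ∈ S.domParam (n + 1) := fun k =>
        (S.convex_domParam (n + 1)).add_smul_sub_mem hmem hθ ⟨(ht0 k).le, ht1 k⟩
      refine measurable_of_tendsto_metrizable (f := fun k x => (t k)⁻¹ *
        (S.Q (n + 1) (S.param n + t k • (θ - S.param n)) φ x - S.Q (n + 1) (S.param n) φ x))
        (fun k => ?_) (tendsto_pi_nhds.2 fun x => ?_)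
      · exact ((S.isTest_Q hA.isTest_V _ _ hφ).1.sub (S.isTest_Q hA.isTest_V _ _ hφ).1).const_mul _
      · refine (hD x _ hmem).lim (l := atTop) (c := fun k => (t k)⁻¹)
          (d := fun k => t k • (θ - S.param n)) (v := θ - S.param n) ?_
          (Eventually.of_forall hin) ?_
        · simpa using htl.smul_const (θ - S.param n)
        · refine tendsto_const_nhds.congr fun k => ?_
          rw [smul_smul, inv_mul_cancel₀ (ht0 k).ne', one_smul]
  · exact ((D x (S.param n)).le_opNorm v).trans
      (mul_le_mul_of_nonneg_right (hC x _ hmem) (norm_nonneg _))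

/-! ### Limits along random measures and random parameters -/

section Limits

variable {ι : Type*} {L : Filter ι} {ηN : ι → Measure E} {n : ℕ} {θN : ι → Param d}

/-- Stochastic equicontinuity of the kernels at the limiting parameter. -/
lemma tendsto_integral_Q_sub_div (hA : S.BoundedContinuous) (hA4 : S.DifferentiableKernels)
    {φ : E → ℝ} (hφ : IsTest φ) (hprob : ∀ᶠ i in L, IsProbabilityMeasure (ηN i))
    (hη : ∀ f, IsTest f → Tendsto (fun i => ∫ x, f x ∂ηN i) L (𝓝 (∫ x, f x ∂S.target n)))
    (hθ : Tendsto θN L (𝓝[S.domParam (n + 1)] S.param n)) :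
    Tendsto (fun i => (∫ x, S.Q (n + 1) (θN i) φ x ∂ηN i - ∫ x, S.Q (n + 1) (S.param n) φ x ∂ηN i -
      (∫ x, S.Q (n + 1) (θN i) φ x ∂S.target n - ∫ x, S.Q (n + 1) (S.param n) φ x ∂S.target n)) /
        ‖θN i - S.param n‖) L (𝓝 0) := by
  have hV := hA.isTest_V
  have := S.isProbabilityMeasure_target hV n
  obtain ⟨D, hD, ⟨C, hC⟩, hDc⟩ := hA4 n φ hφ
  -- On the finite-dimensional span of admissible directions, the derivative at the limit is a
  -- combination of finitely many test functions, with coefficients linear in the direction.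
  -- Convergence of the integrals of these functions is therefore uniform over unit directions.
  set W := Submodule.span ℝ ((fun θ => θ - S.param n) '' S.domParam (n + 1)) with hW
  let b := Module.finBasis ℝ W
  let c : Fin (Module.finrank ℝ W) → (W →L[ℝ] ℝ) := fun j =>
    LinearMap.toContinuousLinearMap (b.coord j)
  have hDb : ∀ j, IsTest fun x => D x (S.param n) (b j : Param d) := fun j =>
    S.isTest_deriv hA n hφ hD hC (b j).2
  have hDW : ∀ (x : E) (w : W), D x (S.param n) (w : Param d) =
      ∑ j, c j w * D x (S.param n) (b j : Param d) := by
    intro x w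
    have h := congrArg (fun w : W => D x (S.param n) (w : Param d)) (b.sum_repr w)
    simp only [AddSubmonoidClass.coe_finsetSum, Submodule.coe_smul, map_sum, map_smul,
      smul_eq_mul] at h
    exact h.symm
  have hS : Tendsto (fun i => ∑ j, ‖c j‖ * |∫ x, D x (S.param n) (b j : Param d) ∂ηN i -
      ∫ x, D x (S.param n) (b j : Param d) ∂S.target n|) L (𝓝 0) := by
    have : Tendsto (fun i => ∑ j, ‖c j‖ * |∫ x, D x (S.param n) (b j : Param d) ∂ηN i -
        ∫ x, D x (S.param n) (b j : Param d) ∂S.target n|) L (𝓝 (∑ j, ‖c j‖ * |(0 : ℝ)|)) := by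
      refine tendsto_finsetSum _ fun j _ => (Tendsto.abs ?_).const_mul _
      rw [← sub_self (∫ x, D x (S.param n) (b j : Param d) ∂S.target n)]
      exact (hη _ (hDb j)).sub_const _
    simpa using this
  rw [Metric.tendsto_nhds]
  intro ε hε
  -- Budget: a Taylor remainder ε/4 under each of the two measures, and ε/2 for the difference of
  -- the derivative terms.
  have h1 := hθ.eventually (S.exists_abs_Q_sub_sub_le hA n hD hDc (ε := ε / 4) (by positivity))
  have h2 := hS.eventually_lt_const (show (0 : ℝ) < ε / 2 by positivity)
  have h3 := hθ.eventually (self_mem_nhdsWithin)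
  filter_upwards [h1, h2, h3, hprob] with i h1 h2 h3 h4
  rw [dist_zero_right, Real.norm_eq_abs]
  rcases eq_or_ne ‖θN i - S.param n‖ 0 with h0 | h0
  · rw [h0, div_zero, abs_zero]; exact hε
  have hpos : 0 < ‖θN i - S.param n‖ := lt_of_le_of_ne (norm_nonneg _) h0.symm
  rw [abs_div, abs_norm, div_lt_iff₀ hpos]
  let w : W := ⟨θN i - S.param n, Submodule.subset_span ⟨_, h3, rfl⟩⟩
  have hint : ∀ (μ : Measure E) [IsFiniteMeasure μ],
      ∫ x, D x (S.param n) (θN i - S.param n) ∂μ =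
        ∑ j, c j w * ∫ x, D x (S.param n) (b j : Param d) ∂μ := by
    intro μ _
    have : ∀ x, D x (S.param n) (θN i - S.param n) =
        ∑ j, c j w * D x (S.param n) (b j : Param d) := fun x => hDW x w
    simp_rw [this]
    rw [integral_finsetSum _ fun j _ => ((hDb j).const_mul (c j w)).integrable]
    simp_rw [integral_const_mul]
  have hDt : IsTest fun x => D x (S.param n) (θN i - S.param n) :=
    S.isTest_deriv hA n hφ hD hC w.2
  have hrem : ∀ (μ : Measure E) [IsProbabilityMeasure μ],
      |∫ x, S.Q (n + 1) (θN i) φ x ∂μ - ∫ x, S.Q (n + 1) (S.param n) φ x ∂μ -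
        ∫ x, D x (S.param n) (θN i - S.param n) ∂μ| ≤ ε / 4 * ‖θN i - S.param n‖ := by
    intro μ _
    have i1 := (S.isTest_Q hV (n + 1) (θN i) hφ).integrable (μ := μ)
    have i2 := (S.isTest_Q hV (n + 1) (S.param n) hφ).integrable (μ := μ)
    have i12 : Integrable (fun x => S.Q (n + 1) (θN i) φ x - S.Q (n + 1) (S.param n) φ x) μ :=
      i1.sub i2
    rw [← integral_sub i1 i2, ← integral_sub i12 hDt.integrable]
    exact abs_integral_le_of_bounded h1
  have r1 := abs_le.1 (hrem (ηN i))
  have r2 := abs_le.1 (hrem (S.target n))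
  have r3 : |∫ x, D x (S.param n) (θN i - S.param n) ∂ηN i -
      ∫ x, D x (S.param n) (θN i - S.param n) ∂S.target n| <
        ε / 2 * ‖θN i - S.param n‖ := by
    rw [hint, hint, ← Finset.sum_sub_distrib]
    refine lt_of_le_of_lt (Finset.abs_sum_le_sum_abs _ _) ?_
    refine lt_of_le_of_lt (b := (∑ j, ‖c j‖ * |∫ x, D x (S.param n) (b j : Param d) ∂ηN i -
      ∫ x, D x (S.param n) (b j : Param d) ∂S.target n|) * ‖θN i - S.param n‖) ?_
      (mul_lt_mul_of_pos_right h2 hpos)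
    rw [Finset.sum_mul]
    refine Finset.sum_le_sum fun j _ => ?_
    rw [← mul_sub, abs_mul, mul_right_comm]
    gcongr
    exact (c j).le_opNorm w
  have r4 := abs_lt.1 r3
  rw [abs_lt]
  constructor <;> linarith [r1.1, r1.2, r2.1, r2.2, r4.1, r4.2]

lemma tendsto_integral_of_tendstoUniformly {f : ι → E → ℝ} {g : E → ℝ} {c : ℝ}
    (hprob : ∀ᶠ i in L, IsProbabilityMeasure (ηN i)) (hf : ∀ i, IsTest (f i)) (hg : IsTest g)
    (hfg : TendstoUniformly f g L) (hc : Tendsto (fun i => ∫ x, g x ∂ηN i) L (𝓝 c)) :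
    Tendsto (fun i => ∫ x, f i x ∂ηN i) L (𝓝 c) := by
  have h : Tendsto (fun i => ∫ x, f i x ∂ηN i - ∫ x, g x ∂ηN i) L (𝓝 0) := by
    rw [Metric.tendsto_nhds]
    intro ε hε
    filter_upwards [hprob, Metric.tendstoUniformly_iff.1 hfg (ε / 2) (by positivity)] with i h1 h2
    rw [dist_zero_right, Real.norm_eq_abs, ← integral_sub (hf i).integrable hg.integrable]
    refine lt_of_le_of_lt (abs_integral_le_of_bounded (C := ε / 2) fun x => ?_) (by linarith)
    have := (h2 x).le
    rwa [Real.dist_eq, abs_sub_comm] at this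
  simpa using h.add hc

lemma tendsto_integral_mul_Q (hA : S.BoundedContinuous) {φ ψ : E → ℝ} (hφ : IsTest φ)
    (hψ : IsTest ψ) (hprob : ∀ᶠ i in L, IsProbabilityMeasure (ηN i))
    (hη : ∀ f, IsTest f → Tendsto (fun i => ∫ x, f x ∂ηN i) L (𝓝 (∫ x, f x ∂S.target n)))
    (hθ : Tendsto θN L (𝓝[S.domParam (n + 1)] S.param n)) :
    Tendsto (fun i => ∫ x, ψ x * S.Q (n + 1) (θN i) φ x ∂ηN i) L
      (𝓝 (∫ x, ψ x * S.Q (n + 1) (S.param n) φ x ∂S.target n)) := by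
  have hV := hA.isTest_V
  refine tendsto_integral_of_tendstoUniformly hprob (fun i => hψ.mul (S.isTest_Q hV _ _ hφ))
    (hψ.mul (S.isTest_Q hV _ _ hφ)) ?_ (hη _ (hψ.mul (S.isTest_Q hV _ _ hφ)))
  have hu := hA.continuous_Q n φ hφ
  obtain ⟨-, B, hB⟩ := hψ
  rw [Metric.tendstoUniformly_iff] at hu ⊢
  intro ε hε
  have hB' : 0 < |B| + 1 := by positivity
  filter_upwards [hθ.eventually (hu (ε / (|B| + 1)) (by positivity))] with i hi x
  rw [Real.dist_eq, ← mul_sub, abs_mul]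
  have h1 := hi x
  rw [Real.dist_eq] at h1
  calc |ψ x| * |S.Q (n + 1) (S.param n) φ x - S.Q (n + 1) (θN i) φ x|
      ≤ (|B| + 1) * |S.Q (n + 1) (S.param n) φ x - S.Q (n + 1) (θN i) φ x| := by
        gcongr
        linarith [hB x, le_abs_self B]
    _ < (|B| + 1) * (ε / (|B| + 1)) := by gcongr
    _ = ε := by field_simp

lemma tendsto_integral_Q (hA : S.BoundedContinuous) {φ : E → ℝ} (hφ : IsTest φ)
    (hprob : ∀ᶠ i in L, IsProbabilityMeasure (ηN i))
    (hη : ∀ f, IsTest f → Tendsto (fun i => ∫ x, f x ∂ηN i) L (𝓝 (∫ x, f x ∂S.target n)))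
    (hθ : Tendsto θN L (𝓝[S.domParam (n + 1)] S.param n)) :
    Tendsto (fun i => ∫ x, S.Q (n + 1) (θN i) φ x ∂ηN i) L
      (𝓝 (∫ x, S.Q (n + 1) (S.param n) φ x ∂S.target n)) := by
  simpa using S.tendsto_integral_mul_Q hA hφ (isTest_const 1) hprob hη hθ

end Limits

/-! ### The derivatives in the inverse temperatures -/

/-- Only the factor G_θ involves the first temperature. The hypothesis makes the interval of
differentiation nondegenerate, so that `derivWithin` is the derivative. -/
lemma dQfst_eq (hV : IsTest S.V) (n : ℕ) (h : S.β₀ < S.temp (n + 1)) (φ : E → ℝ) :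
    S.dQfst n φ = ∫ x, S.V x * S.Q (n + 1) (S.param n) φ x ∂S.target n := by
  rw [dQfst]
  congr 1
  ext x
  have h1 : HasDerivAt (fun t => S.Q (n + 1) (t, (S.param n).2) φ x)
      (S.V x * S.Q (n + 1) (S.param n) φ x) (S.temp n) := by
    have h2 : HasDerivAt (fun t : ℝ => -((S.param n).2.1 - t) * S.V x) (S.V x) (S.temp n) := by
      have := (((hasDerivAt_id (S.temp n)).const_sub (S.param n).2.1).neg).mul_const (S.V x)
      simpa using this
    have h3 := h2.exp.mul_const (∫ y, φ y ∂S.M (n + 1) (((S.param n).2.2, (S.param n).2.1), x))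
    refine h3.congr_deriv ?_
    rw [Q, potential]
    change Real.exp (-((S.param n).2.1 - S.temp n) * S.V x) * S.V x * _ =
      S.V x * (Real.exp (-((S.param n).2.1 - S.temp n) * S.V x) * _)
    ring
  exact h1.hasDerivWithinAt.derivWithin (uniqueDiffOn_Icc h _
    ⟨(S.temp_mem hV n).1, S.temp_le_temp_succ hV n⟩)

/-- The interval shrinks to the point `β₀`, where `derivWithin` is 0 by convention. -/
lemma dQfst_eq_zero (hV : IsTest S.V) (n : ℕ) (h : S.temp (n + 1) ≤ S.β₀) (φ : E → ℝ) :
    S.dQfst n φ = 0 := by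
  have h1 : S.temp (n + 1) = S.β₀ := le_antisymm h (S.temp_mem hV (n + 1)).1
  have h2 : S.temp n = S.β₀ :=
    le_antisymm ((S.temp_le_temp_succ hV n).trans h) (S.temp_mem hV n).1
  rw [dQfst, h1]
  simp only [Set.Icc_self]
  have : ∀ x, derivWithin (fun t => S.Q (n + 1) (t, (S.param n).2) φ x) {S.β₀} (S.temp n) = 0 :=
    fun x => derivWithin_zero_of_not_accPt fun hacc => by
      obtain ⟨y, hy, hne⟩ := accPt_iff_nhds.1 hacc _ Filter.univ_mem
      exact hne (hy.2.trans h2.symm)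
  simp [this]

/-- The derivative of t ↦ η_n(Qφ) is computed twice: as the integral of the derivative given by
`DifferentiableKernels`, and, by invariance, as the derivative of an explicit tilted integral.
Uniqueness equates the two. -/
lemma dQsnd_eq (hA : S.BoundedContinuous) (hA4 : S.DifferentiableKernels) (n : ℕ)
    (h1 : S.temp n < S.temp (n + 1)) (h2 : S.temp (n + 1) < S.βs) {φ : E → ℝ} (hφ : IsTest φ) :
    S.dQsnd n φ = -((∫ x, S.V x * (Real.exp (-S.temp (n + 1) * S.V x) * φ x) ∂S.m) /
      S.normConst (S.temp n)) := by
  have hV := hA.isTest_V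
  have := S.isProbabilityMeasure_target hV n
  have := S.finite_m
  obtain ⟨D, hD, ⟨C, hC⟩, hDc⟩ := hA4 n φ hφ
  have hmem := hA.param_mem n
  set p : ℝ → Param d := fun t => (S.temp n, t, (S.param n).2.2) with hp
  have hpn : p (S.temp (n + 1)) = S.param n := rfl
  have hpmem : ∀ t ∈ Set.Icc (S.temp n) S.βs, p t ∈ S.domParam (n + 1) := fun t ht =>
    ⟨hmem.1, ht.1, ht.2, hmem.2.2.2⟩
  have hsub : ∀ t, p t - S.param n = (t - S.temp (n + 1)) • ((0, 1, 0) : Param d) := by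
    intro t
    rw [← hpn]
    ext <;> simp [hp]
  have hmaps : Set.MapsTo p (Set.Icc (S.temp n) S.βs) (S.domParam (n + 1)) := hpmem
  have htmem : S.temp (n + 1) ∈ Set.Icc (S.temp n) S.βs := ⟨h1.le, h2.le⟩
  have huniq : UniqueDiffWithinAt ℝ (Set.Icc (S.temp n) S.βs) (S.temp (n + 1)) :=
    uniqueDiffOn_Icc (h1.trans h2) _ htmem
  have hpd : HasDerivAt p (0, 1, 0) (S.temp (n + 1)) :=
    (hasDerivAt_const _ _).prodMk ((hasDerivAt_id _).prodMk (hasDerivAt_const _ _))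
  have hderiv : ∀ x, derivWithin (fun t => S.Q (n + 1) (p t) φ x) (Set.Icc (S.temp n) S.βs)
      (S.temp (n + 1)) = D x (S.param n) (0, 1, 0) := fun x =>
    ((hD x (p (S.temp (n + 1))) hmem).comp_hasDerivWithinAt (S.temp (n + 1))
      hpd.hasDerivWithinAt hmaps).derivWithin huniq
  -- Since β_{n+1} < βs there is room to move the second temperature, so this direction lies in the
  -- span.
  have hv : ((0, 1, 0) : Param d) ∈
      Submodule.span ℝ ((fun θ => θ - S.param n) '' S.domParam (n + 1)) := by
    have h3 : p S.βs - S.param n ∈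
        Submodule.span ℝ ((fun θ => θ - S.param n) '' S.domParam (n + 1)) :=
      Submodule.subset_span ⟨_, hpmem _ ⟨(h1.trans h2).le, le_rfl⟩, rfl⟩
    rw [hsub] at h3
    exact (Submodule.smul_mem_iff _ (sub_pos.2 h2).ne').1 h3
  have hDt := S.isTest_deriv hA n hφ hD hC hv
  have e1 : HasDerivWithinAt (fun t => ∫ x, S.Q (n + 1) (p t) φ x ∂S.target n)
      (∫ x, D x (S.param n) (0, 1, 0) ∂S.target n) (Set.Icc (S.temp n) S.βs)
      (S.temp (n + 1)) := by
    rw [hasDerivWithinAt_iff_isLittleO, Asymptotics.isLittleO_iff]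
    intro ε hε
    have hlim : Tendsto p (𝓝[Set.Icc (S.temp n) S.βs] (S.temp (n + 1)))
        (𝓝[S.domParam (n + 1)] S.param n) :=
      hpd.continuousAt.continuousWithinAt.tendsto_nhdsWithin hmaps
    filter_upwards [hlim.eventually (S.exists_abs_Q_sub_sub_le hA n hD hDc hε)] with t ht
    have i1 := (S.isTest_Q hV (n + 1) (p t) hφ).integrable (μ := S.target n)
    have i2 := (S.isTest_Q hV (n + 1) (S.param n) hφ).integrable (μ := S.target n)
    have i12 : Integrable (fun x => S.Q (n + 1) (p t) φ x - S.Q (n + 1) (S.param n) φ x)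
      (S.target n) := i1.sub i2
    have i3 := (hDt.const_mul (t - S.temp (n + 1))).integrable (μ := S.target n)
    rw [hpn, smul_eq_mul, ← integral_const_mul, ← integral_sub i1 i2, ← integral_sub i12 i3]
    refine abs_integral_le_of_bounded fun x => ?_
    have := ht x
    rw [hsub, map_smul, norm_smul, smul_eq_mul] at this
    simpa [Prod.norm_def] using this
  have e2 : HasDerivWithinAt (fun t => ∫ x, S.Q (n + 1) (p t) φ x ∂S.target n)
      (-((∫ x, S.V x * (Real.exp (-S.temp (n + 1) * S.V x) * φ x) ∂S.m) /
        S.normConst (S.temp n))) (Set.Icc (S.temp n) S.βs) (S.temp (n + 1)) := by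
    have h4 := (hasDerivAt_integral_mul_exp hφ hV S.m (S.temp (n + 1))).div_const
      (S.normConst (S.temp n))
    rw [neg_div] at h4
    simp_rw [mul_comm (φ _)] at h4
    refine h4.hasDerivWithinAt.congr_of_mem (fun t ht => ?_) htmem
    exact S.integral_Q_of_fst_eq hV n (hpmem t ht) rfl hφ
  rw [dQsnd]
  change ∫ x, derivWithin (fun t => S.Q (n + 1) (p t) φ x) (Set.Icc (S.temp n) S.βs)
      (S.temp (n + 1)) ∂S.target n = _
  simp_rw [hderiv]
  exact huniq.eq_deriv _ e1 e2

end Expansion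

/-! ### Fluctuations of the inverse temperatures -/

section NextTempLimit

variable {E : Type*} [MeasurableSpace E] {d : ℕ} (S : AdaptiveTempering E d)
  {ι : Type*} {L : Filter ι} {ηN : ι → Measure E} {n : ℕ} {bN : ι → ℝ}

lemma tendsto_ESS (hV : IsTest S.V)
    (hη : ∀ f, IsTest f → Tendsto (fun i => ∫ x, f x ∂ηN i) L (𝓝 (∫ x, f x ∂S.target n))) (t : ℝ) :
    Tendsto (fun i => ESS (ηN i) fun x => Real.exp (-t * S.V x)) L
      (𝓝 (ESS (S.target n) fun x => Real.exp (-t * S.V x))) := by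
  have := S.isProbabilityMeasure_target hV n
  exact ((hη _ (hV.exp (-t))).pow 2).div (hη _ ((hV.exp (-t)).pow 2))
    (integral_exp_sq_pos hV (-t)).ne'

lemma ESS_temp_succ (hV : IsTest S.V) (h : S.temp (n + 1) < S.βs) : S.temp n < S.temp (n + 1) ∧
    (ESS (S.target n) fun x => Real.exp (-(S.temp (n + 1) - S.temp n) * S.V x)) = S.α := by
  have := S.isProbabilityMeasure_target hV n
  exact ESS_nextTemp_of_lt S (μ := S.target n) hV (S.temp_mem hV n).2 h

lemma not_ae_const_of_temp_lt (hV : IsTest S.V) (h : S.temp (n + 1) < S.βs) (c : ℝ) :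
    ¬ S.V =ᵐ[S.target n] fun _ => c := by
  have := S.isProbabilityMeasure_target hV n
  intro hc
  have h1 := (S.ESS_temp_succ hV h).2
  rw [ESS_const c hc] at h1
  exact S.α_lt_one.ne h1.symm

/-- Consistency of the next inverse temperature, when it is interior. -/
lemma tendsto_nextTemp (hV : IsTest S.V) (hprob : ∀ᶠ i in L, IsProbabilityMeasure (ηN i))
    (hη : ∀ f, IsTest f → Tendsto (fun i => ∫ x, f x ∂ηN i) L (𝓝 (∫ x, f x ∂S.target n)))
    (hb : Tendsto bN L (𝓝 (S.temp n))) (h : S.temp (n + 1) < S.βs) :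
    Tendsto (fun i => S.nextTemp (ηN i) (bN i)) L (𝓝 (S.temp (n + 1))) ∧
    ∀ᶠ i in L, (ESS (ηN i) fun x =>
      Real.exp (-(S.nextTemp (ηN i) (bN i) - bN i) * S.V x)) = S.α := by
  have := S.isProbabilityMeasure_target hV n
  obtain ⟨h1, h2⟩ := S.ESS_temp_succ hV h
  have hanti := strictAntiOn_ESS (μ := S.target n) hV (S.not_ae_const_of_temp_lt hV h)
  set Δ := S.temp (n + 1) - S.temp n with hΔ
  have hΔ0 : 0 < Δ := sub_pos.2 h1
  -- By strict monotonicity the limiting ESS lies on opposite sides of α at Δ ± ε; the random one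
  -- eventually does too, which brackets the increment. A further ε comes from the error of `bN`.
  have key : ∀ ε, 0 < ε → ε < Δ → 2 * ε < S.βs - S.temp (n + 1) → ∀ᶠ i in L,
      |S.nextTemp (ηN i) (bN i) - S.temp (n + 1)| < 2 * ε ∧ (ESS (ηN i) fun x =>
        Real.exp (-(S.nextTemp (ηN i) (bN i) - bN i) * S.V x)) = S.α := by
    intro ε hε hεΔ hε2
    have l1 : (ESS (S.target n) fun x => Real.exp (-(Δ + ε) * S.V x)) < S.α := by
      rw [← h2]
      exact hanti (show Δ ∈ Set.Ici 0 from hΔ0.le) (show Δ + ε ∈ Set.Ici 0 from by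
        rw [Set.mem_Ici]; linarith) (by linarith)
    have l2 : S.α < (ESS (S.target n) fun x => Real.exp (-(Δ - ε) * S.V x)) := by
      rw [← h2]
      exact hanti (show Δ - ε ∈ Set.Ici 0 from by rw [Set.mem_Ici]; linarith)
        (show Δ ∈ Set.Ici 0 from hΔ0.le) (by linarith)
    filter_upwards [hprob, (S.tendsto_ESS hV hη (Δ + ε)).eventually_lt_const l1,
      (S.tendsto_ESS hV hη (Δ - ε)).eventually_const_lt l2,
      Metric.tendsto_nhds.1 hb ε hε] with i i1 i2 i3 i4
    rw [Real.dist_eq, abs_lt] at i4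
    have c1 : bN i + (Δ + ε) < S.βs := by linarith
    have j1 : S.nextTemp (ηN i) (bN i) ≤ bN i + (Δ + ε) := by
      rw [nextTemp_le_iff S hV (by linarith) c1, add_sub_cancel_left]
      exact i2.le
    have j2 : ¬ S.nextTemp (ηN i) (bN i) ≤ bN i + (Δ - ε) := by
      rw [nextTemp_le_iff S hV (by linarith) (by linarith), add_sub_cancel_left, not_le]
      exact i3
    rw [not_le] at j2
    refine ⟨?_, (ESS_nextTemp_of_lt S hV (by linarith) (by linarith)).2⟩
    rw [abs_lt]
    constructor <;> linarith
  have hsmall : ∀ δ, 0 < δ → ∃ ε, 0 < ε ∧ ε < Δ ∧ 2 * ε < S.βs - S.temp (n + 1) ∧ 2 * ε < δ := by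
    intro δ hδ
    have hpos : 0 < min Δ (min (S.βs - S.temp (n + 1)) δ) :=
      lt_min hΔ0 (lt_min (sub_pos.2 h) hδ)
    have m1 := min_le_left Δ (min (S.βs - S.temp (n + 1)) δ)
    have m2 := min_le_right Δ (min (S.βs - S.temp (n + 1)) δ)
    have m3 := min_le_left (S.βs - S.temp (n + 1)) δ
    have m4 := min_le_right (S.βs - S.temp (n + 1)) δ
    exact ⟨min Δ (min (S.βs - S.temp (n + 1)) δ) / 3, by linarith, by linarith, by linarith,
      by linarith⟩
  refine ⟨Metric.tendsto_nhds.2 fun δ hδ => ?_, ?_⟩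
  · obtain ⟨ε, e1, e2, e3, e4⟩ := hsmall δ hδ
    filter_upwards [key ε e1 e2 e3] with i hi
    rw [Real.dist_eq]
    exact hi.1.trans e4
  · obtain ⟨ε, e1, e2, e3, e4⟩ := hsmall 1 one_pos
    exact (key ε e1 e2 e3).mono fun i hi => hi.2

/-- When the limiting inverse temperature is the final one, and the threshold is not attained
there, so is the random one with high probability. -/
lemma eventually_nextTemp_eq (hV : IsTest S.V) (hprob : ∀ᶠ i in L, IsProbabilityMeasure (ηN i))
    (hη : ∀ f, IsTest f → Tendsto (fun i => ∫ x, f x ∂ηN i) L (𝓝 (∫ x, f x ∂S.target n)))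
    (hb : Tendsto bN L (𝓝 (S.temp n))) (hbs : ∀ᶠ i in L, bN i ≤ S.βs)
    (h : S.temp (n + 1) = S.βs)
    (hne : (ESS (S.target n) fun x => Real.exp (-(S.βs - S.temp n) * S.V x)) ≠ S.α) :
    ∀ᶠ i in L, S.nextTemp (ηN i) (bN i) = S.βs := by
  have := S.isProbabilityMeasure_target hV n
  have hlt : S.α < ESS (S.target n) fun x => Real.exp (-(S.βs - S.temp n) * S.V x) := by
    by_contra hle
    have h3 := (nextTemp_mem_of_le S (μ := S.target n) hV (S.temp_mem hV n).2 (not_lt.1 hle)).2.2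
    change (ESS (S.target n) fun x => Real.exp (-(S.temp (n + 1) - S.temp n) * S.V x)) = S.α at h3
    rw [h] at h3
    exact hne h3
  -- As `bN` may lie below β_n, the random distance to `βs` may exceed the limiting one; the strict
  -- inequality is first extended by a margin ε/2, and monotonicity does the rest.
  have hcont := (continuous_ESS (μ := S.target n) hV).continuousAt (x := S.βs - S.temp n)
  obtain ⟨ε, hε, hball⟩ := Metric.eventually_nhds_iff.1 (hcont.eventually_const_lt hlt)
  have hε2 : S.α < ESS (S.target n) fun x => Real.exp (-(S.βs - S.temp n + ε / 2) * S.V x) := by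
    refine hball ?_
    rw [Real.dist_eq, add_sub_cancel_left, abs_of_pos (by positivity)]
    linarith
  filter_upwards [hprob, hbs, (S.tendsto_ESS hV hη (S.βs - S.temp n + ε / 2)).eventually_const_lt hε2,
    Metric.tendsto_nhds.1 hb (ε / 2) (by positivity)] with i i1 i2 i3 i4
  rw [Real.dist_eq, abs_lt] at i4
  refine nextTemp_eq_of_lt S hV (i3.trans_le ?_)
  exact antitoneOn_ESS (μ := ηN i) hV (show S.βs - bN i ∈ Set.Ici 0 from sub_nonneg.2 i2)
    (show S.βs - S.temp n + ε / 2 ∈ Set.Ici 0 from by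
      rw [Set.mem_Ici]; linarith) (by linarith)

lemma dESS_eq (hV : IsTest S.V) (n : ℕ) : S.dESS n =
    2 * (∫ x, S.G n x ∂S.target n) / (∫ x, S.G n x ^ 2 ∂S.target n) ^ 2 *
      ((∫ x, S.G n x ∂S.target n) * (∫ x, S.V x * S.G n x ^ 2 ∂S.target n) -
        (∫ x, S.V x * S.G n x ∂S.target n) * ∫ x, S.G n x ^ 2 ∂S.target n) := by
  have := S.isProbabilityMeasure_target hV n
  exact (hasDerivAt_ESS (μ := S.target n) hV (S.temp (n + 1) - S.temp n)).deriv

/-- The nondegeneracy that allows the linearised ESS equation to be solved for the increment. -/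
lemma dESS_neg (hV : IsTest S.V) (h : S.temp (n + 1) < S.βs) : S.dESS n < 0 := by
  have := S.isProbabilityMeasure_target hV n
  rw [S.dESS_eq hV]
  exact mul_neg_of_pos_of_neg (div_pos (mul_pos two_pos
    (integral_exp_mul_pos hV _)) (pow_pos (integral_exp_sq_pos hV _) 2))
    (tilted_cov_neg hV (sub_pos.2 (S.ESS_temp_succ hV h).1) (S.not_ae_const_of_temp_lt hV h))

end NextTempLimit

/-! ### The implicit-function argument for the increment -/

section NextTempCLT

variable {E : Type*} [MeasurableSpace E] {d : ℕ} (S : AdaptiveTempering E d)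
  {Ω : ℕ → Type*} [∀ N, MeasurableSpace (Ω N)] {P : ∀ N, Measure (Ω N)}
  {ηN : (Σ N, Ω N) → Measure E} {n : ℕ} {δ : (Σ N, Ω N) → ℝ}

/-- Linearisation of the equation that defines the increment of the inverse temperature. -/
lemma tendsto_increment_sub (hV : IsTest S.V)
    (hprob : ∀ᶠ i in highProb P, IsProbabilityMeasure (ηN i))
    (hη : ∀ f, IsTest f → BoundedInProb P fun i =>
      √(i.1 : ℝ) * (∫ x, f x ∂ηN i - ∫ x, f x ∂S.target n))
    (h : S.temp (n + 1) < S.βs) (hδ : Tendsto δ (highProb P) (𝓝 0))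
    (hESS : ∀ᶠ i in highProb P, (ESS (ηN i) fun x =>
      Real.exp (-(S.temp (n + 1) - S.temp n + δ i) * S.V x)) = S.α) :
    Tendsto (fun i => √(i.1 : ℝ) * δ i -
      (-2 * ((∫ x, S.G n x ∂S.target n) / ∫ x, S.G n x ^ 2 ∂S.target n) * (S.dESS n)⁻¹ *
          (√(i.1 : ℝ) * (∫ x, S.G n x ∂ηN i - ∫ x, S.G n x ∂S.target n)) +
        ((∫ x, S.G n x ∂S.target n) ^ 2 / (∫ x, S.G n x ^ 2 ∂S.target n) ^ 2) * (S.dESS n)⁻¹ *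
          (√(i.1 : ℝ) * (∫ x, S.G n x ^ 2 ∂ηN i - ∫ x, S.G n x ^ 2 ∂S.target n))))
      (highProb P) (𝓝 0) := by
  have := S.isProbabilityMeasure_target hV n
  have hlim : ∀ f, IsTest f →
      Tendsto (fun i => ∫ x, f x ∂ηN i) (highProb P) (𝓝 (∫ x, f x ∂S.target n)) := fun f hf => by
    simpa using (hη f hf).tendsto_of_sqrt_mul.add_const (∫ x, f x ∂S.target n)
  have hG : IsTest (S.G n) := S.isTest_potential hV _
  have hG2 := hG.pow 2
  have hα := (S.ESS_temp_succ hV h).2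
  have hρ := (S.dESS_neg hV h).ne
  have hρeq := S.dESS_eq hV n
  set a := ∫ x, S.G n x ∂S.target n with ha
  set b := ∫ x, S.G n x ^ 2 ∂S.target n with hb
  set u := ∫ x, S.V x * S.G n x ∂S.target n with hu
  set v := ∫ x, S.V x * S.G n x ^ 2 ∂S.target n with hv
  set ρ := S.dESS n with hρdef
  have hb0 : b ≠ 0 := (integral_exp_sq_pos (μ := S.target n) hV _).ne'
  have hα' : a ^ 2 = S.α * b := by
    rw [← div_eq_iff hb0]
    exact hα
  -- The left side is the slope at δ = 0 of η_n(Ge^{-δV})² - α η_n(G²e^{-2δV}), which is the second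
  -- mean times (ESS - α); since the ESS equals α at δ = 0, the slope is b times the derivative of
  -- the ESS.
  have hκ : -u * (a + a) + 2 * S.α * v = b * ρ := by
    have : S.α = a ^ 2 / b := by rw [hα']; field_simp
    rw [this, hρeq]
    field_simp
    ring
  have hκ0 : b * ρ ≠ 0 := mul_ne_zero hb0 hρ
  set aN : (Σ N, Ω N) → ℝ := fun i => ∫ x, S.G n x ∂ηN i with haN
  set bN : (Σ N, Ω N) → ℝ := fun i => ∫ x, S.G n x ^ 2 ∂ηN i with hbN
  set uN : (Σ N, Ω N) → ℝ := fun i => ∫ x, S.V x * S.G n x ∂ηN i with huN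
  set vN : (Σ N, Ω N) → ℝ := fun i => ∫ x, S.V x * S.G n x ^ 2 ∂ηN i with hvN
  set aN' : (Σ N, Ω N) → ℝ := fun i => ∫ x, S.G n x * Real.exp (-δ i * S.V x) ∂ηN i with haN'
  set bN' : (Σ N, Ω N) → ℝ := fun i => ∫ x, S.G n x ^ 2 * Real.exp (-(2 * δ i) * S.V x) ∂ηN i
    with hbN'
  set r₁ : (Σ N, Ω N) → ℝ := fun i => aN' i - aN i + δ i * uN i with hr₁
  set r₂ : (Σ N, Ω N) → ℝ := fun i => bN' i - bN i + 2 * δ i * vN i with hr₂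
  obtain ⟨C, hC⟩ := hV.2
  obtain ⟨B, hB⟩ := hG.2
  obtain ⟨B', hB'⟩ := hG2.2
  have hr₁b : ∀ᶠ i in highProb P, |r₁ i| ≤ B * (C ^ 2 * Real.exp C) * δ i ^ 2 := by
    filter_upwards [hprob, hδ.abs.eventually_le_const (show |(0 : ℝ)| < 1 by simp)] with i h1 h2
    have h3 := abs_integral_mul_exp_sub_le hG.1 hV.1 hB hC (ηN i) h2
    rwa [probReal_univ, mul_one] at h3
  have hr₂b : ∀ᶠ i in highProb P, |r₂ i| ≤ B' * (C ^ 2 * Real.exp C) * (2 * δ i) ^ 2 := by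
    have h2 : Tendsto (fun i => |2 * δ i|) (highProb P) (𝓝 |2 * 0|) := (hδ.const_mul 2).abs
    filter_upwards [hprob, h2.eventually_le_const (show |2 * (0 : ℝ)| < 1 by simp)] with i h1 h2
    have h3 := abs_integral_mul_exp_sub_le hG2.1 hV.1 hB' hC (ηN i) h2
    rwa [probReal_univ, mul_one] at h3
  -- Where `δ i = 0`, the quotient is 0 by convention and the remainder is 0 by its quadratic bound,
  -- so the remainder can still be written as δ times the quotient.
  have hdiv : ∀ {r : (Σ N, Ω N) → ℝ} {K : ℝ}, (∀ᶠ i in highProb P, |r i| ≤ K * δ i ^ 2) →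
      Tendsto (fun i => r i / δ i) (highProb P) (𝓝 0) := by
    intro r K hr
    refine squeeze_zero_norm' (a := fun i => K * |δ i|) ?_ (by simpa using hδ.abs.const_mul K)
    filter_upwards [hr] with i hi
    rw [Real.norm_eq_abs, abs_div]
    rcases eq_or_ne (δ i) 0 with h0 | h0
    · simp [h0]
    · rw [div_le_iff₀ (abs_pos.2 h0), mul_assoc, abs_mul_abs_self, ← sq]
      exact hi
  have hmul : ∀ {r : (Σ N, Ω N) → ℝ} {K : ℝ}, (∀ᶠ i in highProb P, |r i| ≤ K * δ i ^ 2) →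
      ∀ᶠ i in highProb P, δ i * (r i / δ i) = r i := by
    intro r K hr
    filter_upwards [hr] with i hi
    rcases eq_or_ne (δ i) 0 with h0 | h0
    · rw [h0] at hi ⊢
      have : r i = 0 := by simpa using hi
      rw [this, zero_mul]
    · field_simp
  have hr₂b' : ∀ᶠ i in highProb P, |r₂ i| ≤ 4 * (B' * (C ^ 2 * Real.exp C)) * δ i ^ 2 :=
    hr₂b.mono fun i hi => hi.trans (le_of_eq (by ring))
  have haNl : Tendsto aN (highProb P) (𝓝 a) := hlim _ hG
  have huNl : Tendsto uN (highProb P) (𝓝 u) := hlim _ (hV.mul hG)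
  have hvNl : Tendsto vN (highProb P) (𝓝 v) := hlim _ (hV.mul hG2)
  have haN'l : Tendsto aN' (highProb P) (𝓝 a) := by
    have h1 : Tendsto (fun i => aN i - δ i * uN i + δ i * (r₁ i / δ i)) (highProb P)
        (𝓝 (a - 0 * u + 0 * 0)) := (haNl.sub (hδ.mul huNl)).add (hδ.mul (hdiv hr₁b))
    rw [zero_mul, zero_mul, sub_zero, add_zero] at h1
    refine h1.congr' ?_
    filter_upwards [hmul hr₁b] with i hi
    rw [hi, hr₁]
    ring
  -- An exact random slope: subtracting the limiting equation a² = αb from the random one gives δ ·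
  -- κN = -((aN + a)(aN - a) - α(bN - b)) with no term neglected. Only the convergence of `κN` is
  -- then needed.
  set κN : (Σ N, Ω N) → ℝ := fun i => -uN i * (aN' i + aN i) + 2 * S.α * vN i +
    (r₁ i / δ i * (aN' i + aN i) - S.α * (r₂ i / δ i)) with hκN
  have hκNl : Tendsto κN (highProb P) (𝓝 (b * ρ)) := by
    have h1 : Tendsto κN (highProb P) (𝓝 (-u * (a + a) + 2 * S.α * v +
        (0 * (a + a) - S.α * 0))) :=
      ((huNl.neg.mul (haN'l.add haNl)).add (hvNl.const_mul _)).add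
        (((hdiv hr₁b).mul (haN'l.add haNl)).sub ((hdiv hr₂b').const_mul _))
    rwa [zero_mul, mul_zero, sub_zero, add_zero, hκ] at h1
  have hmain : ∀ᶠ i in highProb P,
      δ i * κN i = -((aN i + a) * (aN i - a) - S.α * (bN i - b)) := by
    filter_upwards [hmul hr₁b, hmul hr₂b', hprob, hESS] with i h1 h2 h3 h4
    have e1 : aN' i ^ 2 = S.α * bN' i := by
      have e2 : ∀ x, Real.exp (-(S.temp (n + 1) - S.temp n + δ i) * S.V x) =
          S.G n x * Real.exp (-δ i * S.V x) := by
        intro x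
        rw [G, potential, ← Real.exp_add]
        congr 1
        simp only [param]
        ring
      have e3 : ∀ x, (S.G n x * Real.exp (-δ i * S.V x)) ^ 2 =
          S.G n x ^ 2 * Real.exp (-(2 * δ i) * S.V x) := by
        intro x
        rw [mul_pow, ← Real.exp_nat_mul]
        congr 2
        push_cast
        ring
      have hpos := integral_exp_sq_pos (μ := ηN i) hV (-(S.temp (n + 1) - S.temp n + δ i))
      rw [ESS] at h4
      simp_rw [e2, e3] at h4 hpos
      rwa [div_eq_iff hpos.ne'] at h4
    have e4 : δ i * κN i = -(δ i * uN i) * (aN' i + aN i) + 2 * S.α * (δ i * vN i) +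
        (δ i * (r₁ i / δ i) * (aN' i + aN i) - S.α * (δ i * (r₂ i / δ i))) := by
      simp only [hκN]; ring
    rw [e4, h1, h2]
    simp only [hr₁, hr₂]
    linear_combination e1 - hα'
  have hOP1 := hη _ hG
  have hOP2 := hη _ hG2
  have t1 : Tendsto (fun i => -(aN i + a) / κN i - -(a + a) / (b * ρ)) (highProb P) (𝓝 0) := by
    rw [← sub_self (-(a + a) / (b * ρ))]
    exact ((haNl.add_const a).neg.div hκNl hκ0).sub_const _
  have t2 : Tendsto (fun i => S.α / κN i - S.α / (b * ρ)) (highProb P) (𝓝 0) := by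
    rw [← sub_self (S.α / (b * ρ))]
    exact (tendsto_const_nhds.div hκNl hκ0).sub_const _
  have t3 := (hOP1.tendsto_mul t1).add (hOP2.tendsto_mul t2)
  rw [add_zero] at t3
  refine t3.congr' ?_
  filter_upwards [hmain, hκNl.eventually_ne hκ0] with i h1 h2
  have e1 : δ i = -((aN i + a) * (aN i - a) - S.α * (bN i - b)) / κN i := by
    rw [eq_div_iff h2]; exact h1
  have e2 : -2 * (a / b) * ρ⁻¹ = -(a + a) / (b * ρ) := by field_simp; ring
  have e3 : a ^ 2 / b ^ 2 * ρ⁻¹ = S.α / (b * ρ) := by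
    rw [hα']; field_simp
  rw [e2, e3, e1]
  change (-(aN i + a) / κN i - -(a + a) / (b * ρ)) * (√(i.1 : ℝ) * (aN i - a)) +
    (S.α / κN i - S.α / (b * ρ)) * (√(i.1 : ℝ) * (bN i - b)) = _
  ring

end NextTempCLT

/-! ### The asymptotic variance of linear combinations -/

section Covariance

open Matrix

variable {E : Type*} [MeasurableSpace E] {d : ℕ} (S : AdaptiveTempering E d)

lemma IsTest.memLp {μ : Measure E} [IsFiniteMeasure μ] {f : E → ℝ} (hf : IsTest f) :
    MemLp f 2 μ := by
  obtain ⟨hm, C, hC⟩ := hf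
  exact .of_bound hm.aestronglyMeasurable C (Eventually.of_forall hC)

lemma IsTest.variance_eq {μ : Measure E} [IsProbabilityMeasure μ] {f : E → ℝ} (hf : IsTest f) :
    Var[f; μ] = ∫ x, f x ^ 2 ∂μ - (∫ x, f x ∂μ) ^ 2 := by
  rw [variance_eq_sub hf.memLp]
  rfl

lemma dotProduct_covMatrix_mulVec (η : Measure E) [IsProbabilityMeasure η] {k : ℕ}
    {f : Fin k → E → ℝ} (hf : ∀ i, IsTest (f i)) (t : Fin k → ℝ) :
    t ⬝ᵥ (covMatrix η f *ᵥ t) = Var[fun x => ∑ i, t i * f i x; η] := by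
  have h := variance_fun_sum (μ := η) fun i => ((hf i).const_mul (t i)).memLp
  rw [h]
  simp only [dotProduct, mulVec, covMatrix, of_apply, Finset.mul_sum, covariance_const_mul_left,
    covariance_const_mul_right]
  refine Finset.sum_congr rfl fun i _ => Finset.sum_congr rfl fun j _ => ?_
  ring

lemma posSemidef_covMatrix (η : Measure E) [IsProbabilityMeasure η] {k : ℕ}
    {f : Fin k → E → ℝ} (hf : ∀ i, IsTest (f i)) : (covMatrix η f).PosSemidef := by
  refine .of_dotProduct_mulVec_nonneg ?_ fun t => ?_
  · ext i j
    simp [covMatrix, covariance_comm]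
  · have := dotProduct_covMatrix_mulVec η hf t
    simp only [star_trivial]
    rw [this]
    exact variance_nonneg _ _

lemma Q_sum (n : ℕ) (θ : Param d) {ι : Type*} (s : Finset ι) (t : ι → ℝ) {φ : ι → E → ℝ}
    (hφ : ∀ i, IsTest (φ i)) (x : E) :
    S.Q n θ (fun x => ∑ i ∈ s, t i * φ i x) x = ∑ i ∈ s, t i * S.Q n θ (φ i) x := by
  have := S.markov_M n
  simp only [Q]
  rw [integral_finsetSum _ fun i _ => ((hφ i).const_mul (t i)).integrable, Finset.mul_sum]
  refine Finset.sum_congr rfl fun i _ => ?_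
  rw [integral_const_mul]
  ring

lemma dQfst_sum (hV : IsTest S.V) (n : ℕ) {ι : Type*} (s : Finset ι) (t : ι → ℝ) {φ : ι → E → ℝ}
    (hφ : ∀ i, IsTest (φ i)) :
    S.dQfst n (fun x => ∑ i ∈ s, t i * φ i x) = ∑ i ∈ s, t i * S.dQfst n (φ i) := by
  have := S.isProbabilityMeasure_target hV n
  rcases lt_or_ge S.β₀ (S.temp (n + 1)) with h | h
  · simp only [S.dQfst_eq hV n h, S.Q_sum (n + 1) _ s t hφ, Finset.mul_sum]
    rw [integral_finsetSum]
    · refine Finset.sum_congr rfl fun i _ => ?_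
      rw [← integral_const_mul]
      congr 1
      ext x
      ring
    · exact fun i _ => (hV.mul ((S.isTest_Q hV _ _ (hφ i)).const_mul (t i))).integrable
  · simp [S.dQfst_eq_zero hV n h]

lemma dQsnd_sum (hA : S.BoundedContinuous) (hA4 : S.DifferentiableKernels) (n : ℕ)
    (h : S.temp (n + 1) < S.βs) {ι : Type*} (s : Finset ι) (t : ι → ℝ) {φ : ι → E → ℝ}
    (hφ : ∀ i, IsTest (φ i)) :
    S.dQsnd n (fun x => ∑ i ∈ s, t i * φ i x) = ∑ i ∈ s, t i * S.dQsnd n (φ i) := by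
  have hV := hA.isTest_V
  have := S.finite_m
  have h1 := (S.ESS_temp_succ hV h).1
  rw [S.dQsnd_eq hA hA4 n h1 h (IsTest.sum s fun i _ => (hφ i).const_mul (t i))]
  simp only [S.dQsnd_eq hA hA4 n h1 h (hφ _), Finset.mul_sum]
  rw [integral_finsetSum, Finset.sum_div, ← Finset.sum_neg_distrib]
  · refine Finset.sum_congr rfl fun i _ => ?_
    have e : ∀ x, S.V x * (Real.exp (-S.temp (n + 1) * S.V x) * (t i * φ i x)) =
        t i * (S.V x * (Real.exp (-S.temp (n + 1) * S.V x) * φ i x)) := fun x => by ring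
    simp_rw [e]
    rw [integral_const_mul]
    ring
  · exact fun i _ => (hV.mul ((hV.exp _).mul ((hφ i).const_mul (t i)))).integrable

open Classical in
/-- A coefficient that vanishes once the final inverse temperature is reached. -/
def interiorCoef (n : ℕ) (c : ℝ) : ℝ := if S.temp (n + 1) < S.βs then c else 0

/-- The coefficient of the fluctuation of the inverse temperature after one backward step. -/
def pullCoef (n : ℕ) (s : ℝ) (ψ : E → ℝ) : ℝ :=
  S.interiorCoef n 1 * (s + (S.unnorm n fun _ => 1) * S.dQsnd n ψ) +
    (S.unnorm n fun _ => 1) * S.dQfst n ψ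

/-- The test function after one backward step. -/
def pullFun (n : ℕ) (s : ℝ) (ψ : E → ℝ) (x : E) : ℝ :=
  S.interiorCoef n (S.A12 n) * (s + (S.unnorm n fun _ => 1) * S.dQsnd n ψ) *
      (S.G n x - ∫ y, S.G n y ∂S.target n) +
    S.interiorCoef n (S.A13 n) * (s + (S.unnorm n fun _ => 1) * S.dQsnd n ψ) *
      (S.G n x ^ 2 - ∫ y, S.G n y ^ 2 ∂S.target n) +
    S.Q (n + 1) (S.param n) ψ x

/-- The asymptotic variance of `√N (s (β_n^N - β_n) + [γ_n^N - γ_n](ψ))`. -/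
def limitVar : ℕ → ℝ → (E → ℝ) → ℝ
  | 0, _, ψ => (S.unnorm 0 fun _ => 1) ^ 2 * Var[ψ; S.target 0]
  | n + 1, s, ψ => limitVar n (S.pullCoef n s ψ) (S.pullFun n s ψ) +
      (S.unnorm (n + 1) fun _ => 1) ^ 2 * Var[ψ; S.target (n + 1)]

/-- One formula for both cases of the definition: `interiorCoef` switches off the fluctuation of the
next temperature once `βs` is reached. -/
lemma A_eq (n : ℕ) {r : ℕ} (φ : Fin r → E → ℝ) : S.A n φ = Matrix.of (Fin.cons
    (Fin.cons (S.interiorCoef n 1) (Fin.cons (S.interiorCoef n (S.A12 n))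
      (Fin.cons (S.interiorCoef n (S.A13 n)) fun _ => 0)))
    fun i => Fin.cons ((S.unnorm n fun _ => 1) *
        (S.dQfst n (φ i) + S.interiorCoef n 1 * S.dQsnd n (φ i)))
      (Fin.cons ((S.unnorm n fun _ => 1) * S.dQsnd n (φ i) * S.interiorCoef n (S.A12 n))
        (Fin.cons ((S.unnorm n fun _ => 1) * S.dQsnd n (φ i) * S.interiorCoef n (S.A13 n))
          fun j => if i = j then 1 else 0))) := by
  by_cases h : S.temp (n + 1) < S.βs
  · simp only [A, interiorCoef, if_pos h, one_mul]
  · simp only [A, interiorCoef, if_neg h, zero_mul, add_zero, mul_zero]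
    congr 2
    ext j
    refine Fin.cases rfl (fun j => ?_) j
    refine Fin.cases rfl (fun j => ?_) j
    exact Fin.cases rfl (fun j => rfl) j

lemma isTest_Ext (hV : IsTest S.V) (n : ℕ) {r : ℕ} {φ : Fin r → E → ℝ} (hφ : ∀ i, IsTest (φ i))
    (i : Fin (r + 2)) : IsTest (S.Ext n φ i) := by
  have hG : IsTest (S.G n) := S.isTest_potential hV _
  refine Fin.cases ?_ (fun j => Fin.cases ?_ (fun k => ?_) j) i
  · exact hG.sub (isTest_const _)
  · exact (hG.pow 2).sub (isTest_const _)
  · exact hφ k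

lemma isTest_cons_zero {r : ℕ} {φ : Fin r → E → ℝ} (hφ : ∀ i, IsTest (φ i)) (i : Fin (r + 1)) :
    IsTest ((Fin.cons (fun _ => 0) φ : Fin (r + 1) → E → ℝ) i) :=
  Fin.cases (isTest_const 0) hφ i

lemma isTest_pullFun (hV : IsTest S.V) (n : ℕ) (s : ℝ) {ψ : E → ℝ} (hψ : IsTest ψ) :
    IsTest (S.pullFun n s ψ) := by
  have hG : IsTest (S.G n) := S.isTest_potential hV _
  exact (((hG.sub (isTest_const _)).const_mul _).add
    (((hG.pow 2).sub (isTest_const _)).const_mul _)).add (S.isTest_Q hV _ _ hψ)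

lemma posSemidef_asympCov (hV : IsTest S.V) (n : ℕ) {r : ℕ} {φ : Fin r → E → ℝ}
    (hφ : ∀ i, IsTest (φ i)) : (S.asympCov n φ).PosSemidef := by
  induction n generalizing r with
  | zero =>
    have := S.isProbabilityMeasure_target hV 0
    exact (posSemidef_covMatrix _ (isTest_cons_zero hφ)).smul (sq_nonneg _)
  | succ n ih =>
    have := S.isProbabilityMeasure_target hV (n + 1)
    have h1 := (ih (S.isTest_Ext hV n fun i => S.isTest_Q hV (n + 1) (S.param n) (hφ i))
      ).mul_mul_conjTranspose_same (S.A n φ)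
    rw [conjTranspose_eq_transpose_of_trivial] at h1
    exact h1.add ((posSemidef_covMatrix _ (isTest_cons_zero hφ)).smul (sq_nonneg _))

lemma dotProduct_covMatrix_cons (η : Measure E) [IsProbabilityMeasure η] {r : ℕ}
    {φ : Fin r → E → ℝ} (hφ : ∀ i, IsTest (φ i)) (t : Fin (r + 1) → ℝ) :
    t ⬝ᵥ (covMatrix η (Fin.cons (fun _ => 0) φ) *ᵥ t) =
      Var[fun x => ∑ i, t i.succ * φ i x; η] := by
  rw [dotProduct_covMatrix_mulVec η (isTest_cons_zero hφ)]
  simp [Fin.sum_univ_succ]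

/-- Linearity of `dQsnd` comes from `dQsnd_eq`, which requires β_{n+1} < βs; otherwise the
coefficient in front is 0. -/
lemma interiorCoef_mul_add_sum (hA : S.BoundedContinuous) (hA4 : S.DifferentiableKernels) (n : ℕ)
    {r : ℕ} {φ : Fin r → E → ℝ} (hφ : ∀ i, IsTest (φ i)) (c g s : ℝ) (t : Fin r → ℝ) :
    S.interiorCoef n c * (s + g * S.dQsnd n (fun x => ∑ i, t i * φ i x)) =
      S.interiorCoef n c * s + ∑ i, g * S.dQsnd n (φ i) * S.interiorCoef n c * t i := by
  by_cases h : S.temp (n + 1) < S.βs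
  · rw [S.dQsnd_sum hA hA4 n h _ _ hφ, mul_add, Finset.mul_sum, Finset.mul_sum]
    congr 1
    exact Finset.sum_congr rfl fun i _ => by ring
  · simp [interiorCoef, h]

/-- The quadratic form of the asymptotic covariance matrix. -/
lemma dotProduct_asympCov_mulVec (hA : S.BoundedContinuous) (hA4 : S.DifferentiableKernels) (n : ℕ)
    {r : ℕ} {φ : Fin r → E → ℝ} (hφ : ∀ i, IsTest (φ i)) (t : Fin (r + 1) → ℝ) :
    t ⬝ᵥ (S.asympCov n φ *ᵥ t) = S.limitVar n (t 0) fun x => ∑ i, t i.succ * φ i x := by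
  have hV := hA.isTest_V
  induction n generalizing r with
  | zero =>
    have := S.isProbabilityMeasure_target hV 0
    rw [asympCov, limitVar, smul_mulVec, dotProduct_smul, dotProduct_covMatrix_cons _ hφ,
      smul_eq_mul]
  | succ n ih =>
    have := S.isProbabilityMeasure_target hV (n + 1)
    rw [asympCov, limitVar, add_mulVec, dotProduct_add, smul_mulVec, dotProduct_smul,
      dotProduct_covMatrix_cons _ hφ, smul_eq_mul]
    congr 1
    -- The form of 𝒜Σ𝒜ᵀ at t is that of Σ at 𝒜ᵀt. The first component of 𝒜ᵀt turns out to be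
    -- `pullCoef`, and the others are the coefficients of `pullFun`.
    rw [← mulVec_mulVec, ← mulVec_mulVec, dotProduct_mulVec, ← mulVec_transpose,
      ih (φ := S.Ext n (S.Qlim n φ)) (S.isTest_Ext hV n (φ := S.Qlim n φ)
        fun i => S.isTest_Q hV (n + 1) (S.param n) (hφ i))]
    have hu : ∀ j, ((S.A n φ)ᵀ *ᵥ t) j =
        S.A n φ 0 j * t 0 + ∑ i : Fin r, S.A n φ i.succ j * t i.succ := by
      intro j
      rw [mulVec, dotProduct, Fin.sum_univ_succ]
      rfl
    have e0 : ((S.A n φ)ᵀ *ᵥ t) 0 = S.interiorCoef n 1 * t 0 + ∑ i : Fin r, (S.unnorm n fun _ => 1) *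
        (S.dQfst n (φ i) + S.interiorCoef n 1 * S.dQsnd n (φ i)) * t i.succ := by
      rw [hu, A_eq]
      rfl
    have e1 : ((S.A n φ)ᵀ *ᵥ t) (Fin.succ 0) = S.interiorCoef n (S.A12 n) * t 0 +
        ∑ i : Fin r, (S.unnorm n fun _ => 1) * S.dQsnd n (φ i) * S.interiorCoef n (S.A12 n) *
          t i.succ := by
      rw [hu, A_eq]
      rfl
    have e2 : ((S.A n φ)ᵀ *ᵥ t) (Fin.succ (Fin.succ 0)) = S.interiorCoef n (S.A13 n) * t 0 +
        ∑ i : Fin r, (S.unnorm n fun _ => 1) * S.dQsnd n (φ i) * S.interiorCoef n (S.A13 n) *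
          t i.succ := by
      rw [hu, A_eq]
      rfl
    have e3 : ∀ k : Fin r, ((S.A n φ)ᵀ *ᵥ t) k.succ.succ.succ = t k.succ := by
      intro k
      have : ((S.A n φ)ᵀ *ᵥ t) k.succ.succ.succ =
          0 * t 0 + ∑ i : Fin r, (if i = k then 1 else 0) * t i.succ := by
        rw [hu, A_eq]
        rfl
      simpa using this
    congr 1
    · rw [e0, pullCoef, S.interiorCoef_mul_add_sum hA hA4 n hφ, S.dQfst_sum hV n _ _ hφ,
        Finset.mul_sum, add_assoc, ← Finset.sum_add_distrib]
      congr 1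
      exact Finset.sum_congr rfl fun i _ => by ring
    · ext x
      rw [Fin.sum_univ_succ, Fin.sum_univ_succ, e1, e2, pullFun,
        S.interiorCoef_mul_add_sum hA hA4 n hφ, S.interiorCoef_mul_add_sum hA hA4 n hφ,
        S.Q_sum (n + 1) _ _ _ hφ, ← add_assoc]
      simp only [e3]
      rfl

/-- Homogeneity is inherited from the quadratic form for the single function `ψ`, evaluated at (s,
1) and at its multiple by t. -/
lemma limitVar_smul (hA : S.BoundedContinuous) (hA4 : S.DifferentiableKernels) (n : ℕ)
    (s : ℝ) {ψ : E → ℝ} (hψ : IsTest ψ) (t : ℝ) :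
    S.limitVar n (t * s) (fun x => t * ψ x) = t ^ 2 * S.limitVar n s ψ := by
  have h1 := S.dotProduct_asympCov_mulVec hA hA4 n (r := 1) (φ := fun _ => ψ) (fun _ => hψ) ![s, 1]
  have h2 := S.dotProduct_asympCov_mulVec hA hA4 n (r := 1) (φ := fun _ => ψ) (fun _ => hψ)
    (t • ![s, 1])
  rw [mulVec_smul, smul_dotProduct, dotProduct_smul, h1] at h2
  simp only [smul_eq_mul, Pi.smul_apply, Matrix.cons_val_zero, Finset.univ_unique,
    Finset.sum_singleton, Fin.default_eq_zero, Fin.succ_zero_eq_one, Matrix.cons_val_one,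
    mul_one, one_mul] at h2
  rw [← h2]
  ring

end Covariance

/-! ### Fluctuations of the particle system -/

section Fluctuation

variable {E : Type*} [MeasurableSpace E] {d : ℕ} (S : AdaptiveTempering E d)

instance isFiniteMeasure_empirical {N : ℕ} (x : Fin N → E) : IsFiniteMeasure (empirical x) := by
  rcases eq_or_ne N 0 with rfl | hN
  · have : empirical x = 0 := by simp [empirical]
    rw [this]
    infer_instance
  · have := isProbabilityMeasure_empirical hN x
    infer_instance

lemma unnormN_const_mul {N : ℕ} (x : ℕ → Fin N → E) (n : ℕ) (c : ℝ) (φ : E → ℝ) :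
    S.unnormN x n (fun y => c * φ y) = c * S.unnormN x n φ := by
  rw [unnormN, unnormN, integral_const_mul]
  ring

lemma unnormN_add {N : ℕ} (x : ℕ → Fin N → E) (n : ℕ) {φ ψ : E → ℝ} (hφ : IsTest φ)
    (hψ : IsTest ψ) :
    S.unnormN x n (fun y => φ y + ψ y) = S.unnormN x n φ + S.unnormN x n ψ := by
  rw [unnormN, unnormN, unnormN, integral_add hφ.integrable hψ.integrable, mul_add]

lemma unnorm_const_mul (n : ℕ) (c : ℝ) (φ : E → ℝ) :
    S.unnorm n (fun y => c * φ y) = c * S.unnorm n φ := by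
  simp only [unnorm, mul_left_comm _ c]
  rw [integral_const_mul]
  ring

lemma unnorm_add (hV : IsTest S.V) (n : ℕ) {φ ψ : E → ℝ} (hφ : IsTest φ) (hψ : IsTest ψ) :
    S.unnorm n (fun y => φ y + ψ y) = S.unnorm n φ + S.unnorm n ψ := by
  have := S.isProbabilityMeasure_target hV n
  rw [S.unnorm_eq hV, S.unnorm_eq hV, S.unnorm_eq hV, integral_add hφ.integrable hψ.integrable,
    mul_add]

lemma unnorm_sub_integral (hV : IsTest S.V) (n : ℕ) {φ : E → ℝ} (hφ : IsTest φ) :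
    S.unnorm n (fun y => φ y - ∫ z, φ z ∂S.target n) = 0 := by
  have := S.isProbabilityMeasure_target hV n
  rw [S.unnorm_eq hV, integral_sub hφ.integrable (integrable_const _)]
  simp

lemma unnormN_sub_const {N : ℕ} (hN : N ≠ 0) (x : ℕ → Fin N → E) (n : ℕ) {φ : E → ℝ}
    (hφ : IsTest φ) (c : ℝ) : S.unnormN x n (fun y => φ y - c) =
      S.unnormN x n (fun _ => 1) * (∫ y, φ y ∂empirical (x n) - c) := by
  have := isProbabilityMeasure_empirical hN (x n)
  rw [S.unnormN_eq_mul hN, integral_sub hφ.integrable (integrable_const _)]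
  simp

variable {Ω : ℕ → Type*} (X : ∀ N, ℕ → Fin N → Ω N → E)

/-- The path of the particle system with `N` particles at a sample point. -/
def path (i : Σ N, Ω N) : ℕ → Fin i.1 → E := fun p j => X i.1 p j i.2

/-- The rescaled error of the inverse temperature. -/
def tempErr (n : ℕ) (i : Σ N, Ω N) : ℝ := √(i.1 : ℝ) * (S.tempN (path X i) n - S.temp n)

/-- The rescaled error of the unnormalised distribution. -/
def unnormErr (n : ℕ) (ψ : E → ℝ) (i : Σ N, Ω N) : ℝ :=
  √(i.1 : ℝ) * (S.unnormN (path X i) n ψ - S.unnorm n ψ)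

lemma unnormErr_const_mul (n : ℕ) (c : ℝ) (ψ : E → ℝ) (i : Σ N, Ω N) :
    S.unnormErr X n (fun y => c * ψ y) i = c * S.unnormErr X n ψ i := by
  rw [unnormErr, unnormN_const_mul, unnorm_const_mul, unnormErr]
  ring

lemma unnormErr_add (hV : IsTest S.V) (n : ℕ) {φ ψ : E → ℝ} (hφ : IsTest φ) (hψ : IsTest ψ)
    (i : Σ N, Ω N) : S.unnormErr X n (fun y => φ y + ψ y) i =
      S.unnormErr X n φ i + S.unnormErr X n ψ i := by
  rw [unnormErr, S.unnormN_add _ _ hφ hψ, S.unnorm_add hV _ hφ hψ, unnormErr, unnormErr]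
  ring

lemma unnormErr_sub_integral (hV : IsTest S.V) (n : ℕ) {φ : E → ℝ} (hφ : IsTest φ)
    {i : Σ N, Ω N} (hi : i.1 ≠ 0) :
    S.unnormErr X n (fun y => φ y - ∫ z, φ z ∂S.target n) i =
      S.unnormN (path X i) n (fun _ => 1) * (√(i.1 : ℝ) *
        (∫ y, φ y ∂empirical (path X i n) - ∫ y, φ y ∂S.target n)) := by
  rw [unnormErr, S.unnorm_sub_integral hV n hφ, S.unnormN_sub_const hi _ _ hφ]
  ring

variable [∀ N, MeasurableSpace (Ω N)] (P : ∀ N, Measure (Ω N))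

/-- Convergence of the characteristic functions of the rescaled errors. -/
def HasCLT (n : ℕ) : Prop := ∀ (s : ℝ) (ψ : E → ℝ), IsTest ψ →
  Tendsto (fun N => ∫ ω, Complex.exp ((s * S.tempErr X n ⟨N, ω⟩ + S.unnormErr X n ψ ⟨N, ω⟩ : ℝ) *
    Complex.I) ∂P N) atTop (𝓝 ((Real.exp (-S.limitVar n s ψ / 2) : ℝ) : ℂ))

variable {X P}

lemma eventually_ne_zero : ∀ᶠ i in highProb P, i.1 ≠ 0 :=
  tendsto_fst_highProb.eventually_ne_atTop 0

variable (hX : ∀ N, S.IsParticleSystem (P N) (X N))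

include hX

lemma measurable_tempErr (hV : IsTest S.V) (n N : ℕ) :
    Measurable fun ω => S.tempErr X n ⟨N, ω⟩ :=
  (((S.measurable_tempN hV n).comp (S.measurable_path (hX N))).sub_const (S.temp n)).const_mul
    √(N : ℝ)

lemma measurable_unnormErr (hV : IsTest S.V) (n N : ℕ) {ψ : E → ℝ} (hψ : IsTest ψ) :
    Measurable fun ω => S.unnormErr X n ψ ⟨N, ω⟩ :=
  (((S.measurable_unnormN hV n hψ.1).comp (S.measurable_path (hX N))).sub_const
    (S.unnorm n ψ)).const_mul √(N : ℝ)

variable [∀ N, IsProbabilityMeasure (P N)]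

section Consistency

variable (hA : S.BoundedContinuous) (hA4 : S.DifferentiableKernels) {n : ℕ} (h : S.HasCLT X P n)

include hA hA4 h

/-- The hypothesis at (ts, tψ) gives the characteristic function at t; by homogeneity its limit is
exp(-t²σ²/2), continuous in t, and tightness follows. -/
lemma HasCLT.boundedInProb (s : ℝ) {ψ : E → ℝ} (hψ : IsTest ψ) :
    BoundedInProb P fun i => s * S.tempErr X n i + S.unnormErr X n ψ i := by
  refine BoundedInProb.of_tendsto_charFun
    (f := fun t => ((Real.exp (-(t ^ 2 * S.limitVar n s ψ) / 2) : ℝ) : ℂ))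
    (fun N => ((S.measurable_tempErr hX hA.isTest_V n N).const_mul s).add
      (S.measurable_unnormErr hX hA.isTest_V n N hψ)) (by fun_prop) fun t => ?_
  have h1 := h (t * s) (fun x => t * ψ x) (hψ.const_mul t)
  rw [S.limitVar_smul hA hA4 n s hψ t] at h1
  refine h1.congr fun N => ?_
  congr 1
  ext ω
  rw [unnormErr_const_mul]
  congr 3
  ring

lemma HasCLT.boundedInProb_unnormErr {ψ : E → ℝ} (hψ : IsTest ψ) :
    BoundedInProb P (S.unnormErr X n ψ) := by
  simpa using h.boundedInProb S hX hA hA4 0 hψ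

lemma HasCLT.boundedInProb_tempErr : BoundedInProb P (S.tempErr X n) := by
  have h1 := h.boundedInProb S hX hA hA4 1 (isTest_const 0)
  refine h1.congr (Eventually.of_forall fun i => ?_)
  simp [unnormErr, unnormN, unnorm]

lemma HasCLT.tendsto_tempN :
    Tendsto (fun i => S.tempN (path X i) n) (highProb P) (𝓝 (S.temp n)) :=
  tendsto_sub_nhds_zero_iff.1 (h.boundedInProb_tempErr S hX hA hA4).tendsto_of_sqrt_mul

lemma HasCLT.tendsto_unnormN {ψ : E → ℝ} (hψ : IsTest ψ) :
    Tendsto (fun i => S.unnormN (path X i) n ψ) (highProb P) (𝓝 (S.unnorm n ψ)) :=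
  tendsto_sub_nhds_zero_iff.1 (h.boundedInProb_unnormErr S hX hA hA4 hψ).tendsto_of_sqrt_mul

/-- The unnormalised error of the centred function f - η_n(f) is γ_n^N(1) times the normalised error
of f, and γ_n^N(1) has a positive limit. -/
lemma HasCLT.boundedInProb_integral {f : E → ℝ} (hf : IsTest f) : BoundedInProb P fun i =>
    √(i.1 : ℝ) * (∫ x, f x ∂empirical (path X i n) - ∫ x, f x ∂S.target n) := by
  have hV := hA.isTest_V
  have hg := h.tendsto_unnormN S hX hA hA4 (isTest_const 1)
  have hpos := S.unnorm_one_pos hV n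
  refine ((BoundedInProb.of_tendsto (hg.inv₀ hpos.ne')).mul
    (h.boundedInProb_unnormErr S hX hA hA4
      (hf.sub (isTest_const (∫ x, f x ∂S.target n))))).congr ?_
  filter_upwards [eventually_ne_zero, hg.eventually_ne hpos.ne'] with i hi hi'
  rw [S.unnormErr_sub_integral X hV n hf hi, inv_mul_cancel_left₀ hi']

lemma HasCLT.tendsto_integral {f : E → ℝ} (hf : IsTest f) :
    Tendsto (fun i => ∫ x, f x ∂empirical (path X i n)) (highProb P)
      (𝓝 (∫ x, f x ∂S.target n)) :=
  tendsto_sub_nhds_zero_iff.1 (h.boundedInProb_integral S hX hA hA4 hf).tendsto_of_sqrt_mul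

end Consistency

end Fluctuation

/-! ### Linearisation of one step of the algorithm -/

lemma norm_le_sum_abs {d : ℕ} (z : EuclideanSpace ℝ (Fin d)) : ‖z‖ ≤ ∑ k, |z k| := by
  conv_lhs => rw [← (EuclideanSpace.basisFun (Fin d) ℝ).sum_repr z]
  refine (norm_sum_le _ _).trans (le_of_eq (Finset.sum_congr rfl fun k _ => ?_))
  rw [norm_smul, (EuclideanSpace.basisFun (Fin d) ℝ).norm_eq_one, mul_one, Real.norm_eq_abs,
    EuclideanSpace.basisFun_repr]

section OneStep

variable {E : Type*} [MeasurableSpace E] {d : ℕ} (S : AdaptiveTempering E d)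
  {Ω : ℕ → Type*} {X : ∀ N, ℕ → Fin N → Ω N → E} [∀ N, MeasurableSpace (Ω N)]
  {P : ∀ N, Measure (Ω N)} [∀ N, IsProbabilityMeasure (P N)]
  (hX : ∀ N, S.IsParticleSystem (P N) (X N)) (hA : S.BoundedContinuous)
  (hA4 : S.DifferentiableKernels) {n : ℕ} (h : S.HasCLT X P n)
  (hn : (ESS (S.target n) fun x => Real.exp (-(S.βs - S.temp n) * S.V x)) ≠ S.α)

include hX hA hA4 h

/-- Passing from normalised to unnormalised errors replaces γ_n^N(1) by its limit, at the cost of a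
vanishing factor times a bounded one. This is the origin of the factor γ_n(1)⁻¹ in `A12` and `A13`.
-/
lemma HasCLT.tendsto_unnormN_one_sub_mul {f : E → ℝ} (hf : IsTest f) (c : ℝ) :
    Tendsto (fun i => (S.unnorm n fun _ => 1) * c * (√(i.1 : ℝ) *
      (∫ x, f x ∂empirical (path X i n) - ∫ x, f x ∂S.target n)) -
        c * S.unnormErr X n (fun y => f y - ∫ x, f x ∂S.target n) i) (highProb P) (𝓝 0) := by
  have hV := hA.isTest_V
  have hg := tendsto_sub_nhds_zero_iff.2 (h.tendsto_unnormN S hX hA hA4 (isTest_const 1))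
  have h0 := hg.const_mul (-c)
  rw [mul_zero] at h0
  have h1 := (h.boundedInProb_integral S hX hA hA4 hf).tendsto_mul h0
  refine h1.congr' ?_
  filter_upwards [eventually_ne_zero] with i hi
  rw [S.unnormErr_sub_integral X hV n hf hi]
  ring

include hn

lemma HasCLT.eventually_tempN_succ_eq (hs : ¬ S.temp (n + 1) < S.βs) :
    ∀ᶠ i in highProb P, S.tempN (path X i) (n + 1) = S.temp (n + 1) := by
  have hV := hA.isTest_V
  have e : S.temp (n + 1) = S.βs := le_antisymm (S.temp_mem hV (n + 1)).2 (not_lt.1 hs)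
  rw [e]
  exact S.eventually_nextTemp_eq hV
    (eventually_ne_zero.mono fun i hi => isProbabilityMeasure_empirical hi (path X i n))
    (fun f hf => h.tendsto_integral S hX hA hA4 hf) (h.tendsto_tempN S hX hA hA4)
    (eventually_ne_zero.mono fun i hi => (S.tempN_mem hV hi (path X i) n).2) e hn

/-- For interior β_{n+1}, the error of β_n is added to that of the increment, which
`tendsto_increment_sub` expands. At `βs`, all terms vanish with high probability. -/
lemma HasCLT.tendsto_tempErr_succ_sub : Tendsto (fun i => S.tempErr X (n + 1) i -
    (S.interiorCoef n 1 * S.tempErr X n i +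
      S.interiorCoef n (S.A12 n) *
        S.unnormErr X n (fun y => S.G n y - ∫ x, S.G n x ∂S.target n) i +
      S.interiorCoef n (S.A13 n) *
        S.unnormErr X n (fun y => S.G n y ^ 2 - ∫ x, S.G n x ^ 2 ∂S.target n) i))
    (highProb P) (𝓝 0) := by
  have hV := hA.isTest_V
  by_cases hs : S.temp (n + 1) < S.βs
  · have hG : IsTest (S.G n) := S.isTest_potential hV _
    have hprob : ∀ᶠ i in highProb P, IsProbabilityMeasure (empirical (path X i n)) :=
      eventually_ne_zero.mono fun i hi => isProbabilityMeasure_empirical hi (path X i n)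
    have hb := h.tendsto_tempN S hX hA hA4
    obtain ⟨h1, h2⟩ := S.tendsto_nextTemp hV hprob
      (fun f hf => h.tendsto_integral S hX hA hA4 hf) hb hs
    have h3 := S.tendsto_increment_sub hV hprob
      (fun f hf => h.boundedInProb_integral S hX hA hA4 hf) hs
      (δ := fun i => (S.tempN (path X i) (n + 1) - S.tempN (path X i) n) -
        (S.temp (n + 1) - S.temp n))
      (tendsto_sub_nhds_zero_iff.2 (h1.sub hb)) (by
        filter_upwards [h2] with i hi
        rw [add_sub_cancel]
        exact hi)
    have h4 := h.tendsto_unnormN_one_sub_mul S hX hA hA4 hG (S.A12 n)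
    have h5 := h.tendsto_unnormN_one_sub_mul S hX hA hA4 (hG.pow 2) (S.A13 n)
    have h6 := (h3.add h4).add h5
    simp only [add_zero] at h6
    refine h6.congr fun i => ?_
    have hg := (S.unnorm_one_pos hV n).ne'
    have e1 : (S.unnorm n fun _ => 1) * S.A12 n =
        -2 * ((∫ x, S.G n x ∂S.target n) / ∫ x, S.G n x ^ 2 ∂S.target n) * (S.dESS n)⁻¹ := by
      rw [A12]
      field_simp
    have e2 : (S.unnorm n fun _ => 1) * S.A13 n =
        ((∫ x, S.G n x ∂S.target n) ^ 2 / (∫ x, S.G n x ^ 2 ∂S.target n) ^ 2) *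
          (S.dESS n)⁻¹ := by
      rw [A13]
      field_simp
    rw [e1, e2]
    simp only [interiorCoef, if_pos hs, tempErr]
    ring
  · refine tendsto_const_nhds.congr' ?_
    filter_upwards [h.eventually_tempN_succ_eq S hX hA hA4 hn hs] with i hi
    simp [interiorCoef, hs, tempErr, hi]

lemma HasCLT.boundedInProb_tempErr_succ : BoundedInProb P (S.tempErr X (n + 1)) := by
  have hV := hA.isTest_V
  have hG : IsTest (S.G n) := S.isTest_potential hV _
  have h1 := BoundedInProb.of_tendsto (h.tendsto_tempErr_succ_sub S hX hA hA4 hn)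
  refine (h1.add (((h.boundedInProb_tempErr S hX hA hA4).const_mul (S.interiorCoef n 1)).add
    ((h.boundedInProb_unnormErr S hX hA hA4
      (hG.sub (isTest_const (∫ x, S.G n x ∂S.target n)))).const_mul
        (S.interiorCoef n (S.A12 n))) |>.add
    ((h.boundedInProb_unnormErr S hX hA hA4
      ((hG.pow 2).sub (isTest_const (∫ x, S.G n x ^ 2 ∂S.target n)))).const_mul
        (S.interiorCoef n (S.A13 n))))).congr (Eventually.of_forall fun i => ?_)
  ring

lemma HasCLT.boundedInProb_norm_paramN_sub :
    BoundedInProb P fun i => √(i.1 : ℝ) * ‖S.paramN (path X i) n - S.param n‖ := by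
  have hV := hA.isTest_V
  have := S.isProbabilityMeasure_target hV n
  obtain ⟨C, hC⟩ := hA.bounded_ξ (n + 1)
  have hξ : ∀ k, IsTest fun x => S.ξ (n + 1) x k := fun k =>
    ⟨(measurable_pi_apply k).comp
      ((WithLp.measurable_ofLp 2 _).comp (S.measurable_ξ (n + 1))), C, fun x => by
      rw [← Real.norm_eq_abs]
      exact (PiLp.norm_apply_le _ k).trans (hC x)⟩
  have h1 := ((h.boundedInProb_tempErr S hX hA hA4).abs.add
    (h.boundedInProb_tempErr_succ S hX hA hA4 hn).abs).add (.sum Finset.univ fun k _ =>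
      (h.boundedInProb_integral S hX hA hA4 (hξ k)).abs)
  refine h1.mono (Eventually.of_forall fun i => ?_)
  have hs := Real.sqrt_nonneg (i.1 : ℝ)
  have e : ∀ k, (∫ x, S.ξ (n + 1) x ∂empirical (path X i n) -
      ∫ x, S.ξ (n + 1) x ∂S.target n) k =
      ∫ x, S.ξ (n + 1) x k ∂empirical (path X i n) - ∫ x, S.ξ (n + 1) x k ∂S.target n := fun k => by
    have e1 : ∀ μ : Measure E, IsFiniteMeasure μ →
        ∫ x, S.ξ (n + 1) x k ∂μ = (∫ x, S.ξ (n + 1) x ∂μ) k := fun μ _ =>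
      (EuclideanSpace.proj (𝕜 := ℝ) k).integral_comp_comm (S.integrable_ξ hC)
    rw [e1 _ inferInstance, e1 _ inferInstance, PiLp.sub_apply]
  have h2 : ‖S.paramN (path X i) n - S.param n‖ ≤ |S.tempN (path X i) n - S.temp n| +
      |S.tempN (path X i) (n + 1) - S.temp (n + 1)| +
      ∑ k, |∫ x, S.ξ (n + 1) x k ∂empirical (path X i n) - ∫ x, S.ξ (n + 1) x k ∂S.target n| := by
    have h3 := norm_le_sum_abs (∫ x, S.ξ (n + 1) x ∂empirical (path X i n) -
      ∫ x, S.ξ (n + 1) x ∂S.target n)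
    simp only [e] at h3
    have h4 := abs_nonneg (S.tempN (path X i) n - S.temp n)
    have h5 := abs_nonneg (S.tempN (path X i) (n + 1) - S.temp (n + 1))
    have h6 : 0 ≤ ∑ k, |∫ x, S.ξ (n + 1) x k ∂empirical (path X i n) -
        ∫ x, S.ξ (n + 1) x k ∂S.target n| := Finset.sum_nonneg fun k _ => abs_nonneg _
    refine max_le ?_ (max_le ?_ (h3.trans ?_))
    · change |S.tempN (path X i) n - S.temp n| ≤ _
      linarith
    · change |S.tempN (path X i) (n + 1) - S.temp (n + 1)| ≤ _
      linarith
    · linarith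
  rw [abs_mul, abs_of_nonneg hs, abs_of_nonneg (norm_nonneg _)]
  refine (mul_le_mul_of_nonneg_left h2 hs).trans (le_trans (le_of_eq ?_) (le_abs_self _))
  simp only [tempErr, abs_mul, abs_of_nonneg hs, ← Finset.mul_sum]
  ring

lemma HasCLT.tendsto_paramN : Tendsto (fun i => S.paramN (path X i) n) (highProb P)
    (𝓝[S.domParam (n + 1)] S.param n) := by
  obtain ⟨C, hC⟩ := hA.bounded_ξ (n + 1)
  refine tendsto_nhdsWithin_iff.2 ⟨?_, eventually_ne_zero.mono fun i hi =>
    S.paramN_mem hA.isTest_V hi _ n hC⟩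
  exact tendsto_iff_norm_sub_tendsto_zero.2
    (h.boundedInProb_norm_paramN_sub S hX hA hA4 hn).tendsto_of_sqrt_mul

/-- The contribution of the kernels to the fluctuations. -/
lemma HasCLT.tendsto_unnormN_Q_sub {ψ : E → ℝ} (hψ : IsTest ψ) : Tendsto (fun i =>
    √(i.1 : ℝ) * (S.unnormN (path X i) n (S.Q (n + 1) (S.paramN (path X i) n) ψ) -
      S.unnorm (n + 1) ψ) -
    (S.unnormErr X n (S.Q (n + 1) (S.param n) ψ) i + (S.unnorm n fun _ => 1) *
      (S.dQfst n ψ * S.tempErr X n i + S.dQsnd n ψ * S.tempErr X (n + 1) i)))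
    (highProb P) (𝓝 0) := by
  have hV := hA.isTest_V
  have := S.isProbabilityMeasure_target hV n
  have hprob : ∀ᶠ i in highProb P, IsProbabilityMeasure (empirical (path X i n)) :=
    eventually_ne_zero.mono fun i hi => isProbabilityMeasure_empirical hi (path X i n)
  have hθ := h.tendsto_paramN S hX hA hA4 hn
  have hy := h.boundedInProb_tempErr S hX hA hA4
  have hy' := h.boundedInProb_tempErr_succ S hX hA hA4 hn
  have hg := h.tendsto_unnormN S hX hA hA4 (isTest_const 1)
  set w := (∫ x, S.V x * (Real.exp (-S.temp (n + 1) * S.V x) * ψ x) ∂S.m) /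
    S.normConst (S.temp n) with hw
  set v := ∫ x, S.V x * S.Q (n + 1) (S.param n) ψ x ∂S.target n with hv
  -- Replacing the empirical measure by η_n in the increment of Q costs o(‖θ_n^N - θ_n‖), negligible
  -- because this distance is of order N^{-1/2} in probability.
  have h1 : Tendsto (fun i => √(i.1 : ℝ) *
      (∫ x, S.Q (n + 1) (S.paramN (path X i) n) ψ x ∂empirical (path X i n) -
        ∫ x, S.Q (n + 1) (S.param n) ψ x ∂empirical (path X i n) -
      (∫ x, S.Q (n + 1) (S.paramN (path X i) n) ψ x ∂S.target n -
        ∫ x, S.Q (n + 1) (S.param n) ψ x ∂S.target n))) (highProb P) (𝓝 0) := by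
    refine ((h.boundedInProb_norm_paramN_sub S hX hA hA4 hn).tendsto_mul
      (S.tendsto_integral_Q_sub_div hA hA4 hψ hprob
        (fun f hf => h.tendsto_integral S hX hA hA4 hf) hθ)).congr fun i => ?_
    rcases eq_or_ne (S.paramN (path X i) n) (S.param n) with e | e
    · rw [e]
      simp
    · have := (norm_pos_iff.2 (sub_ne_zero.2 e)).ne'
      field_simp
  -- There remains the expansion of η_n(Q_θψ) at the random parameter: linear in the two
  -- temperatures, with a quadratic remainder and a coefficient that tends to `v`.
  have h2 : Tendsto (fun i => √(i.1 : ℝ) *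
      (∫ x, S.Q (n + 1) (S.paramN (path X i) n) ψ x ∂S.target n -
        ∫ x, S.Q (n + 1) (S.param n) ψ x ∂S.target n) -
      (v * S.tempErr X n i - w * S.tempErr X (n + 1) i)) (highProb P) (𝓝 0) := by
    have hv' := tendsto_sub_nhds_zero_iff.2
      (S.tendsto_integral_mul_Q (ηN := fun _ => S.target n) hA hψ hV
        (Eventually.of_forall fun _ => this) (fun f _ => tendsto_const_nhds) hθ)
    obtain ⟨K, hK, hexp⟩ := S.exists_abs_integral_Q_sub_le hA n hψ
    have ht := tendsto_sub_nhds_zero_iff.2 (h.tendsto_tempN S hX hA hA4)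
    have ht' := hy'.tendsto_of_sqrt_mul
    have h3 := ((hy.abs.tendsto_mul (by simpa using ht.abs)).add
      (hy'.abs.tendsto_mul (by simpa using ht'.abs))).const_mul K
    simp only [add_zero, mul_zero] at h3
    have h4 : Tendsto (fun i => √(i.1 : ℝ) *
        (∫ x, S.Q (n + 1) (S.paramN (path X i) n) ψ x ∂S.target n -
          ∫ x, S.Q (n + 1) (S.param n) ψ x ∂S.target n -
        (S.tempN (path X i) n - S.temp n) *
          ∫ x, S.V x * S.Q (n + 1) (S.paramN (path X i) n) ψ x ∂S.target n +
        (S.tempN (path X i) (n + 1) - S.temp (n + 1)) * w)) (highProb P) (𝓝 0) := by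
      refine squeeze_zero_norm' ?_ h3
      filter_upwards [(tendsto_nhdsWithin_iff.1 hθ).2,
        (by simpa using ht.abs : Tendsto (fun i => |S.tempN (path X i) n - S.temp n|) (highProb P)
          (𝓝 0)).eventually_le_const one_pos,
        (by simpa using ht'.abs : Tendsto (fun i => |S.tempN (path X i) (n + 1) - S.temp (n + 1)|)
          (highProb P) (𝓝 0)).eventually_le_const one_pos] with i i1 i2 i3
      have hs := Real.sqrt_nonneg (i.1 : ℝ)
      rw [Real.norm_eq_abs, abs_mul, abs_of_nonneg hs]
      refine (mul_le_mul_of_nonneg_left (hexp _ i1 i2 i3) hs).trans_eq ?_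
      simp only [tempErr, abs_mul, abs_of_nonneg hs, paramN]
      ring
    have h5 := h4.add (hy.tendsto_mul hv')
    rw [add_zero] at h5
    refine h5.congr fun i => ?_
    simp only [tempErr]
    ring
  -- When β_{n+1} = β₀, the conventional value 0 of `dQfst` need not equal `v`; but then βs = β₀ and
  -- the temperature cannot move at all.
  have h3 : ∀ᶠ i in highProb P, S.dQfst n ψ * S.tempErr X n i = v * S.tempErr X n i := by
    rcases lt_or_ge S.β₀ (S.temp (n + 1)) with hs | hs
    · rw [S.dQfst_eq hV n hs]
      exact Eventually.of_forall fun _ => rfl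
    · have hb := S.temp_mem hV n
      have hb' := S.temp_le_temp_succ hV n
      have hbs : S.βs ≤ S.temp (n + 1) := not_lt.1 fun hlt => by
        have := (S.ESS_temp_succ hV hlt).1
        linarith
      filter_upwards [eventually_ne_zero] with i hi
      have := S.tempN_mem hV hi (path X i) n
      have e : S.tempN (path X i) n = S.temp n := by linarith
      simp [tempErr, e]
  -- At `βs` no formula for `dQsnd` is needed: the error that it multiplies is zero with high
  -- probability.
  have h4 : ∀ᶠ i in highProb P,
      S.dQsnd n ψ * S.tempErr X (n + 1) i = -(w * S.tempErr X (n + 1) i) := by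
    by_cases hs : S.temp (n + 1) < S.βs
    · rw [S.dQsnd_eq hA hA4 n (S.ESS_temp_succ hV hs).1 hs hψ]
      exact Eventually.of_forall fun _ => neg_mul _ _
    · filter_upwards [h.eventually_tempN_succ_eq S hX hA hA4 hn hs] with i hi
      simp [tempErr, hi]
  have hB : BoundedInProb P fun i => v * S.tempErr X n i + -w * S.tempErr X (n + 1) i :=
    (hy.const_mul v).add (hy'.const_mul (-w))
  have h5 := ((hg.mul (h1.add h2)).add (hB.tendsto_mul (tendsto_sub_nhds_zero_iff.2 hg)))
  simp only [add_zero, mul_zero] at h5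
  refine h5.congr' ?_
  filter_upwards [h3, h4, eventually_ne_zero] with i e3 e4 hi
  rw [e3, e4, unnormErr, S.unnorm_Q hA n hψ,
    S.unnormN_eq_mul hi _ _ (S.Q (n + 1) (S.paramN (path X i) n) ψ),
    S.unnormN_eq_mul hi _ _ (S.Q (n + 1) (S.param n) ψ)]
  ring

/-- Linearisation of one step of the algorithm, before resampling. -/
lemma HasCLT.tendsto_step_sub (s : ℝ) {ψ : E → ℝ} (hψ : IsTest ψ) : Tendsto (fun i =>
    s * S.tempErr X (n + 1) i +
      √(i.1 : ℝ) * (S.unnormN (path X i) n (S.Q (n + 1) (S.paramN (path X i) n) ψ) -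
        S.unnorm (n + 1) ψ) -
    (S.pullCoef n s ψ * S.tempErr X n i + S.unnormErr X n (S.pullFun n s ψ) i))
    (highProb P) (𝓝 0) := by
  have hV := hA.isTest_V
  have hG : IsTest (S.G n) := S.isTest_potential hV _
  have hG1 := hG.sub (isTest_const (∫ x, S.G n x ∂S.target n))
  have hG2 := (hG.pow 2).sub (isTest_const (∫ x, S.G n x ^ 2 ∂S.target n))
  have h1 := (h.tendsto_tempErr_succ_sub S hX hA hA4 hn).const_mul
    (s + (S.unnorm n fun _ => 1) * S.dQsnd n ψ)
  have h2 := h1.add (h.tendsto_unnormN_Q_sub S hX hA hA4 hn hψ)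
  simp only [add_zero, mul_zero] at h2
  refine h2.congr fun i => ?_
  have e : S.unnormErr X n (S.pullFun n s ψ) i = _ :=
    S.unnormErr_add X hV n ((hG1.const_mul _).add (hG2.const_mul _))
      (S.isTest_Q hV (n + 1) (S.param n) hψ) i
  rw [e, S.unnormErr_add X hV n (hG1.const_mul _) (hG2.const_mul _), unnormErr_const_mul,
    unnormErr_const_mul, pullCoef]
  ring

end OneStep

/-! ### The central limit theorem for characteristic functions -/

section Sampling

variable {E : Type*} [MeasurableSpace E] {d : ℕ} (S : AdaptiveTempering E d)

lemma exp_sqrt_mul_integral_empirical {N : ℕ} (hN : N ≠ 0) (x : Fin N → E) {f : E → ℝ}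
    (hf : Measurable f) :
    Complex.exp ((√(N : ℝ) * ∫ y, f y ∂empirical x : ℝ) * Complex.I) =
      ∏ j, Complex.exp ((f (x j) / √(N : ℝ) : ℝ) * Complex.I) := by
  have hN' : (0 : ℝ) < N := by exact_mod_cast Nat.pos_of_ne_zero hN
  have hs := Real.sqrt_pos.2 hN'
  rw [← Complex.exp_sum, ← Finset.sum_mul, ← Complex.ofReal_sum, ← Finset.sum_div,
    integral_empirical x hf.stronglyMeasurable, smul_eq_mul]
  congr 3
  field_simp
  rw [Real.sq_sqrt hN'.le]

lemma norm_charFun_pow_le_one {μ : Measure E} [IsProbabilityMeasure μ] (f : E → ℝ) (N : ℕ) (a : ℝ) :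
    ‖Complex.exp (a * Complex.I) * (∫ x, Complex.exp ((f x : ℝ) * Complex.I) ∂μ) ^ N‖ ≤ 1 := by
  rw [norm_mul, Complex.norm_exp_ofReal_mul_I, one_mul, norm_pow]
  refine pow_le_one₀ (norm_nonneg _) ?_
  have h := norm_integral_le_of_norm_le_const (μ := μ) (C := 1)
    (f := fun x => Complex.exp ((f x : ℝ) * Complex.I))
    (Eventually.of_forall fun x => (Complex.norm_exp_ofReal_mul_I _).le)
  simpa using h

/-- The rescaled sampling error of the generation `n + 1`. -/
def samplingErr (n : ℕ) (f : E → ℝ) {N : ℕ} (x : ℕ → Fin N → E) : ℝ :=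
  √(N : ℝ) * (∫ y, f y ∂empirical (x (n + 1)) -
    ∫ y, f y ∂S.Phi (n + 1) (S.paramN x n) (empirical (x n)))

lemma measurable_integral_Phi (hV : IsTest S.V) (n : ℕ) {f : E → ℝ} (hf : IsTest f) {N : ℕ} :
    Measurable fun x : ℕ → Fin N → E =>
      ∫ y, f y ∂S.Phi (n + 1) (S.paramN x n) (empirical (x n)) := by
  rcases eq_or_ne N 0 with rfl | hN
  · exact Subsingleton.measurable
  have e : (fun x : ℕ → Fin N → E =>
      ∫ y, f y ∂S.Phi (n + 1) (S.paramN x n) (empirical (x n))) = fun x =>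
      (∫ y, S.Q (n + 1) (S.paramN x n) f y ∂empirical (x n)) /
        ∫ y, S.Q (n + 1) (S.paramN x n) (fun _ => 1) y ∂empirical (x n) := by
    ext x
    have := isProbabilityMeasure_empirical hN (x n)
    simp only [S.integral_Phi hV _ _ _ hf, Q_one]
  rw [e]
  exact (S.measurable_integral_Q hV n (n + 1) hf.1).div
    (S.measurable_integral_Q hV n (n + 1) measurable_const)

lemma measurable_samplingErr (hV : IsTest S.V) (n : ℕ) {f : E → ℝ} (hf : IsTest f) {N : ℕ} :
    Measurable fun x : ℕ → Fin N → E => S.samplingErr n f x :=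
  ((measurable_integral_empirical (n + 1) (hf.1.comp measurable_snd)).sub
    (S.measurable_integral_Phi hV n hf)).const_mul _

lemma samplingErr_const_mul (n : ℕ) (c : ℝ) (f : E → ℝ) {N : ℕ} (x : ℕ → Fin N → E) :
    S.samplingErr n (fun y => c * f y) x = c * S.samplingErr n f x := by
  simp only [samplingErr]
  rw [integral_const_mul, integral_const_mul]
  ring

/-- The conditional characteristic function of the rescaled sampling error. -/
def samplingFactor (n : ℕ) (f : E → ℝ) {N : ℕ} (x : ℕ → Fin N → E) : ℂ :=
  Complex.exp ((-√(N : ℝ) * ∫ y, f y ∂S.Phi (n + 1) (S.paramN x n) (empirical (x n)) : ℝ) *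
      Complex.I) *
    (∫ y, Complex.exp ((f y / √(N : ℝ) : ℝ) * Complex.I)
      ∂S.Phi (n + 1) (S.paramN x n) (empirical (x n))) ^ N

lemma norm_samplingFactor_le (hV : IsTest S.V) (n : ℕ) (f : E → ℝ) {N : ℕ} (x : ℕ → Fin N → E) :
    ‖S.samplingFactor n f x‖ ≤ 1 := by
  rw [samplingFactor]
  rcases eq_or_ne N 0 with rfl | hN
  · rw [pow_zero, mul_one]
    exact (Complex.norm_exp_ofReal_mul_I _).le
  · have := isProbabilityMeasure_empirical hN (x n)
    have := S.isProbabilityMeasure_Phi hV (n + 1) (S.paramN x n) (empirical (x n))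
    exact norm_charFun_pow_le_one _ _ _

lemma measurable_samplingFactor (hV : IsTest S.V) (n : ℕ) {f : E → ℝ} (hf : IsTest f) {N : ℕ} :
    Measurable fun x : ℕ → Fin N → E => S.samplingFactor n f x := by
  rcases eq_or_ne N 0 with rfl | hN
  · exact Subsingleton.measurable
  have h1 := S.measurable_integral_Phi hV n hf (N := N)
  have hfm := hf.1
  let κ : Kernel (ℕ → Fin N → E) E := ⟨fun x => S.Phi (n + 1) (S.paramN x n) (empirical (x n)),
    S.measurable_Phi_path hV hN n (n + 1)⟩
  have h2 : Measurable fun y => Complex.exp ((f y / √(N : ℝ) : ℝ) * Complex.I) := by fun_prop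
  have h3 : Measurable fun x => ∫ y, Complex.exp ((f y / √(N : ℝ) : ℝ) * Complex.I) ∂κ x :=
    (h2.stronglyMeasurable.integral_kernel (κ := κ)).measurable
  refine Measurable.mul ?_ (h3.pow_const N)
  fun_prop

/-- Given the past, `T` and the centring phase are frozen, and the remaining product over the i.i.d.
particles integrates to an N-th power. -/
lemma integral_exp_add_samplingErr (hV : IsTest S.V) {Ω : Type*} [MeasurableSpace Ω]
    {P : Measure Ω} [IsProbabilityMeasure P] {N : ℕ} (hN : N ≠ 0) {X : ℕ → Fin N → Ω → E}
    (hX : S.IsParticleSystem P X) (n : ℕ) {f : E → ℝ} (hf : IsTest f)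
    {T : (ℕ → Fin N → E) → ℝ} (hT : Measurable T) (hpast : ∀ x, T (stopPath x n) = T x) :
    ∫ ω, Complex.exp ((T (fun p j => X p j ω) + S.samplingErr n f (fun p j => X p j ω) : ℝ) *
        Complex.I) ∂P =
      ∫ ω, Complex.exp (T (fun p j => X p j ω) * Complex.I) *
        S.samplingFactor n f (fun p j => X p j ω) ∂P := by
  have hPm := S.measurable_integral_Phi hV n hf (N := N)
  have hfm := hf.1
  have hU : Measurable fun x : ℕ → Fin N → E => Complex.exp (T x * Complex.I) *
      Complex.exp ((-√(N : ℝ) * ∫ y, f y ∂S.Phi (n + 1) (S.paramN x n) (empirical (x n)) : ℝ) *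
        Complex.I) := by
    fun_prop
  have h := S.integral_mul_prod hV hN hX n hU (C := 1) (fun x => by
      rw [norm_mul, Complex.norm_exp_ofReal_mul_I, Complex.norm_exp_ofReal_mul_I, one_mul])
    (fun x => by rw [hpast, Phi_stopPath])
    (f := fun y => Complex.exp ((f y / √(N : ℝ) : ℝ) * Complex.I)) (by fun_prop) (B := 1)
    (fun y => (Complex.norm_exp_ofReal_mul_I _).le)
  refine Eq.trans ?_ (h.trans ?_)
  · refine integral_congr_ae (Eventually.of_forall fun ω => ?_)
    beta_reduce
    rw [← exp_sqrt_mul_integral_empirical hN (fun j => X (n + 1) j ω) hf.1, ← Complex.exp_add,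
      ← Complex.exp_add, ← add_mul, ← add_mul, ← Complex.ofReal_add, ← Complex.ofReal_add,
      samplingErr]
    congr 3
    ring
  · refine integral_congr_ae (Eventually.of_forall fun ω => ?_)
    beta_reduce
    rw [samplingFactor, mul_assoc]

/-- The constant depends only on a bound for `f`, hence is the same for all random sampling laws. -/
lemma exists_norm_samplingFactor_sub_le (hV : IsTest S.V) (n : ℕ) {f : E → ℝ} (hf : IsTest f) :
    ∃ K : ℝ, ∀ (N : ℕ) (_ : N ≠ 0) (x : ℕ → Fin N → E), ‖S.samplingFactor n f x -
      (Real.exp (-(∫ y, f y ^ 2 ∂S.Phi (n + 1) (S.paramN x n) (empirical (x n)) -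
        (∫ y, f y ∂S.Phi (n + 1) (S.paramN x n) (empirical (x n))) ^ 2) / 2) : ℝ)‖ ≤
      K / √(N : ℝ) := by
  obtain ⟨C, hC⟩ := hf.2
  obtain ⟨K, hK⟩ := exists_norm_charFun_pow_sub_le (E := E) C
  refine ⟨K, fun N hN x => ?_⟩
  have := isProbabilityMeasure_empirical hN (x n)
  have := S.isProbabilityMeasure_Phi hV (n + 1) (S.paramN x n) (empirical (x n))
  rw [samplingFactor]
  exact hK _ f hf.1 hC N (Nat.one_le_iff_ne_zero.2 hN)

variable {Ω : ℕ → Type*} {X : ∀ N, ℕ → Fin N → Ω N → E} [∀ N, MeasurableSpace (Ω N)]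
  {P : ∀ N, Measure (Ω N)}

/-- The sampling laws converge on f and f², so the conditional variance tends to the variance under
η_{n+1}. -/
lemma tendsto_samplingFactor (hV : IsTest S.V) {n : ℕ} {f : E → ℝ} (hf : IsTest f)
    (hPhi : ∀ g, IsTest g → Tendsto (fun i : Σ N, Ω N => ∫ y, g y ∂S.Phi (n + 1)
      (S.paramN (path X i) n) (empirical (path X i n))) (highProb P)
      (𝓝 (∫ y, g y ∂S.target (n + 1)))) :
    Tendsto (fun i => S.samplingFactor n f (path X i)) (highProb P)
      (𝓝 ((Real.exp (-Var[f; S.target (n + 1)] / 2) : ℝ) : ℂ)) := by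
  have := S.isProbabilityMeasure_target hV (n + 1)
  obtain ⟨K, hK⟩ := S.exists_norm_samplingFactor_sub_le hV n hf
  have h2 := ((hPhi _ (hf.pow 2)).sub ((hPhi f hf).pow 2)).neg.div_const 2
  rw [← hf.variance_eq] at h2
  have h3 : Tendsto (fun i : Σ N, Ω N => ((Real.exp (-(∫ y, f y ^ 2 ∂S.Phi (n + 1)
      (S.paramN (path X i) n) (empirical (path X i n)) - (∫ y, f y ∂S.Phi (n + 1)
      (S.paramN (path X i) n) (empirical (path X i n))) ^ 2) / 2) : ℝ) : ℂ)) (highProb P)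
      (𝓝 ((Real.exp (-Var[f; S.target (n + 1)] / 2) : ℝ) : ℂ)) :=
    (Complex.continuous_ofReal.tendsto _).comp ((Real.continuous_exp.tendsto _).comp h2)
  have h4 : Tendsto (fun i : Σ N, Ω N => S.samplingFactor n f (path X i) -
      ((Real.exp (-(∫ y, f y ^ 2 ∂S.Phi (n + 1)
      (S.paramN (path X i) n) (empirical (path X i n)) - (∫ y, f y ∂S.Phi (n + 1)
      (S.paramN (path X i) n) (empirical (path X i n))) ^ 2) / 2) : ℝ) : ℂ)) (highProb P)
      (𝓝 0) := by
    have h0 : Tendsto (fun i : Σ N, Ω N => K / √(i.1 : ℝ)) (highProb P) (𝓝 0) :=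
      (tendsto_sqrt_highProb (P := P)).const_div_atTop K
    refine squeeze_zero_norm' ?_ h0
    exact eventually_ne_zero.mono fun i hi => hK i.1 hi (path X i)
  have h5 := h4.add h3
  rw [zero_add] at h5
  exact h5.congr fun i => sub_add_cancel _ _

variable [∀ N, IsProbabilityMeasure (P N)] (hX : ∀ N, S.IsParticleSystem (P N) (X N))

include hX

/-- Conditional central limit theorem for one generation. -/
lemma tendsto_charFun_add_samplingErr (hV : IsTest S.V) {n : ℕ} {f : E → ℝ} (hf : IsTest f)
    (hPhi : ∀ g, IsTest g → Tendsto (fun i : Σ N, Ω N => ∫ y, g y ∂S.Phi (n + 1)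
      (S.paramN (path X i) n) (empirical (path X i n))) (highProb P)
      (𝓝 (∫ y, g y ∂S.target (n + 1))))
    {T : ∀ N, (ℕ → Fin N → E) → ℝ} (hT : ∀ N, Measurable (T N))
    (hpast : ∀ N x, T N (stopPath x n) = T N x) {a : ℂ}
    (hTa : Tendsto (fun N => ∫ ω, Complex.exp (T N (path X ⟨N, ω⟩) * Complex.I) ∂P N) atTop (𝓝 a)) :
    Tendsto (fun N => ∫ ω, Complex.exp
      ((T N (path X ⟨N, ω⟩) + S.samplingErr n f (path X ⟨N, ω⟩) : ℝ) * Complex.I) ∂P N) atTop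
      (𝓝 (a * (Real.exp (-Var[f; S.target (n + 1)] / 2) : ℝ))) := by
  set v : ℂ := ((Real.exp (-Var[f; S.target (n + 1)] / 2) : ℝ) : ℂ) with hv
  have hbv := tendsto_sub_nhds_zero_iff.2 (S.tendsto_samplingFactor (P := P) (X := X) hV hf hPhi)
  -- Dominated convergence replaces the conditional factor by the constant `v`, which then leaves
  -- the integral.
  have h1 := tendsto_integral_of_tendsto_highProb (P := P) (C := 1 + ‖v‖)
    (g := fun i => Complex.exp (T i.1 (path X i) * Complex.I) *
      (S.samplingFactor n f (path X i) - v))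
    (fun i => by
      rw [norm_mul, Complex.norm_exp_ofReal_mul_I, one_mul]
      exact (norm_sub_le _ _).trans
        (add_le_add (S.norm_samplingFactor_le hV n f (path X i)) le_rfl))
    (squeeze_zero_norm (a := fun i => ‖S.samplingFactor n f (path X i) - v‖) (fun i => by
      rw [norm_mul, Complex.norm_exp_ofReal_mul_I, one_mul]) (by rw [← norm_zero (E := ℂ)]; exact hbv.norm))
  have h2 := h1.add (hTa.mul_const v)
  rw [zero_add] at h2
  refine h2.congr' ?_
  filter_upwards [eventually_ne_atTop 0] with N hN
  have hpath : Measurable (fun ω p j => X N p j ω : Ω N → ℕ → Fin N → E) := S.measurable_path (hX N)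
  have hTm : Measurable fun ω => T N (path X ⟨N, ω⟩) := (hT N).comp hpath
  have hi1 : Integrable (fun ω => Complex.exp (T N (path X ⟨N, ω⟩) * Complex.I)) (P N) :=
    integrable_exp_ofReal_mul_I hTm
  have hbm : Measurable fun ω => S.samplingFactor n f (path X ⟨N, ω⟩) :=
    (S.measurable_samplingFactor hV n hf).comp hpath
  have hi2 : Integrable (fun ω => Complex.exp (T N (path X ⟨N, ω⟩) * Complex.I) *
      S.samplingFactor n f (path X ⟨N, ω⟩)) (P N) :=
    hi1.mul_bdd (c := 1) hbm.aestronglyMeasurable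
      (Eventually.of_forall fun ω => S.norm_samplingFactor_le hV n f _)
  refine Eq.trans ?_ (S.integral_exp_add_samplingErr hV hN (hX N) n hf (hT N) (hpast N)).symm
  rw [← integral_mul_const]
  simp only [mul_sub]
  rw [integral_sub hi2 (hi1.mul_const v), sub_add_cancel]
  rfl

end Sampling

/-! ### Induction over the generations and passage to vectors -/

section Induction

variable {E : Type*} [MeasurableSpace E] {d : ℕ} (S : AdaptiveTempering E d)

/-- The rescaled error of the next generation, before resampling. -/
def stepErr (n : ℕ) (s : ℝ) (ψ : E → ℝ) {N : ℕ} (x : ℕ → Fin N → E) : ℝ :=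
  s * (√(N : ℝ) * (S.tempN x (n + 1) - S.temp (n + 1))) +
    √(N : ℝ) * (S.unnormN x n (S.Q (n + 1) (S.paramN x n) ψ) - S.unnorm (n + 1) ψ)

lemma measurable_stepErr (hV : IsTest S.V) (n : ℕ) (s : ℝ) {ψ : E → ℝ} (hψ : Measurable ψ) {N : ℕ} :
    Measurable fun x : ℕ → Fin N → E => S.stepErr n s ψ x := by
  rcases eq_or_ne N 0 with rfl | hN
  · exact Subsingleton.measurable
  have h1 := S.measurable_tempN hV (n + 1) (N := N)
  have h2 := (S.measurable_unnormN hV n (measurable_const (a := (1 : ℝ))) (N := N)).mul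
    (S.measurable_integral_Q hV n (n + 1) hψ)
  have e : (fun x : ℕ → Fin N → E => S.stepErr n s ψ x) = fun x =>
      s * (√(N : ℝ) * (S.tempN x (n + 1) - S.temp (n + 1))) +
        √(N : ℝ) * (S.unnormN x n (fun _ => 1) *
          ∫ y, S.Q (n + 1) (S.paramN x n) ψ y ∂empirical (x n) - S.unnorm (n + 1) ψ) := by
    ext x
    rw [stepErr, S.unnormN_eq_mul hN]
  rw [e]
  exact ((h1.sub_const _).const_mul _ |>.const_mul _).add ((h2.sub_const _).const_mul _)

lemma stepErr_stopPath (n : ℕ) (s : ℝ) (ψ : E → ℝ) {N : ℕ} (x : ℕ → Fin N → E) :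
    S.stepErr n s ψ (stopPath x n) = S.stepErr n s ψ x := by
  have h : ∀ p ≤ n, stopPath x n p = x p := fun p hp => stopPath_eq x hp
  rw [stepErr, stepErr, S.tempN_congr (n + 1) fun p hp => h p (Nat.lt_succ_iff.1 hp),
    S.paramN_congr n h, S.unnormN_congr n h]

/-- The normalising constant of the sampling law cancels against the new factor in the product
defining γ_{n+1}^N. -/
lemma unnormN_mul_integral_Phi (hV : IsTest S.V) {N : ℕ} (hN : N ≠ 0) (x : ℕ → Fin N → E) (n : ℕ)
    {ψ : E → ℝ} (hψ : IsTest ψ) : S.unnormN x n (S.potential (S.paramN x n)) *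
      ∫ y, ψ y ∂S.Phi (n + 1) (S.paramN x n) (empirical (x n)) =
      S.unnormN x n (S.Q (n + 1) (S.paramN x n) ψ) := by
  have := isProbabilityMeasure_empirical hN (x n)
  have h := (S.integral_potential_pos hV (μ := empirical (x n)) (S.paramN x n)).ne'
  rw [S.integral_Phi hV _ _ _ hψ, S.unnormN_eq_mul hN, S.unnormN_eq_mul hN _ _ (S.Q _ _ ψ)]
  field_simp

variable {Ω : ℕ → Type*} {X : ∀ N, ℕ → Fin N → Ω N → E}

/-- Both the first term and the weight γ_{n+1}^N(1) of the sampling error are known at time n. -/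
lemma tempErr_add_unnormErr_succ (hV : IsTest S.V) (n : ℕ) (s : ℝ) {ψ : E → ℝ} (hψ : IsTest ψ)
    {i : Σ N, Ω N} (hi : i.1 ≠ 0) :
    s * S.tempErr X (n + 1) i + S.unnormErr X (n + 1) ψ i = S.stepErr n s ψ (path X i) +
      S.unnormN (path X i) n (S.potential (S.paramN (path X i) n)) *
        S.samplingErr n ψ (path X i) := by
  rw [stepErr, ← S.unnormN_mul_integral_Phi hV hi (path X i) n hψ, samplingErr, tempErr, unnormErr,
    unnormN_succ]
  ring

/-- Cramér–Wold: by linearity a direction `t` becomes a pair (s, ψ) of `HasCLT`. -/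
lemma inner_rescaledError (hV : IsTest S.V) (n : ℕ) {r : ℕ} {φ : Fin r → E → ℝ}
    (hφ : ∀ i, IsTest (φ i)) (t : EuclideanSpace ℝ (Fin (r + 1))) (i : Σ N, Ω N) :
    inner ℝ (S.rescaledError n φ (path X i)) t =
      t 0 * S.tempErr X n i + S.unnormErr X n (fun x => ∑ j, t j.succ * φ j x) i := by
  have h : ∀ s : Finset (Fin r), S.unnormErr X n (fun x => ∑ j ∈ s, t j.succ * φ j x) i =
      ∑ j ∈ s, t j.succ * S.unnormErr X n (φ j) i := by
    intro s
    induction s using Finset.induction_on with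
    | empty => simp [unnormErr, unnormN, unnorm]
    | insert a s ha ih =>
      simp only [Finset.sum_insert ha]
      rw [S.unnormErr_add X hV n ((hφ a).const_mul _) (IsTest.sum s fun j _ => (hφ j).const_mul _),
        unnormErr_const_mul, ih]
  rw [h, PiLp.inner_apply, Fin.sum_univ_succ]
  rfl

variable [∀ N, MeasurableSpace (Ω N)] {P : ∀ N, Measure (Ω N)}
  (hX : ∀ N, S.IsParticleSystem (P N) (X N))

include hX

lemma measurable_rescaledError (hV : IsTest S.V) (n : ℕ) {r : ℕ} {φ : Fin r → E → ℝ}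
    (hφ : ∀ i, IsTest (φ i)) (N : ℕ) :
    Measurable fun ω => S.rescaledError n φ fun p i => X N p i ω := by
  refine (WithLp.measurable_toLp 2 _).comp (measurable_pi_lambda _ fun i => ?_)
  refine Fin.cases ?_ (fun j => ?_) i
  · exact S.measurable_tempErr hX hV n N
  · exact S.measurable_unnormErr hX hV n N (hφ j)

/-- There is no temperature error at time 0 and γ_0 = η_0, so the estimate for i.i.d. sums suffices.
-/
lemma hasCLT_zero (hV : IsTest S.V) : S.HasCLT X P 0 := by
  intro s ψ hψ
  have := S.isProbabilityMeasure_target hV 0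
  obtain ⟨C, hC⟩ := hψ.2
  obtain ⟨K, hK⟩ := exists_norm_charFun_pow_sub_le (E := E) C
  have hu : (S.unnorm 0 fun _ => 1) = 1 := by
    rw [S.unnorm_one hV]
    exact div_self (S.normConst_pos hV _).ne'
  rw [limitVar, hu, one_pow, one_mul, hψ.variance_eq, tendsto_iff_norm_sub_tendsto_zero]
  refine squeeze_zero' (Eventually.of_forall fun _ => norm_nonneg _) (g := fun N : ℕ => K / √(N : ℝ))
    ?_ ((Real.tendsto_sqrt_atTop.comp tendsto_natCast_atTop_atTop).const_div_atTop K)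
  filter_upwards [eventually_ne_atTop 0] with N hN
  have h1 := hK (S.target 0) ψ hψ.1 hC N (Nat.one_le_iff_ne_zero.2 hN)
  have hm := hψ.1
  rw [← S.integral_prod_zero hV (hX N)
    (f := fun y => Complex.exp ((ψ y / √(N : ℝ) : ℝ) * Complex.I)) (by fun_prop),
    ← integral_const_mul] at h1
  refine le_of_eq_of_le ?_ h1
  congr 2
  refine integral_congr_ae (Eventually.of_forall fun ω => ?_)
  beta_reduce
  rw [← exp_sqrt_mul_integral_empirical hN (fun j => X N 0 j ω) hm, ← Complex.exp_add, ← add_mul,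
    ← Complex.ofReal_add]
  congr 3
  have e : S.unnormN (path X ⟨N, ω⟩) 0 ψ = ∫ y, ψ y ∂empirical fun j => X N 0 j ω := by
    simp only [unnormN, Finset.range_zero, Finset.prod_empty, one_mul]
    rfl
  have e' : S.tempN (path X ⟨N, ω⟩) 0 = S.temp 0 := rfl
  rw [tempErr, unnormErr, e, e', S.unnorm_eq_mul hV, hu]
  ring

variable [∀ N, IsProbabilityMeasure (P N)] (hA : S.BoundedContinuous) (hA4 : S.DifferentiableKernels) {n : ℕ} (h : S.HasCLT X P n)
  (hn : (ESS (S.target n) fun x => Real.exp (-(S.βs - S.temp n) * S.V x)) ≠ S.α)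

include hA hA4

-- The error known at time n converges by the hypothesis at the pulled-back pair, and the
-- conditional limit theorem multiplies its limit by a Gaussian factor. The weight γ_{n+1}^N(1) may
-- be replaced by its limit because the sampling error is bounded in probability.
include h hn in
lemma HasCLT.succ : S.HasCLT X P (n + 1) := by
  intro s ψ hψ
  have hV := hA.isTest_V
  have hprob : ∀ᶠ i in highProb P, IsProbabilityMeasure (empirical (path X i n)) :=
    eventually_ne_zero.mono fun i hi => isProbabilityMeasure_empirical hi (path X i n)
  have hg := h.tendsto_unnormN S hX hA hA4 (isTest_const 1)
  have hQ : ∀ f, IsTest f → Tendsto (fun i => S.unnormN (path X i) n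
      (S.Q (n + 1) (S.paramN (path X i) n) f)) (highProb P) (𝓝 (S.unnorm (n + 1) f)) := by
    intro f hf
    have h1 := hg.mul (S.tendsto_integral_Q hA hf hprob
      (fun f hf => h.tendsto_integral S hX hA hA4 hf) (h.tendsto_paramN S hX hA hA4 hn))
    rw [← S.unnorm_eq_mul hV, S.unnorm_Q hA n hf] at h1
    refine h1.congr' ?_
    filter_upwards [eventually_ne_zero] with i hi
    rw [← S.unnormN_eq_mul hi]
  set c : ℝ := S.unnorm (n + 1) fun _ => 1 with hc
  have hc0 : c ≠ 0 := (S.unnorm_one_pos hV (n + 1)).ne'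
  have hcN : Tendsto (fun i => S.unnormN (path X i) n (S.potential (S.paramN (path X i) n)))
      (highProb P) (𝓝 c) := by
    refine (hQ _ (isTest_const 1)).congr fun i => ?_
    congr 1
    ext x
    rw [Q_one]
  have hPhi : ∀ g, IsTest g → Tendsto (fun i : Σ N, Ω N => ∫ y, g y ∂S.Phi (n + 1)
      (S.paramN (path X i) n) (empirical (path X i n))) (highProb P)
      (𝓝 (∫ y, g y ∂S.target (n + 1))) := by
    intro g hg
    have h1 := (hQ g hg).div hcN hc0
    rw [S.unnorm_eq_mul hV, mul_div_cancel_left₀ _ hc0] at h1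
    refine h1.congr' ?_
    filter_upwards [eventually_ne_zero, hcN.eventually_ne hc0] with i hi hi'
    rw [Pi.div_apply, ← S.unnormN_mul_integral_Phi hV hi _ _ hg, mul_div_cancel_left₀ _ hi']
  have hpath : ∀ N, Measurable (fun ω p j => X N p j ω : Ω N → ℕ → Fin N → E) := fun N =>
    S.measurable_path (hX N)
  -- The conditional limit theorem with trivial past `T = 0` isolates the sampling error.
  have hW : BoundedInProb P fun i => S.samplingErr n ψ (path X i) := by
    refine BoundedInProb.of_tendsto_charFun
      (f := fun t => ((Real.exp (-(t ^ 2 * Var[ψ; S.target (n + 1)]) / 2) : ℝ) : ℂ))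
      (fun N => (S.measurable_samplingErr hV n hψ).comp (hpath N)) (by fun_prop) fun t => ?_
    have h1 := S.tendsto_charFun_add_samplingErr hX hV (hψ.const_mul t) hPhi (T := fun _ _ => 0)
      (fun N => measurable_const) (fun _ _ => rfl) (a := 1) (by simp)
    rw [variance_const_mul, one_mul] at h1
    refine h1.congr fun N => ?_
    simp only [zero_add, samplingErr_const_mul]
  have hstep := S.tendsto_charFun_add_samplingErr hX hV (hψ.const_mul c) hPhi
    (T := fun N x => S.stepErr n s ψ x) (fun N => S.measurable_stepErr hV n s hψ.1)
    (fun N x => S.stepErr_stopPath n s ψ x)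
    (tendsto_charFun_of_sub (P := P) (Y := fun i => S.stepErr n s ψ (path X i))
      (fun N => (S.measurable_stepErr hV n s hψ.1).comp (hpath N))
      (fun N => ((S.measurable_tempErr hX hV n N).const_mul (S.pullCoef n s ψ)).add
        (S.measurable_unnormErr hX hV n N (S.isTest_pullFun hV n s hψ)))
      (h.tendsto_step_sub S hX hA hA4 hn s hψ)
      (h (S.pullCoef n s ψ) (S.pullFun n s ψ) (S.isTest_pullFun hV n s hψ)))
  have e : ((Real.exp (-S.limitVar (n + 1) s ψ / 2) : ℝ) : ℂ) =
      (Real.exp (-S.limitVar n (S.pullCoef n s ψ) (S.pullFun n s ψ) / 2) : ℝ) *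
        (Real.exp (-Var[fun y => c * ψ y; S.target (n + 1)] / 2) : ℝ) := by
    rw [← Complex.ofReal_mul, ← Real.exp_add, variance_const_mul, limitVar]
    congr 2
    ring
  rw [e]
  refine tendsto_charFun_of_sub (P := P)
    (Y := fun i => s * S.tempErr X (n + 1) i + S.unnormErr X (n + 1) ψ i)
    (Z := fun i => S.stepErr n s ψ (path X i) + S.samplingErr n (fun y => c * ψ y) (path X i))
    (fun N => ((S.measurable_tempErr hX hV (n + 1) N).const_mul s).add
      (S.measurable_unnormErr hX hV (n + 1) N hψ))
    (fun N => ((S.measurable_stepErr hV n s hψ.1).comp (hpath N)).add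
      ((S.measurable_samplingErr hV n (hψ.const_mul c)).comp (hpath N))) ?_ hstep
  refine (hW.tendsto_mul (tendsto_sub_nhds_zero_iff.2 hcN)).congr' ?_
  filter_upwards [eventually_ne_zero] with i hi
  rw [S.tempErr_add_unnormErr_succ hV n s hψ hi, samplingErr_const_mul]
  ring

/-- The central limit theorem for linear combinations of the errors. -/
lemma hasCLT (n : ℕ) (hn : ∀ k < n,
    (ESS (S.target k) fun x => Real.exp (-(S.βs - S.temp k) * S.V x)) ≠ S.α) :
    S.HasCLT X P n := by
  induction n with
  | zero => exact S.hasCLT_zero hX hA.isTest_V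
  | succ n ih =>
    exact (ih fun k hk => hn k (hk.trans n.lt_succ_self)).succ S hX hA hA4 (hn n n.lt_succ_self)

/-- Convergence of the characteristic functions of the error vector. -/
lemma tendsto_charFun_rescaledError (n : ℕ) (hn : ∀ k < n,
    (ESS (S.target k) fun x => Real.exp (-(S.βs - S.temp k) * S.V x)) ≠ S.α) {r : ℕ}
    {φ : Fin r → E → ℝ} (hφ : ∀ i, IsTest (φ i)) (t : EuclideanSpace ℝ (Fin (r + 1))) :
    Tendsto (fun N => charFun ((P N).map fun ω => S.rescaledError n φ fun p i => X N p i ω) t)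
      atTop (𝓝 (charFun (multivariateGaussian 0 (S.asympCov n φ)) t)) := by
  have hV := hA.isTest_V
  rw [charFun_multivariateGaussian (S.posSemidef_asympCov hV n hφ),
    S.dotProduct_asympCov_mulVec hA hA4 n hφ]
  have h := S.hasCLT hX hA hA4 n hn (t 0) (fun x => ∑ j : Fin r, t j.succ * φ j x)
    (IsTest.sum _ fun j _ => (hφ j).const_mul _)
  convert h using 2 with N
  · rw [charFun_apply, integral_map (S.measurable_rescaledError hX hV n hφ N).aemeasurable
      (by fun_prop)]
    refine integral_congr_ae (Eventually.of_forall fun ω => ?_)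
    beta_reduce
    rw [← S.inner_rescaledError hV n hφ t ⟨N, ω⟩]
    rfl
  · simp [neg_div]

end Induction

end AdaptiveTempering

end

theorem mainTheorem3 {E : Type*} [MeasurableSpace E] {d : ℕ} (S : AdaptiveTempering E d)
    (hA3 : S.BoundedContinuous) (hA4 : S.DifferentiableKernels)
    {Ω : ℕ → Type*} [∀ N, MeasurableSpace (Ω N)] (P : ∀ N, Measure (Ω N))
    [∀ N, IsProbabilityMeasure (P N)] (X : ∀ N, ℕ → Fin N → Ω N → E)
    (hX : ∀ N, S.IsParticleSystem (P N) (X N))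
    (n r : ℕ)
    (hn : ∀ k < n, AdaptiveTempering.ESS (S.target k)
      (fun x => Real.exp (-(S.βs - S.temp k) * S.V x)) ≠ S.α)
    (φ : Fin r → E → ℝ) (hφ : ∀ i, AdaptiveTempering.IsTest (φ i)) :
    (S.asympCov n φ).PosSemidef ∧
    TendstoInDistribution
      (fun N ω => S.rescaledError n φ (fun p i => X N p i ω)) atTop id P
      (multivariateGaussian 0 (S.asympCov n φ)) := by
  have hV := hA3.isTest_V
  -- Positive semidefiniteness is what gives the Gaussian law on the right its expected
  -- characteristic function; the convergence is then Lévy's continuity theorem.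
  refine ⟨S.posSemidef_asympCov hV n hφ,
    fun N => (S.measurable_rescaledError hX hV n hφ N).aemeasurable, aemeasurable_id, ?_⟩
  refine ProbabilityMeasure.tendsto_of_tendsto_charFun fun t => ?_
  simpa using S.tendsto_charFun_rescaledError hX hA3 hA4 n hn hφ t
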